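/- Let $\mathbb{T}^2=\mathbb{R}^2/\mathbb{Z}^2$ with Lebesgue measure $dx$ (total mass $1$), let $\mathcal{N}$ be the Green function of $\mathbb{T}^2$, i.e. $-\Delta\mathcal{N}=\delta_0-1$, $\int_{\mathbb{T}^2}\mathcal{N}\,dx=0$, smooth off $0$ and with $\mathcal{N}(0)=+\infty$, and let $\mathcal{K}=(-\partial_2\mathcal{N},\partial_1\mathcal{N})$ on $\mathbb{T}^2\setminus\{0\}$. Let $\mathcal{P}(\mathbb{T}^2)$ be the space of probability measures with the weak topology (equivalently, that of the Wasserstein-2 metric). For $\gamma\in\mathcal{P}(\mathbb{T}^2)$ put $$e(\gamma)=\frac12\int_{(\mathbb{T}^2)^2}\mathcal{N}(x-y)\,\gamma(dx)\gamma(dy)\in(-\infty,\infty],$$ let $\|\gamma-1\|_2^2$ be the squared $L^2$ distance between the density of $\gamma$ and $1$ ($+\infty$ if $\gamma$ is not absolutely continuous), and for $C^1$ vector fields $\varphi$ on $\mathbb{T}^2$ let $$\langle\varphi,\mathbf{R}(\gamma)\rangle=\frac12\int_{x\neq y}(\varphi(x)-\varphi(y))\cdot\mathcal{K}(x-y)\,\gamma(dx)\gamma(dy).$$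 Let $\nu>0$, $T>0$ and $v\in L^\infty([0,T]\times\mathbb{T}^2;\mathbb{R}^2)$. For $\rho\in C([0,T];\mathcal{P}(\mathbb{T}^2))$ put $$Q_T(\rho)=\sup_{0\le t\le T}\Big(e(\rho(t))+\frac{\nu}{2}\int_0^t\|\rho(s)-1\|_2^2\,ds\Big).$$ Call $\rho\in C([0,T];\mathcal{P}(\mathbb{T}^2))$ a weak solution of $$\partial_t\rho-\nu\Delta\rho+\mathrm{div}\,\mathbf{R}(\rho)+\mathrm{div}(\rho v)=0\qquad(\ast)$$ if $Q_T(\rho)<\infty$ and for all $\phi\in C^\infty([0,T]\times\mathbb{T}^2)$ and $0\le s<t\le T$, $$\langle\phi(t),\rho(t)\rangle-\langle\phi(s),\rho(s)\rangle=\int_s^t\langle\partial_t\phi(r),\rho(r)\rangle\,dr+\nu\int_s^t\langle\Delta\phi(r),\rho(r)\rangle\,dr+\int_s^t\langle\nabla\phi(r),\mathbf{R}(\rho(r))\rangle\,dr+\int_s^t\int_{\mathbb{T}^2}\nabla\phi(r)\cdot v(r)\,d\rho(r)\,dr.$$ **Lemma.** Let $\gamma\in\mathcal{P}(\mathbb{T}^2)$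 with $e(\gamma)<\infty$. If $\rho$ and $\rho'$ are two weak solutions of $(\ast)$, for the same $v$, with $\rho(0)=\rho'(0)=\gamma$, then $\rho'=\rho$, i.e. $\rho'(t)=\rho(t)$ for all $t\in[0,T]$. -/

import Mathlib

open MeasureTheory

noncomputable section

namespace Vortex

/-- The flat two-dimensional torus `ℝ² / ℤ²`. Its `volume` is Lebesgue measure, of total mass `1`. -/
abbrev Torus : Type := UnitAddTorus (Fin 2)

/-- Partial derivative in the direction of the `i`-th coordinate of a function on the torus. -/
def pd (i : Fin 2) (f : Torus → ℝ) (x : Torus) : ℝ :=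
  deriv (fun h : ℝ => f (x + Pi.single i (h : UnitAddCircle))) 0

/-- The gradient `∇ f`. -/
def grad (f : Torus → ℝ) (x : Torus) : Fin 2 → ℝ := fun i => pd i f x

/-- The Laplacian `Δ f`. -/
def lap (f : Torus → ℝ) (x : Torus) : ℝ := ∑ i, pd i (pd i f) x

/-- The heat kernel `∑ₖ exp (-4π²|k|² t) exp (2πi k·x)` of the torus (with generator `Δ`), for
`t > 0`. -/
def heatKernel (t : ℝ) (x : Torus) : ℝ :=
  ∑' k : Fin 2 → ℤ,
    Real.exp (-(4 * Real.pi ^ 2 * ∑ i, (k i : ℝ) ^ 2) * t) * (UnitAddTorus.mFourier k x).re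

/-- The real values of Green's function off the origin, `∫₀^∞ (heatKernel t x - 1) dt`. See
`integrableOn_heatKernel`, `integral_greenReal` and `integral_greenReal_mul_mFourier` below. -/
def greenReal (x : Torus) : ℝ := ∫ t in Set.Ioi (0 : ℝ), (heatKernel t x - 1)

open Classical in
/-- Green's function `𝒩` of the torus: `-Δ 𝒩 = δ₀ - 1`, `∫ 𝒩 = 0`, with the value `+∞` at the
singular point `0`. -/
def green (x : Torus) : EReal := if x = 0 then ⊤ else (greenReal x : EReal)

/-- The Biot–Savart kernel `𝒦 = -∇^⊥ 𝒩 = (-∂₂ 𝒩, ∂₁ 𝒩)`, off the origin. -/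
def biotSavart (x : Torus) : Fin 2 → ℝ := ![-pd 1 greenReal x, pd 0 greenReal x]

/-- The energy `e(γ) = ½ ∬ 𝒩(x - y) γ(dx) γ(dy)`, diagonal included, as the integral of the positive
part minus the integral of the (bounded) negative part. -/
def energy (γ : ProbabilityMeasure Torus) : EReal :=
  ((1 / 2 : ℝ) : EReal) *
    (((∫⁻ p : Torus × Torus, (green (p.1 - p.2)).toENNReal
        ∂((γ : Measure Torus).prod (γ : Measure Torus)) : ENNReal) : EReal)
      - ((∫⁻ p : Torus × Torus, (-green (p.1 - p.2)).toENNReal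
        ∂((γ : Measure Torus).prod (γ : Measure Torus)) : ENNReal) : EReal))

open Classical in
/-- `‖γ - 1‖₂²`, the squared `L²` distance of the density of `γ` to `1`; it is `∞` if `γ` has no
density. -/
def sqDistToOne (γ : ProbabilityMeasure Torus) : ENNReal :=
  if (γ : Measure Torus) ≪ volume then
    ∫⁻ x : Torus, ENNReal.ofReal ((((γ : Measure Torus).rnDeriv volume x).toReal - 1) ^ 2)
  else ⊤

/-- `Q_T(ρ) = sup_{0 ≤ t ≤ T} (e(ρ(t)) + (ν/2) ∫₀ᵗ ‖ρ(s) - 1‖₂² ds)`. -/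
def Q (ν T : ℝ) (ρ : ℝ → ProbabilityMeasure Torus) : EReal :=
  ⨆ t ∈ Set.Icc (0 : ℝ) T,
    (energy (ρ t)
      + ((ν / 2 : ℝ) : EReal) *
        ((∫⁻ s in Set.Icc (0 : ℝ) t, sqDistToOne (ρ s) : ENNReal) : EReal))

/-- The symmetrised nonlinearity
`⟨φ, R(γ)⟩ = ½ ∬_{x ≠ y} (φ(x) - φ(y)) · 𝒦(x - y) γ(dx) γ(dy)`, for a vector field `φ`. -/
def pairR (φ : Torus → Fin 2 → ℝ) (γ : ProbabilityMeasure Torus) : ℝ :=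
  (1 / 2) * ∫ p in {p : Torus × Torus | p.1 ≠ p.2},
    (φ p.1 - φ p.2) ⬝ᵥ biotSavart (p.1 - p.2)
      ∂((γ : Measure Torus).prod (γ : Measure Torus))

/-- Smooth test functions of time and space, in terms of the lift to `ℝ × ℝ²`. Only the values at
times in `[0, T]` will matter, and every function that is smooth on `[0, T] × 𝕋²` up to the
boundary is the restriction of one of these. -/
def IsTestFunction (φ : ℝ → Torus → ℝ) : Prop :=
  ContDiff ℝ (⊤ : ℕ∞)
    (fun p : ℝ × (Fin 2 → ℝ) => φ p.1 (fun i => (p.2 i : UnitAddCircle)))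

/-- `v ∈ L^∞([0, T] × 𝕋²; ℝ²)`. -/
def IsBoundedField (T : ℝ) (v : ℝ → Torus → Fin 2 → ℝ) : Prop :=
  MemLp (fun p : ℝ × Torus => v p.1 p.2) ⊤
    ((volume.restrict (Set.Icc (0 : ℝ) T)).prod (volume : Measure Torus))

/-- Weak solutions on `[0, T]` of `∂ₜ ρ - ν Δ ρ + div R(ρ) + div (ρ v) = 0`. Only the values of `ρ`
at times in `[0, T]` matter. -/
structure IsWeakSolution (ν T : ℝ) (v : ℝ → Torus → Fin 2 → ℝ)
    (ρ : ℝ → ProbabilityMeasure Torus) : Prop where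
  continuousOn : ContinuousOn ρ (Set.Icc 0 T)
  Q_lt_top : Q ν T ρ < ⊤
  weak_eq : ∀ φ : ℝ → Torus → ℝ, IsTestFunction φ → ∀ s t : ℝ, 0 ≤ s → s < t → t ≤ T →
    (∫ x, φ t x ∂(ρ t : Measure Torus)) - (∫ x, φ s x ∂(ρ s : Measure Torus))
      = (∫ r in s..t, ∫ x, deriv (fun τ => φ τ x) r ∂(ρ r : Measure Torus))
        + ν * (∫ r in s..t, ∫ x, lap (φ r) x ∂(ρ r : Measure Torus))
        + (∫ r in s..t, pairR (grad (φ r)) (ρ r))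
        + ∫ r in s..t, ∫ x, grad (φ r) x ⬝ᵥ v r x ∂(ρ r : Measure Torus)

/-! Facts about `greenReal`: the integral that defines it converges off the origin, and it has
mean zero and solves `-Δ 𝒩 = δ₀ - 1`. -/

lemma hasSum_circle (a : UnitAddCircle) {t : ℝ} (ht : 0 < t) :
    HasSum (fun n : ℤ => ((Real.exp (-(4 * Real.pi ^ 2 * (n : ℝ) ^ 2) * t) : ℝ) : ℂ) * fourier n a)
      ((HurwitzZeta.cosKernel a (4 * Real.pi * t) : ℝ) : ℂ) := by
  induction a using QuotientAddGroup.induction_on with | H a =>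
  have h := HurwitzZeta.hasSum_int_cosKernel a (t := 4 * Real.pi * t) (by positivity)
  refine h.congr_fun fun n => ?_
  have e : ((a : ℝ) : UnitAddCircle) = (QuotientAddGroup.mk a : UnitAddCircle) := rfl
  rw [← e, fourier_coe_apply, mul_comm]
  congr 2
  · push_cast; ring
  · congr 1; ring

lemma summable_weight {t : ℝ} (ht : 0 < t) :
    Summable (fun n : ℤ => Real.exp (-(4 * Real.pi ^ 2 * (n : ℝ) ^ 2) * t)) := by
  have h := (hasSum_circle 0 ht).summable.norm
  refine h.congr fun n => ?_
  rw [norm_mul, Complex.norm_real, Real.norm_of_nonneg (Real.exp_pos _).le]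
  simp

lemma hasSum_heatKernel {t : ℝ} (ht : 0 < t) (x : Torus) :
    HasSum (fun k : Fin 2 → ℤ =>
      ((Real.exp (-(4 * Real.pi ^ 2 * ∑ i, (k i : ℝ) ^ 2) * t) : ℝ) : ℂ) *
        UnitAddTorus.mFourier k x) ((heatKernel t x : ℝ) : ℂ) ∧
    heatKernel t x = HurwitzZeta.cosKernel (x 0) (4 * Real.pi * t) *
      HurwitzZeta.cosKernel (x 1) (4 * Real.pi * t) ∧
    Summable (fun k : Fin 2 → ℤ => Real.exp (-(4 * Real.pi ^ 2 * ∑ i, (k i : ℝ) ^ 2) * t)) := by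
  have hsum : Summable (fun k : Fin 2 → ℤ =>
      Real.exp (-(4 * Real.pi ^ 2 * ∑ i, (k i : ℝ) ^ 2) * t)) := by
    have := (summable_weight ht).mul_of_nonneg (summable_weight ht)
      (fun n => (Real.exp_pos _).le) (fun n => (Real.exp_pos _).le)
    rw [← (finTwoArrowEquiv ℤ).symm.summable_iff]
    refine this.congr fun p => ?_
    simp only [Function.comp, finTwoArrowEquiv_symm_apply, Fin.sum_univ_two, Matrix.cons_val_zero,
      Matrix.cons_val_one, ← Real.exp_add]
    congr 1; ring
  have h2 : HasSum (fun k : Fin 2 → ℤ =>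
      ((Real.exp (-(4 * Real.pi ^ 2 * ∑ i, (k i : ℝ) ^ 2) * t) : ℝ) : ℂ) *
        UnitAddTorus.mFourier k x) ((HurwitzZeta.cosKernel (x 0) (4 * Real.pi * t) *
      HurwitzZeta.cosKernel (x 1) (4 * Real.pi * t) : ℝ) : ℂ) := by
    have h0 := hasSum_circle (x 0) ht
    have h1 := hasSum_circle (x 1) ht
    have key : ∀ (f g : ℤ → ℂ) (a b : ℂ), HasSum f a → HasSum g b →
        HasSum (fun p : ℤ × ℤ => f p.1 * g p.2) (a * b) := fun f g a b hf hg =>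
      HasSum.mul hf hg (summable_mul_of_summable_norm hf.summable.norm hg.summable.norm)
    have hm := key _ _ _ _ h0 h1
    rw [← (finTwoArrowEquiv ℤ).symm.hasSum_iff]
    push_cast
    refine hm.congr_fun fun p => ?_
    simp only [Function.comp, finTwoArrowEquiv_symm_apply, Fin.sum_univ_two, Matrix.cons_val_zero,
      Matrix.cons_val_one, UnitAddTorus.mFourier, ContinuousMap.coe_mk, Fin.prod_univ_two]
    push_cast
    rw [mul_mul_mul_comm, ← Complex.exp_add]
    congr 2; ring
  have he : heatKernel t x = HurwitzZeta.cosKernel (x 0) (4 * Real.pi * t) *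
      HurwitzZeta.cosKernel (x 1) (4 * Real.pi * t) := by
    have h3 := Complex.hasSum_re h2
    rw [Complex.ofReal_re] at h3
    rw [← h3.tsum_eq, heatKernel]
    congr 1; ext k; rw [Complex.re_ofReal_mul]
  exact ⟨by rw [he]; exact h2, he, hsum⟩

lemma cosKernel_nonneg (a : UnitAddCircle) {s : ℝ} (hs : 0 < s) :
    0 ≤ HurwitzZeta.cosKernel a s := by
  have h := HurwitzZeta.evenKernel_functional_equation a (1 / s)
  rw [one_div_one_div] at h
  have h0 : 0 ≤ HurwitzZeta.evenKernel a (1 / s) := by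
    induction a using QuotientAddGroup.induction_on with | H a =>
    exact (HurwitzZeta.hasSum_int_evenKernel a (by positivity)).nonneg fun n => (Real.exp_pos _).le
  rw [h] at h0
  exact nonneg_of_mul_nonneg_right h0 (by positivity)

lemma heatKernel_nonneg {t : ℝ} (ht : 0 < t) (x : Torus) : 0 ≤ heatKernel t x := by
  rw [(hasSum_heatKernel ht x).2.1]
  exact mul_nonneg (cosKernel_nonneg _ (by positivity)) (cosKernel_nonneg _ (by positivity))

lemma measurable_heatKernel : Measurable (fun p : ℝ × Torus => heatKernel p.1 p.2) := by
  unfold heatKernel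
  refine Measurable.tsum fun k => ?_
  fun_prop

lemma abs_heatKernel_sub_one_le {t : ℝ} (ht : 1 ≤ t) (x : Torus) :
    |heatKernel t x - 1| ≤ Real.exp (-(4 * Real.pi ^ 2) * (t - 1)) *
      ∑' k : Fin 2 → ℤ, Real.exp (-(4 * Real.pi ^ 2 * ∑ i, (k i : ℝ) ^ 2) * 1) := by
  classical
  have h := (hasSum_heatKernel (lt_of_lt_of_le one_pos ht) x).1
  have h0 := hasSum_ite_sub_hasSum h 0
  have hs := ((hasSum_heatKernel one_pos x).2.2.hasSum).mul_left
    (Real.exp (-(4 * Real.pi ^ 2) * (t - 1)))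
  simp only [UnitAddTorus.mFourier_zero] at h0
  have := h0.norm_le_of_bounded hs (fun k => ?_)
  · simp only [Pi.zero_apply, Int.cast_zero, ne_eq, OfNat.ofNat_ne_zero, not_false_eq_true, zero_pow,
      Finset.sum_const_zero, mul_zero, neg_zero, zero_mul, Real.exp_zero, Complex.ofReal_one,
      ContinuousMap.one_apply, mul_one] at this
    rw [← Complex.ofReal_one, ← Complex.ofReal_sub, Complex.norm_real] at this
    simpa using this
  · split_ifs with hk
    · simp; positivity
    · have hk1 : (1 : ℝ) ≤ ∑ i, (k i : ℝ) ^ 2 := by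
        obtain ⟨i, hi⟩ := Function.ne_iff.mp hk
        have h1 : (1 : ℝ) ≤ (k i : ℝ) ^ 2 := by
          have : (1 : ℤ) ≤ (k i) ^ 2 := by
            have : 0 < (k i) ^ 2 := by
              have : k i ≠ 0 := hi
              positivity
            omega
          exact_mod_cast this
        exact h1.trans (Finset.single_le_sum (f := fun i => (k i : ℝ) ^ 2)
          (fun i _ => sq_nonneg _) (Finset.mem_univ i))
      have hn : ‖UnitAddTorus.mFourier k x‖ ≤ 1 :=
        ((UnitAddTorus.mFourier k).norm_coe_le_norm x).trans UnitAddTorus.mFourier_norm.le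
      rw [norm_mul, Complex.norm_real, Real.norm_of_nonneg (Real.exp_pos _).le, ← Real.exp_add]
      refine (mul_le_of_le_one_right (Real.exp_pos _).le hn).trans (Real.exp_le_exp.mpr ?_)
      have : 0 ≤ Real.pi ^ 2 * (t - 1) * (∑ i, (k i : ℝ) ^ 2 - 1) :=
        mul_nonneg (mul_nonneg (sq_nonneg _) (by linarith)) (by linarith)
      nlinarith

lemma volume_torus_univ : (volume : Measure Torus).real Set.univ = 1 := by
  rw [measureReal_def, ← Set.pi_univ, volume_pi_pi]
  simp

lemma integral_mFourier (n : Fin 2 → ℤ) :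
    ∫ x : Torus, UnitAddTorus.mFourier n x = if n = 0 then 1 else 0 := by
  have hc : ∀ m : ℤ, ∫ a : UnitAddCircle, fourier m a = if m = 0 then (1 : ℂ) else 0 := by
    intro m
    split_ifs with hm
    · subst hm; simp [measureReal_def]
    · exact integral_eq_zero_of_add_right_eq_neg (fourier_add_half_inv_index hm one_pos)
  simp only [UnitAddTorus.mFourier, ContinuousMap.coe_mk]
  rw [integral_fintype_prod_volume_eq_prod (fun i (a : UnitAddCircle) => (fourier (n i) a : ℂ)),
    Fin.prod_univ_two, hc, hc]
  by_cases h0 : n 0 = 0 <;> by_cases h1 : n 1 = 0 <;> simp [h0, h1, funext_iff, Fin.forall_fin_two]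

lemma continuous_heatKernel {t : ℝ} (ht : 0 < t) : Continuous (heatKernel t) := by
  unfold heatKernel
  refine continuous_tsum (fun k => by fun_prop) (hasSum_heatKernel ht 0).2.2 (fun k x => ?_)
  rw [norm_mul, Real.norm_of_nonneg (Real.exp_pos _).le]
  refine mul_le_of_le_one_right (Real.exp_pos _).le ?_
  exact (Complex.abs_re_le_norm _).trans
    (((UnitAddTorus.mFourier k).norm_coe_le_norm x).trans UnitAddTorus.mFourier_norm.le)

lemma integrable_heatKernel {t : ℝ} (ht : 0 < t) : Integrable (heatKernel t) :=
  (continuous_heatKernel ht).integrable_of_hasCompactSupport (HasCompactSupport.of_compactSpace _)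

lemma integral_heatKernel_mul {t : ℝ} (ht : 0 < t) (n : Fin 2 → ℤ) :
    ∫ x : Torus, (heatKernel t x : ℂ) * UnitAddTorus.mFourier (-n) x =
      (Real.exp (-(4 * Real.pi ^ 2 * ∑ i, (n i : ℝ) ^ 2) * t) : ℝ) := by
  have hb : ∀ (k : Fin 2 → ℤ) (x : Torus), ‖UnitAddTorus.mFourier k x‖ ≤ 1 := fun k x =>
    ((UnitAddTorus.mFourier k).norm_coe_le_norm x).trans UnitAddTorus.mFourier_norm.le
  set w : (Fin 2 → ℤ) → ℝ := fun k => Real.exp (-(4 * Real.pi ^ 2 * ∑ i, (k i : ℝ) ^ 2) * t) with hw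
  have hw0 : ∀ k, 0 ≤ w k := fun k => (Real.exp_pos _).le
  have hs : Summable w := (hasSum_heatKernel ht 0).2.2
  have h := hasSum_integral_of_dominated_convergence (μ := (volume : Measure Torus))
    (F := fun k x => (w k : ℂ) * (UnitAddTorus.mFourier k x * UnitAddTorus.mFourier (-n) x))
    (f := fun x => (heatKernel t x : ℂ) * UnitAddTorus.mFourier (-n) x)
    (fun k _ => w k) (fun k => by
      refine Continuous.aestronglyMeasurable ?_
      fun_prop)
    (fun k => Filter.Eventually.of_forall fun x => by
      rw [norm_mul, norm_mul, Complex.norm_real, Real.norm_of_nonneg (hw0 k)]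
      exact mul_le_of_le_one_right (hw0 k) (mul_le_one₀ (hb _ _) (norm_nonneg _) (hb _ _)))
    (Filter.Eventually.of_forall fun x => hs) (integrable_const _)
    (Filter.Eventually.of_forall fun x => by
      refine ((hasSum_heatKernel ht x).1.mul_right (UnitAddTorus.mFourier (-n) x)).congr_fun
        fun k => ?_
      exact (mul_assoc _ _ _).symm)
  have e : ∀ k, ∫ x : Torus, (w k : ℂ) * (UnitAddTorus.mFourier k x * UnitAddTorus.mFourier (-n) x) =
      if k = n then (w n : ℂ) else 0 := by
    intro k
    rw [integral_const_mul]
    simp_rw [← UnitAddTorus.mFourier_add]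
    rw [integral_mFourier]
    by_cases hk : k = n
    · simp [hk]
    · rw [if_neg hk, if_neg (fun h => hk (by rwa [add_neg_eq_zero] at h)), mul_zero]
  simp_rw [e] at h
  exact h.unique (hasSum_ite_eq n _)

lemma integral_heatKernel {t : ℝ} (ht : 0 < t) : ∫ x : Torus, heatKernel t x = 1 := by
  have h := integral_heatKernel_mul ht 0
  simp only [neg_zero, UnitAddTorus.mFourier_zero, ContinuousMap.one_apply, mul_one, Pi.zero_apply,
    Int.cast_zero, ne_eq, OfNat.ofNat_ne_zero, not_false_eq_true, zero_pow,
      Finset.sum_const_zero, mul_zero, neg_zero, zero_mul, Real.exp_zero] at h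
  rw [integral_complex_ofReal] at h
  exact_mod_cast h

lemma integrable_heatKernel_prod :
    Integrable (fun p : ℝ × Torus => heatKernel p.1 p.2 - 1)
      ((volume.restrict (Set.Ioi (0 : ℝ))).prod (volume : Measure Torus)) := by
  have hm : Measurable (fun p : ℝ × Torus => heatKernel p.1 p.2 - 1) :=
    measurable_heatKernel.sub_const 1
  rw [integrable_prod_iff hm.aestronglyMeasurable]
  have hi : ∀ t : ℝ, 0 < t → Integrable (fun x : Torus => heatKernel t x - 1) := fun t ht =>
    (integrable_heatKernel ht).sub (integrable_const _)
  refine ⟨(ae_restrict_iff' measurableSet_Ioi).2 (Filter.Eventually.of_forall fun t ht => hi t ht), ?_⟩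
  set C := ∑' k : Fin 2 → ℤ, Real.exp (-(4 * Real.pi ^ 2 * ∑ i, (k i : ℝ) ^ 2) * 1)
  have hms : AEStronglyMeasurable (fun t : ℝ => ∫ x : Torus, ‖heatKernel t x - 1‖) volume :=
    (hm.norm.stronglyMeasurable.integral_prod_right).aestronglyMeasurable
  rw [← IntegrableOn, ← Set.Ioc_union_Ioi_eq_Ioi (zero_le_one (α := ℝ))]
  refine IntegrableOn.union ?_ ?_
  · refine Measure.integrableOn_of_bounded (M := 2) (by simp) hms ?_
    refine (ae_restrict_iff' measurableSet_Ioc).2 (Filter.Eventually.of_forall fun t ht => ?_)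
    rw [Real.norm_of_nonneg (integral_nonneg fun x => norm_nonneg _)]
    calc ∫ x : Torus, ‖heatKernel t x - 1‖ ≤ ∫ x : Torus, (heatKernel t x + 1) := by
          refine integral_mono (hi t ht.1).norm ((integrable_heatKernel ht.1).add (integrable_const _))
            fun x => ?_
          have := heatKernel_nonneg ht.1 x
          rw [Real.norm_eq_abs, abs_le]
          constructor <;> linarith
      _ = 2 := by
          rw [integral_add (integrable_heatKernel ht.1) (integrable_const _), integral_heatKernel ht.1]
          simp [volume_torus_univ]; norm_num
  · have hexp : IntegrableOn (fun t : ℝ => Real.exp (-(4 * Real.pi ^ 2) * (t - 1)) * C)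
        (Set.Ioi 1) := by
      refine Integrable.mul_const ?_ C
      have := (integrableOn_exp_mul_Ioi (a := -(4 * Real.pi ^ 2))
        (by have := Real.pi_pos; nlinarith) 1).mul_const (Real.exp (4 * Real.pi ^ 2))
      refine this.congr (Filter.Eventually.of_forall fun t => ?_)
      simp only [← Real.exp_add]
      congr 1; ring
    refine Integrable.mono' hexp hms.restrict ?_
    refine (ae_restrict_iff' measurableSet_Ioi).2 (Filter.Eventually.of_forall fun t ht => ?_)
    rw [Real.norm_of_nonneg (integral_nonneg fun x => norm_nonneg _)]
    have ht' : (1 : ℝ) < t := ht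
    calc ∫ x : Torus, ‖heatKernel t x - 1‖
        ≤ ∫ _x : Torus, Real.exp (-(4 * Real.pi ^ 2) * (t - 1)) * C :=
          integral_mono (hi t (by linarith)).norm (integrable_const _)
            fun x => abs_heatKernel_sub_one_le ht'.le x
      _ = _ := by simp [volume_torus_univ]

/-- Green's function is integrable. -/
lemma integrable_greenReal : Integrable greenReal (volume : Measure Torus) :=
  integrable_heatKernel_prod.integral_prod_right

lemma weight_pos {n : Fin 2 → ℤ} (hn : n ≠ 0) : 0 < 4 * Real.pi ^ 2 * ∑ i, (n i : ℝ) ^ 2 := by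
  obtain ⟨i, hi⟩ := Function.ne_iff.mp hn
  have hi' : (n i : ℝ) ≠ 0 := by exact_mod_cast hi
  have : 0 < ∑ i, (n i : ℝ) ^ 2 :=
    Finset.sum_pos' (fun i _ => sq_nonneg _) ⟨i, Finset.mem_univ i, by positivity⟩
  positivity

lemma integral_greenReal_mul (n : Fin 2 → ℤ) :
    ∫ x : Torus, (greenReal x : ℂ) * UnitAddTorus.mFourier (-n) x =
      if n = 0 then 0 else (((4 * Real.pi ^ 2 * ∑ i, (n i : ℝ) ^ 2)⁻¹ : ℝ) : ℂ) := by
  have hint : Integrable (fun p : Torus × ℝ =>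
      ((heatKernel p.2 p.1 - 1 : ℝ) : ℂ) * UnitAddTorus.mFourier (-n) p.1)
      ((volume : Measure Torus).prod (volume.restrict (Set.Ioi (0 : ℝ)))) := by
    refine Integrable.mul_bdd (c := 1) integrable_heatKernel_prod.swap.ofReal ?_ ?_
    · refine Continuous.aestronglyMeasurable ?_
      fun_prop
    · exact Filter.Eventually.of_forall fun p =>
        ((UnitAddTorus.mFourier (-n)).norm_coe_le_norm p.1).trans UnitAddTorus.mFourier_norm.le
  have h1 : ∀ x : Torus, (greenReal x : ℂ) * UnitAddTorus.mFourier (-n) x =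
      ∫ t in Set.Ioi (0 : ℝ), ((heatKernel t x - 1 : ℝ) : ℂ) * UnitAddTorus.mFourier (-n) x := by
    intro x
    rw [integral_mul_const, integral_complex_ofReal, greenReal]
  simp_rw [h1]
  rw [integral_integral_swap hint]
  have h2 : ∀ t ∈ Set.Ioi (0 : ℝ),
      ∫ x : Torus, ((heatKernel t x - 1 : ℝ) : ℂ) * UnitAddTorus.mFourier (-n) x =
      ((if n = 0 then 0 else Real.exp (-(4 * Real.pi ^ 2 * ∑ i, (n i : ℝ) ^ 2) * t) : ℝ) : ℂ) := by
    intro t ht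
    have hcont := continuous_heatKernel ht
    simp only [Complex.ofReal_sub, Complex.ofReal_one, sub_mul, one_mul]
    rw [integral_sub, integral_heatKernel_mul ht, integral_mFourier]
    · by_cases hn : n = 0 <;> simp [hn]
    · refine Continuous.integrable_of_hasCompactSupport ?_ (HasCompactSupport.of_compactSpace _)
      fun_prop
    · refine Continuous.integrable_of_hasCompactSupport ?_ (HasCompactSupport.of_compactSpace _)
      fun_prop
  rw [setIntegral_congr_fun measurableSet_Ioi h2, integral_complex_ofReal]
  by_cases hn : n = 0
  · simp [hn]
  · have hc := weight_pos hn
    simp only [hn, if_false]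
    rw [integral_exp_mul_Ioi (by linarith)]
    simp

/-- `-Δ 𝒩 = δ₀ - 1`, tested against the characters of the torus. -/
lemma integral_greenReal_mul_mFourier (n : Fin 2 → ℤ) :
    ((4 * Real.pi ^ 2 * ∑ i, (n i : ℝ) ^ 2 : ℝ) : ℂ) *
        ∫ x : Torus, (greenReal x : ℂ) * UnitAddTorus.mFourier (-n) x =
      UnitAddTorus.mFourier (-n) 0 - ∫ x : Torus, UnitAddTorus.mFourier (-n) x := by
  rw [integral_greenReal_mul, integral_mFourier]
  have h1 : UnitAddTorus.mFourier (-n) (0 : Torus) = 1 := by simp [UnitAddTorus.mFourier]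
  rw [h1]
  by_cases hn : n = 0
  · simp [hn]
  · have hc := weight_pos hn
    simp only [neg_eq_zero, hn, if_false, sub_zero]
    rw [← Complex.ofReal_mul, mul_inv_cancel₀ hc.ne', Complex.ofReal_one]

/-- `∫ 𝒩 = 0`. -/
lemma integral_greenReal : ∫ x : Torus, greenReal x = 0 := by
  have h := integral_greenReal_mul 0
  simp only [neg_zero, UnitAddTorus.mFourier_zero, ContinuousMap.one_apply, mul_one, if_true] at h
  rw [integral_complex_ofReal] at h
  exact_mod_cast h

lemma isBigO_evenKernel (a : UnitAddCircle) :
    (HurwitzZeta.evenKernel a) =O[Filter.atTop] (fun _ => (1 : ℝ)) := by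
  obtain ⟨p, hp, h⟩ := HurwitzZeta.isBigO_atTop_evenKernel_sub a
  have h1 : (fun y : ℝ => Real.exp (-p * y)) =O[Filter.atTop] (fun _ => (1 : ℝ)) := by
    refine Asymptotics.IsBigO.of_bound 1 ?_
    filter_upwards [Filter.eventually_ge_atTop 0] with y hy
    rw [Real.norm_of_nonneg (Real.exp_pos _).le, norm_one, one_mul, Real.exp_le_one_iff]
    nlinarith
  have h2 := (h.trans h1).add
    (Asymptotics.isBigO_const_const (if a = 0 then (1 : ℝ) else 0) one_ne_zero Filter.atTop)
  simpa using h2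

lemma isBigO_evenKernel_of_ne {a : UnitAddCircle} (ha : a ≠ 0) :
    (fun y : ℝ => y * HurwitzZeta.evenKernel a y) =O[Filter.atTop] (fun _ => (1 : ℝ)) := by
  obtain ⟨p, hp, h⟩ := HurwitzZeta.isBigO_atTop_evenKernel_sub a
  simp only [ha, if_false, sub_zero] at h
  have h1 : (fun y : ℝ => y * Real.exp (-p * y)) =O[Filter.atTop] (fun _ => (1 : ℝ)) := by
    refine Asymptotics.IsBigO.of_bound (1 / p) ?_
    filter_upwards [Filter.eventually_ge_atTop 0] with y hy
    rw [Real.norm_of_nonneg (mul_nonneg hy (Real.exp_pos _).le), norm_one, mul_one,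
      le_div_iff₀ hp, neg_mul, Real.exp_neg, ← div_eq_mul_inv, div_mul_eq_mul_div,
      div_le_one (Real.exp_pos _)]
    have := Real.add_one_le_exp (p * y)
    linarith
  exact ((Asymptotics.isBigO_refl (fun y : ℝ => y) _).mul h).trans h1

/-- The integral defining `𝒩` converges off the origin. -/
lemma integrableOn_heatKernel {x : Torus} (hx : x ≠ 0) :
    IntegrableOn (fun t => heatKernel t x - 1) (Set.Ioi 0) := by
  have hm : Measurable (fun t : ℝ => heatKernel t x - 1) :=
    (measurable_heatKernel.sub_const 1).comp measurable_prodMk_right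
  have hev : (fun y : ℝ => y * (HurwitzZeta.evenKernel (x 0) y * HurwitzZeta.evenKernel (x 1) y))
      =O[Filter.atTop] (fun _ => (1 : ℝ)) := by
    obtain ⟨i, hi⟩ := Function.ne_iff.mp hx
    have hi' : x i ≠ 0 := hi
    fin_cases i
    · refine ((isBigO_evenKernel_of_ne hi').mul (isBigO_evenKernel (x 1))).congr ?_ ?_
      · intro y; simp only [Fin.zero_eta]; ring
      · intro y; simp
    · refine ((isBigO_evenKernel_of_ne hi').mul (isBigO_evenKernel (x 0))).congr ?_ ?_
      · intro y; simp only [Fin.mk_one]; ring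
      · intro y; simp
  obtain ⟨M, hM⟩ := hev.bound
  obtain ⟨Y, hY⟩ := Filter.eventually_atTop.mp hM
  have hpi := Real.pi_pos
  set Y' := max Y 1 with hY'
  have hY'1 : 1 ≤ Y' := le_max_right _ _
  set d : ℝ := 1 / (4 * Real.pi * Y') with hd
  have hd0 : 0 < d := by positivity
  have hd1 : d ≤ 1 := by
    rw [hd, div_le_one (by positivity)]
    nlinarith [Real.pi_gt_three]
  have hcos : ∀ a : UnitAddCircle, ∀ s : ℝ, 0 < s →
      HurwitzZeta.cosKernel a s = s⁻¹ ^ (1 / 2 : ℝ) * HurwitzZeta.evenKernel a (1 / s) := by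
    intro a s hs
    rw [HurwitzZeta.evenKernel_functional_equation, one_div_one_div, ← mul_assoc, one_div s,
      mul_one_div_cancel (by positivity), one_mul]
  rw [← Set.Ioc_union_Ioi_eq_Ioi hd0.le, ← Set.Ioc_union_Ioi_eq_Ioi hd1]
  refine IntegrableOn.union ?_ (IntegrableOn.union ?_ ?_)
  · refine Measure.integrableOn_of_bounded (M := M + 1) (by simp) hm.aestronglyMeasurable ?_
    refine (ae_restrict_iff' measurableSet_Ioc).2 (Filter.Eventually.of_forall fun t ht => ?_)
    have ht0 : 0 < t := ht.1
    have hs : 0 < 4 * Real.pi * t := by positivity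
    have hy : Y ≤ 1 / (4 * Real.pi * t) := by
      refine (le_max_left Y 1).trans ?_
      rw [le_div_iff₀ hs]
      have := ht.2
      rw [hd, le_div_iff₀ (by positivity)] at this
      nlinarith
    have hb := hY _ hy
    have he : heatKernel t x = 1 / (4 * Real.pi * t) *
        (HurwitzZeta.evenKernel (x 0) (1 / (4 * Real.pi * t)) *
          HurwitzZeta.evenKernel (x 1) (1 / (4 * Real.pi * t))) := by
      rw [(hasSum_heatKernel ht0 x).2.1, hcos _ _ hs, hcos _ _ hs, mul_mul_mul_comm,
        ← Real.rpow_add (by positivity), add_halves, Real.rpow_one, one_div]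
    rw [← he, norm_one, mul_one] at hb
    calc ‖heatKernel t x - 1‖ ≤ ‖heatKernel t x‖ + ‖(1 : ℝ)‖ := norm_sub_le _ _
      _ ≤ M + 1 := by rw [norm_one]; linarith
  · refine IntegrableOn.mono_set ?_ Set.Ioc_subset_Icc_self
    refine ContinuousOn.integrableOn_Icc ?_
    refine ContinuousOn.congr (f := fun t => HurwitzZeta.cosKernel (x 0) (4 * Real.pi * t) *
      HurwitzZeta.cosKernel (x 1) (4 * Real.pi * t) - 1) ?_ ?_
    · have hmap : Set.MapsTo (fun t : ℝ => 4 * Real.pi * t) (Set.Icc d 1) (Set.Ioi 0) := by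
        intro t ht
        have : 0 < t := hd0.trans_le ht.1
        exact Set.mem_Ioi.2 (by positivity)
      have hl : ContinuousOn (fun t : ℝ => 4 * Real.pi * t) (Set.Icc d 1) := by fun_prop
      exact (((HurwitzZeta.continuousOn_cosKernel (x 0)).comp hl hmap).mul
        ((HurwitzZeta.continuousOn_cosKernel (x 1)).comp hl hmap)).sub continuousOn_const
    · intro t ht
      simp only [(hasSum_heatKernel (hd0.trans_le ht.1) x).2.1]
  · have hexp : IntegrableOn (fun t : ℝ => Real.exp (-(4 * Real.pi ^ 2) * (t - 1)) *
        ∑' k : Fin 2 → ℤ, Real.exp (-(4 * Real.pi ^ 2 * ∑ i, (k i : ℝ) ^ 2) * 1)) (Set.Ioi 1) := by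
      refine Integrable.mul_const ?_ _
      have := (integrableOn_exp_mul_Ioi (a := -(4 * Real.pi ^ 2)) (by nlinarith) 1).mul_const
        (Real.exp (4 * Real.pi ^ 2))
      refine this.congr (Filter.Eventually.of_forall fun t => ?_)
      simp only [← Real.exp_add]
      congr 1; ring
    refine Integrable.mono' hexp hm.aestronglyMeasurable ?_
    refine (ae_restrict_iff' measurableSet_Ioi).2 (Filter.Eventually.of_forall fun t ht => ?_)
    exact abs_heatKernel_sub_one_le (le_of_lt ht) x

end Vortex

end

open MeasureTheory

noncomputable section

namespace Vortex

open scoped ENNReal ComplexConjugate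

/-! ### Convolution estimates for nonnegative sequences -/

/-! The difference of the two solutions is estimated in the negative Sobolev norm `H⁻¹`, entirely in
terms of Fourier coefficients. Let `a` and `b` be the coefficients of the two solutions and `c = a -
b`. Since the energy is bounded below, finiteness of `Q` bounds the time integral of the squared
`L²` norms. Hence almost every time slice has a square integrable density, its energy is half the
squared `H⁻¹` norm (`energy_eq`), and this norm is bounded uniformly in time.

Testing the weak equation against the real parts of multiples of characters gives an integral
equation for each coefficient (`mc_sub_eq`). The symmetrised nonlinearity becomes the quadratic
convolution `nonlin`, because the Biot–Savart kernel is integrable with explicit Fourier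
coefficients (`fc_gk`, `pairR_chi`).

The rate of change of `∑ ‖c k‖² / lam k` has three contributions. Viscosity gives `-2ν‖c‖₂²`. The
difference of the nonlinearities splits into the velocity of `c` carrying `b` and the velocity of
`a` carrying `c`. The first is orthogonal to the potential gradient of `c` and disappears, which is
the antisymmetry of `symb k l / lam k`. The second is bounded by a discrete Ladyzhenskaya inequality
(`trilinear_le`) by a multiple of `‖c‖₂^(3/2) (‖c‖₋₁ ‖a‖₋₁ ‖a‖₂)^(1/2)`. The drift by `v`
contributes at most a multiple of `‖c‖₋₁ ‖v‖_∞ ‖c‖₂`. Young's inequality lets viscosity absorb all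
powers of `‖c‖₂`, leaving `(C ‖a‖₂² + C') ‖c‖₋₁²`.

The coefficient `‖a‖₂²` is integrable in time and `c` vanishes at time zero, so Gronwall's lemma
gives `c = 0` at all times. A finite measure is determined by its Fourier coefficients, whence the
solutions agree. The derivative of the infinite sum is never taken: each mode is treated as an
absolutely continuous function, and sum and time integral are exchanged by an absolute bound
(`tsum_enorm_rate_le`). -/

lemma tsum_mul_sq_le {ι : Type*} (f g : ι → ℝ≥0∞) :
    (∑' i, f i * g i) ^ 2 ≤ (∑' i, f i ^ 2) * ∑' i, g i ^ 2 := by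
  let _ : MeasurableSpace ι := ⊤
  have h := ENNReal.lintegral_mul_le_Lp_mul_Lq (Measure.count : Measure ι)
    (Real.HolderConjugate.two_two) (f := f) (g := g) measurable_from_top.aemeasurable
    measurable_from_top.aemeasurable
  simp only [lintegral_count, Pi.mul_apply, ENNReal.rpow_two] at h
  calc (∑' i, f i * g i) ^ 2
      ≤ ((∑' i, f i ^ 2) ^ (1 / 2 : ℝ) * (∑' i, g i ^ 2) ^ (1 / 2 : ℝ)) ^ 2 := by gcongr
    _ = _ := by
      rw [mul_pow, ← ENNReal.rpow_natCast, ← ENNReal.rpow_natCast, ← ENNReal.rpow_mul,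
        ← ENNReal.rpow_mul]
      norm_num

lemma hasSum_telescope {x : ℝ} (hx : 0 < x) :
    HasSum (fun n : ℕ => 1 / (x + n) - 1 / (x + n + 1)) (1 / x) := by
  have h1 : ∀ n : ℕ, 0 ≤ 1 / (x + n) - 1 / (x + n + 1) := fun n =>
    sub_nonneg.2 (one_div_le_one_div_of_le (by positivity) (by linarith))
  rw [hasSum_iff_tendsto_nat_of_nonneg h1]
  have h2 : ∀ n : ℕ, ∑ i ∈ Finset.range n, (1 / (x + i) - 1 / (x + i + 1)) =
      1 / x - 1 / (x + n) := by
    intro n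
    have := Finset.sum_range_sub' (fun i : ℕ => 1 / (x + i)) n
    simpa [add_assoc] using this
  simp_rw [h2]
  have h3 : Filter.Tendsto (fun n : ℕ => 1 / (x + (n : ℝ))) Filter.atTop (nhds 0) :=
    tendsto_const_nhds.div_atTop (Filter.tendsto_atTop_add_const_left _ _
      tendsto_natCast_atTop_atTop)
  simpa using h3.const_sub (1 / x)

/-- Since `(x + n)(x + n + 1) ≤ 2 (x² + (n + 1)²)`, the positive and the negative integers each
contribute at most a telescoping sum `2 / x`. The term `n = 0` is `1 / x² ≤ 1 / x`. -/
lemma tsum_inv_sq_add_sq_le {x : ℝ} (hx : 1 ≤ x) :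
    ∑' n : ℤ, ENNReal.ofReal (1 / (x ^ 2 + (n : ℝ) ^ 2)) ≤ ENNReal.ofReal (5 / x) := by
  have hx0 : 0 < x := by linarith
  have h1 : ∀ n : ℕ, 1 / (x ^ 2 + ((n : ℝ) + 1) ^ 2) ≤ 2 * (1 / (x + n) - 1 / (x + n + 1)) := by
    intro n
    have hn : (0 : ℝ) ≤ n := n.cast_nonneg
    rw [div_sub_div _ _ (by positivity) (by positivity), ← mul_div_assoc,
      div_le_div_iff₀ (by positivity) (by positivity)]
    nlinarith [sq_nonneg (x - n), sq_nonneg (x - n - 1)]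
  have h2 : ∑' n : ℕ, ENNReal.ofReal (1 / (x ^ 2 + ((n : ℝ) + 1) ^ 2)) ≤ ENNReal.ofReal (2 / x) := by
    have hs := (hasSum_telescope hx0).mul_left 2
    calc _ ≤ ∑' n : ℕ, ENNReal.ofReal (2 * (1 / (x + n) - 1 / (x + n + 1))) :=
          ENNReal.tsum_le_tsum fun n => ENNReal.ofReal_le_ofReal (h1 n)
      _ = ENNReal.ofReal (2 / x) := by
          rw [← ENNReal.ofReal_tsum_of_nonneg _ hs.summable, hs.tsum_eq]
          · congr 1; ring
          · intro n
            exact (by positivity : (0 : ℝ) ≤ 1 / (x ^ 2 + ((n : ℝ) + 1) ^ 2)).trans (h1 n)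
  rw [tsum_of_add_one_of_neg_add_one ENNReal.summable ENNReal.summable]
  calc _ ≤ ENNReal.ofReal (2 / x) + ENNReal.ofReal (1 / x) + ENNReal.ofReal (2 / x) := by
        refine add_le_add (add_le_add ?_ ?_) ?_
        · refine le_trans (le_of_eq ?_) h2
          congr 1; ext n; push_cast; rfl
        · refine ENNReal.ofReal_le_ofReal ?_
          simp only [Int.cast_zero, ne_eq, OfNat.ofNat_ne_zero, not_false_eq_true, zero_pow, add_zero]
          exact one_div_le_one_div_of_le hx0 (by nlinarith)
        · refine le_trans (le_of_eq ?_) h2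
          congr 1; ext n; push_cast; congr 3; ring
    _ = ENNReal.ofReal (5 / x) := by
        rw [← ENNReal.ofReal_add (by positivity) (by positivity),
          ← ENNReal.ofReal_add (by positivity) (by positivity)]
        congr 1; ring

/-- The Japanese bracket weight `1 + n²`. -/
def wt (n : ℤ) : ℝ≥0∞ := ENNReal.ofReal (1 + (n : ℝ) ^ 2)

lemma one_le_wt (n : ℤ) : 1 ≤ wt n := by
  rw [wt, ENNReal.one_le_ofReal]; nlinarith [sq_nonneg (n : ℝ)]

/-- Carlson's inequality. -/
lemma carlson (f : ℤ → ℝ≥0∞) :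
    (∑' n, f n) ^ 4 ≤ 100 * (∑' n, f n ^ 2) * ∑' n, wt n * f n ^ 2 := by
  set A := ∑' n, f n ^ 2 with hA
  set B := ∑' n, wt n * f n ^ 2 with hB
  have hAB : A ≤ B := ENNReal.tsum_le_tsum fun n => le_mul_of_one_le_left' (one_le_wt n)
  rcases eq_or_ne A 0 with h0 | h0
  · have : ∀ n, f n = 0 := by simpa [hA] using h0
    simp [this]
  have hB0 : B ≠ 0 := fun h => h0 (le_zero_iff.1 (h ▸ hAB))
  rcases eq_or_ne B ⊤ with hT | hT
  · rw [hT, ENNReal.mul_top (by positivity)]; exact le_top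
  have hAT : A ≠ ⊤ := ne_top_of_le_ne_top hT hAB
  obtain ⟨a, ha, haA⟩ : ∃ a : ℝ, 0 < a ∧ A = ENNReal.ofReal a :=
    ⟨A.toReal, ENNReal.toReal_pos h0 hAT, (ENNReal.ofReal_toReal hAT).symm⟩
  obtain ⟨b, hb, hbB⟩ : ∃ b : ℝ, 0 < b ∧ B = ENNReal.ofReal b :=
    ⟨B.toReal, ENNReal.toReal_pos hB0 hT, (ENNReal.ofReal_toReal hT).symm⟩
  have hab : a ≤ b := by
    rw [haA, hbB, ENNReal.ofReal_le_ofReal_iff hb.le] at hAB; exact hAB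
  -- Cauchy–Schwarz with the weight `x² + n²` gives `(∑ f)² ≤ (5 / x)(x² a + b)`. This `x` makes the
  -- two summands equal, and `1 ≤ x` because the weight `wt` is at least one.
  set x := Real.sqrt (b / a) with hx
  have hx1 : 1 ≤ x := by rw [hx, Real.one_le_sqrt, one_le_div ha]; exact hab
  have hx0 : 0 < x := by linarith
  have hx2 : x ^ 2 * a = b := by rw [hx, Real.sq_sqrt (by positivity)]; field_simp
  have h1 : (∑' n, f n) ^ 2 ≤ ENNReal.ofReal (5 / x) * ENNReal.ofReal (2 * b) := by
    calc (∑' n, f n) ^ 2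
        = (∑' n : ℤ, ENNReal.ofReal (Real.sqrt (1 / (x ^ 2 + (n : ℝ) ^ 2))) *
            (ENNReal.ofReal (Real.sqrt (x ^ 2 + (n : ℝ) ^ 2)) * f n)) ^ 2 := by
          congr 2; ext n
          rw [← mul_assoc, ← ENNReal.ofReal_mul (Real.sqrt_nonneg _), ← Real.sqrt_mul (by positivity),
            one_div_mul_cancel (by positivity), Real.sqrt_one, ENNReal.ofReal_one, one_mul]
      _ ≤ _ := tsum_mul_sq_le _ _
      _ ≤ _ := by
          refine mul_le_mul' ?_ ?_
          · refine le_trans (le_of_eq ?_) (tsum_inv_sq_add_sq_le hx1)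
            congr 1; ext n
            rw [← ENNReal.ofReal_pow (Real.sqrt_nonneg _), Real.sq_sqrt (by positivity)]
          · calc _ ≤ ∑' n, (ENNReal.ofReal (x ^ 2) * f n ^ 2 + wt n * f n ^ 2) := by
                  refine ENNReal.tsum_le_tsum fun n => ?_
                  rw [mul_pow, ← ENNReal.ofReal_pow (Real.sqrt_nonneg _),
                    Real.sq_sqrt (by positivity), ← add_mul, wt,
                    ← ENNReal.ofReal_add (by positivity) (by positivity)]
                  gcongr; linarith
              _ = ENNReal.ofReal (2 * b) := by
                  rw [ENNReal.tsum_add, ENNReal.tsum_mul_left, ← hA, ← hB, haA, hbB,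
                    ← ENNReal.ofReal_mul (by positivity),
                    ← ENNReal.ofReal_add (by positivity) (by positivity)]
                  congr 1; linarith
  calc (∑' n, f n) ^ 4 = ((∑' n, f n) ^ 2) ^ 2 := by ring
    _ ≤ (ENNReal.ofReal (5 / x) * ENNReal.ofReal (2 * b)) ^ 2 := by gcongr
    _ = 100 * A * B := by
      rw [← ENNReal.ofReal_mul (by positivity), ← ENNReal.ofReal_pow (by positivity), haA, hbB,
        show (100 : ℝ≥0∞) = ENNReal.ofReal 100 by norm_num, ← ENNReal.ofReal_mul (by positivity),
        ← ENNReal.ofReal_mul (by positivity)]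
      congr 1
      rw [← hx2]; field_simp; norm_num

/-- A discrete Ladyzhenskaya inequality, in trilinear form. -/
lemma trilinear_le (a b c : ℤ × ℤ → ℝ≥0∞) :
    (∑' k, ∑' l, a (k - l) * b k * c l) ^ 4 ≤
      10000 * (∑' k, a k ^ 2) ^ 2 * ((∑' k, b k ^ 2) * ∑' k : ℤ × ℤ, wt k.1 * b k ^ 2) *
        ((∑' k, c k ^ 2) * ∑' k : ℤ × ℤ, wt k.2 * c k ^ 2) := by
  set α : ℤ → ℝ≥0∞ := fun m => (∑' n, a (m, n) ^ 2) ^ (1 / 2 : ℝ)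
  set β : ℤ → ℝ≥0∞ := fun m => (∑' n, b (m, n) ^ 2) ^ (1 / 2 : ℝ)
  set γ : ℤ → ℝ≥0∞ := fun m => ∑' n, c (m, n)
  have hsq : ∀ s : ℝ≥0∞, (s ^ (1 / 2 : ℝ)) ^ 2 = s := fun s => by
    rw [← ENNReal.rpow_natCast, ← ENNReal.rpow_mul]; norm_num
  have hle : ∀ s t : ℝ≥0∞, s ^ 2 ≤ t → s ≤ t ^ (1 / 2 : ℝ) := fun s t h => by
    rw [one_div, ENNReal.le_rpow_inv_iff (by norm_num), ENNReal.rpow_two]; exact h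
  have hα : ∑' m, α m ^ 2 = ∑' k, a k ^ 2 := by
    rw [ENNReal.tsum_prod' ]; simp only [α, hsq]
  have hβ : ∑' m, β m ^ 2 = ∑' k, b k ^ 2 := by
    rw [ENNReal.tsum_prod' ]; simp only [β, hsq]
  have hβ1 : ∑' m, wt m * β m ^ 2 = ∑' k : ℤ × ℤ, wt k.1 * b k ^ 2 := by
    rw [ENNReal.tsum_prod' ]; simp only [β, hsq, ENNReal.tsum_mul_left]
  have hγ : (∑' m, γ m ^ 2) ^ 2 ≤ 100 * ((∑' k, c k ^ 2) * ∑' k : ℤ × ℤ, wt k.2 * c k ^ 2) := by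
    have h1 : ∀ m, γ m ^ 2 ≤ 10 * ((∑' n, c (m, n) ^ 2) ^ (1 / 2 : ℝ) *
        (∑' n, wt n * c (m, n) ^ 2) ^ (1 / 2 : ℝ)) := by
      intro m
      have h := carlson (fun n => c (m, n))
      have h' : (γ m ^ 2) ^ 2 ≤ 100 * ((∑' n, c (m, n) ^ 2) * ∑' n, wt n * c (m, n) ^ 2) := by
        rw [← pow_mul, ← mul_assoc]; exact h
      refine (hle _ _ h').trans (le_of_eq ?_)
      rw [ENNReal.mul_rpow_of_nonneg _ _ (by norm_num), ENNReal.mul_rpow_of_nonneg _ _ (by norm_num),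
        show (100 : ℝ≥0∞) = 10 ^ (2 : ℝ) by rw [ENNReal.rpow_two]; norm_num, ← ENNReal.rpow_mul]
      norm_num
    calc (∑' m, γ m ^ 2) ^ 2 ≤ (∑' m, 10 * ((∑' n, c (m, n) ^ 2) ^ (1 / 2 : ℝ) *
        (∑' n, wt n * c (m, n) ^ 2) ^ (1 / 2 : ℝ))) ^ 2 := by
          gcongr with m; exact h1 m
      _ = 100 * (∑' m, (∑' n, c (m, n) ^ 2) ^ (1 / 2 : ℝ) *
        (∑' n, wt n * c (m, n) ^ 2) ^ (1 / 2 : ℝ)) ^ 2 := by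
          rw [ENNReal.tsum_mul_left, mul_pow]; norm_num
      _ ≤ _ := by
          gcongr
          refine (tsum_mul_sq_le _ _).trans (le_of_eq ?_)
          simp only [hsq]
          rw [ENNReal.tsum_prod', ENNReal.tsum_prod']
  have hmain : ∑' k, ∑' l, a (k - l) * b k * c l ≤
      (∑' m, β m) * ((∑' m, α m ^ 2) ^ (1 / 2 : ℝ) * (∑' m, γ m ^ 2) ^ (1 / 2 : ℝ)) := by
    calc ∑' k, ∑' l, a (k - l) * b k * c l
        = ∑' k1, ∑' l1, ∑' l2, c (l1, l2) * ∑' k2, a (k1 - l1, k2 - l2) * b (k1, k2) := by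
          rw [ENNReal.tsum_prod']
          congr 1; ext k1
          simp_rw [ENNReal.tsum_prod' (f := fun l => a (_ - l) * _ * c l)]
          rw [ENNReal.tsum_comm]
          congr 1; ext l1
          rw [ENNReal.tsum_comm]
          congr 1; ext l2
          rw [← ENNReal.tsum_mul_left]
          congr 1; ext k2
          simp only [Prod.mk_sub_mk]; ring
      -- Cauchy–Schwarz in the second coordinate alone. Summing `c` over `l2` then leaves an `ℓ¹`
      -- norm in that coordinate, while `β` is later summed over the first one, so Carlson's
      -- inequality is only ever applied in one dimension.
      _ ≤ ∑' k1, ∑' l1, ∑' l2, c (l1, l2) * (α (k1 - l1) * β k1) := by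
          gcongr with k1 l1 l2
          have h := tsum_mul_sq_le (fun k2 => a (k1 - l1, k2 - l2)) (fun k2 => b (k1, k2))
          have hs : ∑' k2, a (k1 - l1, k2 - l2) ^ 2 = ∑' n, a (k1 - l1, n) ^ 2 :=
            (Equiv.subRight l2).tsum_eq (fun n => a (k1 - l1, n) ^ 2)
          rw [hs] at h
          refine (hle _ _ h).trans (le_of_eq ?_)
          rw [ENNReal.mul_rpow_of_nonneg _ _ (by norm_num)]
      _ = ∑' k1, β k1 * ∑' l1, α (k1 - l1) * γ l1 := by
          congr 1; ext k1
          rw [← ENNReal.tsum_mul_left]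
          congr 1; ext l1
          rw [ENNReal.tsum_mul_right]; ring
      _ ≤ ∑' k1, β k1 * ((∑' m, α m ^ 2) ^ (1 / 2 : ℝ) * (∑' m, γ m ^ 2) ^ (1 / 2 : ℝ)) := by
          gcongr with k1
          have h := tsum_mul_sq_le (fun l1 => α (k1 - l1)) γ
          have hs : ∑' l1, α (k1 - l1) ^ 2 = ∑' n, α n ^ 2 :=
            (Equiv.subLeft k1).tsum_eq (fun n => α n ^ 2)
          rw [hs] at h
          refine (hle _ _ h).trans (le_of_eq ?_)
          rw [ENNReal.mul_rpow_of_nonneg _ _ (by norm_num)]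
      _ = _ := by rw [ENNReal.tsum_mul_right]
  calc _ ≤ ((∑' m, β m) * ((∑' m, α m ^ 2) ^ (1 / 2 : ℝ) * (∑' m, γ m ^ 2) ^ (1 / 2 : ℝ))) ^ 4 := by
        gcongr
    _ = (∑' m, β m) ^ 4 * ((∑' m, α m ^ 2) ^ 2 * (∑' m, γ m ^ 2) ^ 2) := by
        have h4 : ∀ s : ℝ≥0∞, (s ^ (1 / 2 : ℝ)) ^ 4 = s ^ 2 := fun s => by
          rw [show 4 = 2 * 2 from rfl, pow_mul, hsq]
        rw [mul_pow, mul_pow, h4, h4]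
    _ ≤ (100 * (∑' m, β m ^ 2) * ∑' m, wt m * β m ^ 2) * ((∑' k, a k ^ 2) ^ 2 *
          (100 * ((∑' k, c k ^ 2) * ∑' k : ℤ × ℤ, wt k.2 * c k ^ 2))) := by
        gcongr
        · exact carlson β
        · exact hα.le
    _ = _ := by rw [hβ, hβ1]; ring

/-! ### Sequences of Fourier coefficients -/

/-- Frequencies of characters of the torus. -/
abbrev Freq : Type := Fin 2 → ℤ

/-- The eigenvalue `4π²|k|²` of `-Δ` at the frequency `k`. -/
def lam (k : Freq) : ℝ := 4 * Real.pi ^ 2 * ∑ i, (k i : ℝ) ^ 2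

lemma lam_nonneg (k : Freq) : 0 ≤ lam k := by unfold lam; positivity

lemma lam_pos {k : Freq} (hk : k ≠ 0) : 0 < lam k := weight_pos hk

@[simp] lemma lam_zero : lam 0 = 0 := by simp [lam]

lemma lam_eq (k : Freq) : lam k = 4 * Real.pi ^ 2 * ((k 0 : ℝ) ^ 2 + (k 1 : ℝ) ^ 2) := by
  simp [lam, Fin.sum_univ_two]

/-- A nonzero integer vector has length at least one, and `4π² ≥ 2` leaves room for the extra `1`.
This converts the one-dimensional weights of `trilinear_le` into the eigenvalue. -/
lemma one_add_sq_le_lam {k : Freq} (hk : k ≠ 0) (i : Fin 2) : 1 + (k i : ℝ) ^ 2 ≤ lam k := by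
  have h1 : (1 : ℝ) ≤ (k 0 : ℝ) ^ 2 + (k 1 : ℝ) ^ 2 := by
    have : 0 < (k 0) ^ 2 + (k 1) ^ 2 := by
      by_contra h
      have h0 : k 0 = 0 := by nlinarith [sq_nonneg (k 0), sq_nonneg (k 1)]
      have h1 : k 1 = 0 := by nlinarith [sq_nonneg (k 0), sq_nonneg (k 1)]
      exact hk (by ext i; fin_cases i <;> simp [h0, h1])
    exact_mod_cast this
  have h2 : (k i : ℝ) ^ 2 ≤ (k 0 : ℝ) ^ 2 + (k 1 : ℝ) ^ 2 := by
    fin_cases i <;> simp [sq_nonneg]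
  have h3 : (2 : ℝ) ≤ 4 * Real.pi ^ 2 := by nlinarith [Real.pi_gt_three]
  rw [lam_eq]
  nlinarith

lemma one_le_lam {k : Freq} (hk : k ≠ 0) : 1 ≤ lam k :=
  le_trans (by nlinarith [sq_nonneg (k 0 : ℝ)]) (one_add_sq_le_lam hk 0)

/-- The weight `|2πk|⁻¹`, with the value `0` at `k = 0`. -/
def om (k : Freq) : ℝ≥0∞ := ENNReal.ofReal (Real.sqrt (lam k))⁻¹

lemma om_sq (k : Freq) : om k ^ 2 = ENNReal.ofReal (lam k)⁻¹ := by
  rw [om, ← ENNReal.ofReal_pow (by positivity), inv_pow, Real.sq_sqrt (lam_nonneg k)]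

lemma om_ne_top (k : Freq) : om k ≠ ⊤ := ENNReal.ofReal_ne_top

lemma om_sq_le_one (k : Freq) : om k ^ 2 ≤ 1 := by
  rw [om_sq, ENNReal.ofReal_le_one]
  rcases eq_or_ne k 0 with rfl | hk
  · simp
  · exact inv_le_one_of_one_le₀ (one_le_lam hk)

lemma wt_mul_om_sq_le_one (k : Freq) (i : Fin 2) : wt (k i) * om k ^ 2 ≤ 1 := by
  rw [om_sq, wt, ← ENNReal.ofReal_mul (by positivity), ENNReal.ofReal_le_one]
  rcases eq_or_ne k 0 with rfl | hk
  · simp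
  · rw [← div_eq_mul_inv, div_le_one (lam_pos hk)]
    exact one_add_sq_le_lam hk i

/-- The squared `ℓ²` norm. -/
def nsq (u : Freq → ℂ) : ℝ≥0∞ := ∑' k, ‖u k‖ₑ ^ 2

/-- The squared `H⁻¹` norm, which ignores the zeroth coefficient. -/
def hsq (u : Freq → ℂ) : ℝ≥0∞ := ∑' k, (om k * ‖u k‖ₑ) ^ 2

lemma hsq_le_nsq (u : Freq → ℂ) : hsq u ≤ nsq u := by
  refine ENNReal.tsum_le_tsum fun k => ?_
  rw [mul_pow]
  exact mul_le_of_le_one_left' (om_sq_le_one k)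

lemma enorm_add_sq_le (x y : ℂ) : ‖x + y‖ₑ ^ 2 ≤ 2 * (‖x‖ₑ ^ 2 + ‖y‖ₑ ^ 2) := by
  simp only [← ofReal_norm]
  rw [← ENNReal.ofReal_pow (norm_nonneg _), ← ENNReal.ofReal_pow (norm_nonneg _),
    ← ENNReal.ofReal_pow (norm_nonneg _), ← ENNReal.ofReal_add (by positivity) (by positivity),
    show (2 : ℝ≥0∞) = ENNReal.ofReal 2 by norm_num, ← ENNReal.ofReal_mul (by norm_num)]
  refine ENNReal.ofReal_le_ofReal ?_
  have := norm_add_le x y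
  nlinarith [norm_nonneg (x + y), sq_nonneg (‖x‖ - ‖y‖), norm_nonneg x, norm_nonneg y]

lemma enorm_sub_sq_le (x y : ℂ) : ‖x - y‖ₑ ^ 2 ≤ 2 * (‖x‖ₑ ^ 2 + ‖y‖ₑ ^ 2) := by
  simpa [sub_eq_add_neg] using enorm_add_sq_le x (-y)

lemma nsq_sub_le (u w : Freq → ℂ) : nsq (u - w) ≤ 2 * (nsq u + nsq w) := by
  rw [nsq, nsq, nsq, ← ENNReal.tsum_add, ← ENNReal.tsum_mul_left]
  exact ENNReal.tsum_le_tsum fun k => enorm_sub_sq_le _ _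

lemma hsq_sub_le (u w : Freq → ℂ) : hsq (u - w) ≤ 2 * (hsq u + hsq w) := by
  rw [hsq, hsq, hsq, ← ENNReal.tsum_add, ← ENNReal.tsum_mul_left]
  refine ENNReal.tsum_le_tsum fun k => ?_
  rw [mul_pow, mul_pow, mul_pow, ← mul_add, mul_left_comm]
  gcongr
  exact enorm_sub_sq_le _ _

/-! ### Trilinear form of the nonlinearity -/

/-- The majorant of the trilinear form of the nonlinearity. -/
def tri (p q s : Freq → ℂ) : ℝ≥0∞ :=
  ∑' k, ∑' l, ‖p (k - l)‖ₑ * (om k * ‖q k‖ₑ) * (om l * ‖s l‖ₑ)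

/-- `trilinear_le` applied to the sequences `om * q` and `om * s`: the weight `om` is one inverse
derivative, so it cancels the weight `wt` in either coordinate and the weighted sums are bounded by
plain `ℓ²` norms. -/
lemma tri_pow_four_le (p q s : Freq → ℂ) :
    tri p q s ^ 4 ≤ 10000 * nsq p ^ 2 * (hsq q * nsq q) * (hsq s * nsq s) := by
  set e := (finTwoArrowEquiv ℤ).symm
  have he0 : ∀ k : ℤ × ℤ, e k 0 = k.1 := fun k => rfl
  have he1 : ∀ k : ℤ × ℤ, e k 1 = k.2 := fun k => rfl
  have hsub : ∀ k l : ℤ × ℤ, e (k - l) = e k - e l := fun k l => by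
    ext i; fin_cases i <;> rfl
  have h := trilinear_le (fun k => ‖p (e k)‖ₑ) (fun k => om (e k) * ‖q (e k)‖ₑ)
    (fun k => om (e k) * ‖s (e k)‖ₑ)
  simp only [hsub] at h
  have e1 : tri p q s = ∑' k, ∑' l, ‖p (e k - e l)‖ₑ * (om (e k) * ‖q (e k)‖ₑ) *
      (om (e l) * ‖s (e l)‖ₑ) := by
    rw [tri, ← e.tsum_eq]
    congr 1; ext k
    rw [← e.tsum_eq]
  have e2 : ∀ u : Freq → ℂ, ∑' k, ‖u (e k)‖ₑ ^ 2 = nsq u := fun u =>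
    e.tsum_eq (fun k => ‖u k‖ₑ ^ 2)
  have e3 : ∀ u : Freq → ℂ, ∑' k, (om (e k) * ‖u (e k)‖ₑ) ^ 2 = hsq u := fun u =>
    e.tsum_eq (fun k => (om k * ‖u k‖ₑ) ^ 2)
  have e4 : ∀ u : Freq → ℂ, ∀ i, ∑' k, wt (e k i) * (om (e k) * ‖u (e k)‖ₑ) ^ 2 ≤ nsq u := by
    intro u i
    rw [← e2]
    refine ENNReal.tsum_le_tsum fun k => ?_
    rw [mul_pow, ← mul_assoc]
    exact mul_le_of_le_one_left' (wt_mul_om_sq_le_one _ _)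
  rw [e1]
  refine h.trans ?_
  rw [e2, e3, e3]
  gcongr
  · exact e4 q 0
  · exact e4 s 1

/-- The symbol of the Biot–Savart nonlinearity. -/
def symb (k l : Freq) : ℝ := 4 * Real.pi ^ 2 * (k 1 * l 0 - k 0 * l 1) / lam l

/-- The Fourier coefficients of `-div (u ρ)`, where `a` are those of `ρ` and `u` is its velocity. -/
def nonlin (a : Freq → ℂ) (k : Freq) : ℂ := ∑' l, (symb k l : ℂ) * (a l * a (k - l))

/-- Lagrange's identity: the squares of the cross product and of the dot product of two plane
vectors add up to the product of their squared lengths. -/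
lemma abs_cross_le (k l : Freq) :
    |4 * Real.pi ^ 2 * ((k 1 : ℝ) * l 0 - k 0 * l 1)| ≤ Real.sqrt (lam k) * Real.sqrt (lam l) := by
  rw [← Real.sqrt_mul (lam_nonneg k)]
  refine Real.abs_le_sqrt ?_
  rw [lam_eq, lam_eq]
  have : (0 : ℝ) ≤ (4 * Real.pi ^ 2) ^ 2 * ((k 0 : ℝ) * l 0 + k 1 * l 1) ^ 2 := by positivity
  nlinarith

lemma abs_symb_le (k l : Freq) : |symb k l| ≤ Real.sqrt (lam k) * (Real.sqrt (lam l))⁻¹ := by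
  rcases eq_or_ne l 0 with rfl | hl
  · simp [symb]
  · have h := abs_cross_le k l
    have hs := Real.sqrt_pos.2 (lam_pos hl)
    rw [symb, abs_div, abs_of_pos (lam_pos hl), div_le_iff₀ (lam_pos hl)]
    refine h.trans (le_of_eq ?_)
    nth_rw 3 [← Real.mul_self_sqrt (lam_nonneg l)]
    field_simp

lemma abs_symb_le_sqrt (k l : Freq) : |symb k l| ≤ Real.sqrt (lam k) := by
  refine (abs_symb_le k l).trans ?_
  refine mul_le_of_le_one_right (Real.sqrt_nonneg _) ?_
  rcases eq_or_ne l 0 with rfl | hl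
  · simp
  · exact inv_le_one_of_one_le₀ (Real.one_le_sqrt.2 (one_le_lam hl))

/-- `symb k l / lam k` is antisymmetric. -/
lemma symb_div_antisymm (k l : Freq) : symb k l / lam k = -(symb l k / lam l) := by
  simp only [symb, div_div]
  rw [← neg_div, mul_comm (lam l)]
  congr 1; ring

lemma enorm_symb_div_le (k l : Freq) : ‖((symb k l / lam k : ℝ) : ℂ)‖ₑ ≤ om k * om l := by
  rw [om, om, ← ENNReal.ofReal_mul (by positivity), ← ofReal_norm, Complex.norm_real]
  refine ENNReal.ofReal_le_ofReal ?_
  rw [Real.norm_eq_abs, abs_div, abs_of_nonneg (lam_nonneg k)]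
  rcases eq_or_ne k 0 with rfl | hk
  · simp
  · rw [div_le_iff₀ (lam_pos hk)]
    refine (abs_symb_le k l).trans (le_of_eq ?_)
    have hs := Real.sqrt_pos.2 (lam_pos hk)
    nth_rw 3 [← Real.mul_self_sqrt (lam_nonneg k)]
    field_simp

lemma enorm_prod_sum_le (a b : Freq → ℂ) (k : Freq) :
    (∑' l, ‖a l * b (k - l)‖ₑ) ^ 2 ≤ nsq a * nsq b := by
  simp only [enorm_mul]
  refine (tsum_mul_sq_le _ _).trans (le_of_eq ?_)
  congr 1
  exact (Equiv.subLeft k).tsum_eq (fun l => ‖b l‖ₑ ^ 2)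

lemma summable_of_tsum_enorm_ne_top {ι : Type*} {f : ι → ℂ} (h : ∑' i, ‖f i‖ₑ ≠ ⊤) :
    Summable f := by
  refine Summable.of_nnnorm ?_
  exact ENNReal.tsum_coe_ne_top_iff_summable.1 h

lemma enorm_symb_le (k l : Freq) : ‖(symb k l : ℂ)‖ₑ ≤ ENNReal.ofReal (Real.sqrt (lam k)) := by
  rw [← ofReal_norm, Complex.norm_real]
  exact ENNReal.ofReal_le_ofReal (abs_symb_le_sqrt k l)

lemma tsum_enorm_symb_le (a b : Freq → ℂ) (k : Freq) :
    ∑' l, ‖(symb k l : ℂ) * (a l * b (k - l))‖ₑ ≤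
      ENNReal.ofReal (Real.sqrt (lam k)) * ∑' l, ‖a l * b (k - l)‖ₑ := by
  rw [← ENNReal.tsum_mul_left]
  refine ENNReal.tsum_le_tsum fun l => ?_
  rw [enorm_mul]
  gcongr
  exact enorm_symb_le k l

lemma summable_symb {a b : Freq → ℂ} (ha : nsq a ≠ ⊤) (hb : nsq b ≠ ⊤) (k : Freq) :
    Summable (fun l => (symb k l : ℂ) * (a l * b (k - l))) := by
  refine summable_of_tsum_enorm_ne_top (ne_top_of_le_ne_top ?_ (tsum_enorm_symb_le a b k))
  refine ENNReal.mul_ne_top ENNReal.ofReal_ne_top fun h => ?_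
  have h1 := enorm_prod_sum_le a b k
  rw [h] at h1
  simp only [ne_eq, OfNat.ofNat_ne_zero, not_false_eq_true, ENNReal.top_pow, top_le_iff] at h1
  exact ENNReal.mul_ne_top ha hb h1

/-- For a fixed mode the nonlinearity is controlled by the squared `ℓ²` norm, hence is integrable in
time along a weak solution. -/
lemma enorm_nonlin_le (a : Freq → ℂ) (k : Freq) :
    ‖nonlin a k‖ₑ ≤ ENNReal.ofReal (Real.sqrt (lam k)) * nsq a := by
  have h1 : ∑' l, ‖a l * a (k - l)‖ₑ ≤ nsq a := by
    rw [← ENNReal.pow_le_pow_left_iff two_ne_zero, sq (nsq a)]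
    exact enorm_prod_sum_le a a k
  exact enorm_tsum_le_tsum_enorm.trans ((tsum_enorm_symb_le a a k).trans (by gcongr))

/-- The trilinear form that pairs the nonlinearity with the potential of `q`. -/
def triForm (p q s : Freq → ℂ) (x : Freq × Freq) : ℂ :=
  conj (q x.1) * ((symb x.1 x.2 / lam x.1 : ℝ) : ℂ) * (s x.2 * p (x.1 - x.2))

lemma tsum_enorm_triForm_le (p q s : Freq → ℂ) :
    ∑' k, ∑' l, ‖triForm p q s (k, l)‖ₑ ≤ tri p q s := by
  refine ENNReal.tsum_le_tsum fun k => ENNReal.tsum_le_tsum fun l => ?_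
  simp only [triForm, enorm_mul, RCLike.enorm_conj]
  calc ‖q k‖ₑ * ‖((symb k l / lam k : ℝ) : ℂ)‖ₑ * (‖s l‖ₑ * ‖p (k - l)‖ₑ)
      ≤ ‖q k‖ₑ * (om k * om l) * (‖s l‖ₑ * ‖p (k - l)‖ₑ) := by
        gcongr; exact enorm_symb_div_le k l
    _ = _ := by ring

lemma summable_triForm {p q s : Freq → ℂ} (h : tri p q s ≠ ⊤) : Summable (triForm p q s) := by
  refine summable_of_tsum_enorm_ne_top ?_
  rw [ENNReal.tsum_prod']
  exact ne_top_of_le_ne_top h (tsum_enorm_triForm_le p q s)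

/-- The contribution of the velocity of the difference vanishes. -/
lemma re_tsum_triForm_eq_zero (b c : Freq → ℂ) (hb : ∀ k, b (-k) = conj (b k)) :
    (∑' x, triForm b c c x).re = 0 := by
  by_cases hs : Summable (triForm b c c)
  · have h1 : ∀ x : Freq × Freq, conj (triForm b c c x) = -triForm b c c x.swap := by
      rintro ⟨k, l⟩
      simp only [triForm, map_mul, Complex.conj_conj, Complex.conj_ofReal, Prod.swap, ← hb, neg_sub]
      rw [symb_div_antisymm k l]
      push_cast; ring
    have h2 : conj (∑' x, triForm b c c x) = -∑' x, triForm b c c x := by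
      rw [Complex.conj_tsum, ← (Equiv.prodComm Freq Freq).tsum_eq (triForm b c c), ← tsum_neg]
      exact tsum_congr h1
    have h3 := congrArg Complex.re h2
    simp only [Complex.conj_re, Complex.neg_re] at h3
    linarith
  · rw [tsum_eq_zero_of_not_summable hs, Complex.zero_re]

lemma tri_ne_top {p q s : Freq → ℂ} (hp : nsq p ≠ ⊤) (hq : nsq q ≠ ⊤) (hs : nsq s ≠ ⊤) :
    tri p q s ≠ ⊤ := by
  intro h
  have h1 := tri_pow_four_le p q s
  rw [h] at h1
  simp only [ne_eq, OfNat.ofNat_ne_zero, not_false_eq_true, ENNReal.top_pow, top_le_iff] at h1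
  refine absurd h1 ?_
  have h2 : ∀ {u}, nsq u ≠ ⊤ → hsq u ≠ ⊤ := fun hu => ne_top_of_le_ne_top hu (hsq_le_nsq _)
  exact ENNReal.mul_ne_top (ENNReal.mul_ne_top (ENNReal.mul_ne_top (by norm_num)
    (ENNReal.pow_ne_top hp)) (ENNReal.mul_ne_top (h2 hq) hq)) (ENNReal.mul_ne_top (h2 hs) hs)

/-- Polarisation `a_l a_{k-l} - b_l b_{k-l} = a_l c_{k-l} + c_l b_{k-l}` with `c = a - b`: the index
`l` carries the velocity and `k - l` the transported density. -/
lemma conj_mul_nonlin_sub {a b : Freq → ℂ} (ha : nsq a ≠ ⊤) (hb : nsq b ≠ ⊤) (k : Freq) :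
    conj (a k - b k) * (nonlin a k - nonlin b k) / (lam k : ℂ) =
      ∑' l, (triForm (a - b) (a - b) a (k, l) + triForm b (a - b) (a - b) (k, l)) := by
  rw [nonlin, nonlin, ← (summable_symb ha ha k).tsum_sub (summable_symb hb hb k), mul_div_right_comm,
    ← tsum_mul_left]
  refine tsum_congr fun l => ?_
  simp only [triForm, Pi.sub_apply]
  push_cast
  ring

lemma tsum_enorm_nonlin_le {a b : Freq → ℂ} (ha : nsq a ≠ ⊤) (hb : nsq b ≠ ⊤) :
    ∑' k, ‖conj (a k - b k) * (nonlin a k - nonlin b k) / (lam k : ℂ)‖ₑ ≤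
      tri (a - b) (a - b) a + tri b (a - b) (a - b) := by
  calc _ ≤ ∑' k, (∑' l, ‖triForm (a - b) (a - b) a (k, l)‖ₑ +
        ∑' l, ‖triForm b (a - b) (a - b) (k, l)‖ₑ) := by
        refine ENNReal.tsum_le_tsum fun k => ?_
        rw [conj_mul_nonlin_sub ha hb, ← ENNReal.tsum_add]
        exact enorm_tsum_le_tsum_enorm.trans (ENNReal.tsum_le_tsum fun l => enorm_add_le _ _)
    _ ≤ _ := by
        rw [ENNReal.tsum_add]
        exact add_le_add (tsum_enorm_triForm_le _ _ _) (tsum_enorm_triForm_le _ _ _)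

lemma nsq_sub_ne_top {a b : Freq → ℂ} (ha : nsq a ≠ ⊤) (hb : nsq b ≠ ⊤) : nsq (a - b) ≠ ⊤ :=
  ne_top_of_le_ne_top (ENNReal.mul_ne_top (by norm_num) (ENNReal.add_ne_top.2 ⟨ha, hb⟩))
    (nsq_sub_le a b)

lemma re_tsum_nonlin_le {a b : Freq → ℂ} (ha : nsq a ≠ ⊤) (hb : nsq b ≠ ⊤)
    (hbc : ∀ k, b (-k) = conj (b k)) :
    (∑' k, conj (a k - b k) * (nonlin a k - nonlin b k) / (lam k : ℂ)).re ≤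
      (tri (a - b) (a - b) a).toReal := by
  have hc := nsq_sub_ne_top ha hb
  have h1 := tri_ne_top hc hc ha
  have s1 := summable_triForm h1
  have s2 := summable_triForm (tri_ne_top hb hc hc)
  have e : ∑' k, conj (a k - b k) * (nonlin a k - nonlin b k) / (lam k : ℂ) =
      ∑' x, triForm (a - b) (a - b) a x + ∑' x, triForm b (a - b) (a - b) x := by
    rw [← s1.tsum_add s2, (s1.add s2).tsum_prod]
    exact tsum_congr fun k => conj_mul_nonlin_sub ha hb k
  rw [e, Complex.add_re, re_tsum_triForm_eq_zero b (a - b) hbc, add_zero]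
  refine (Complex.re_le_norm _).trans ?_
  rw [← toReal_enorm]
  refine ENNReal.toReal_mono h1 (enorm_tsum_le_tsum_enorm.trans ?_)
  rw [ENNReal.tsum_prod']
  exact tsum_enorm_triForm_le _ _ _

/-! ### Estimates at a fixed time -/

/-- The rate of change of `‖a k - b k‖² / lam k`. -/
def rate (ν : ℝ) (a b g : Freq → ℂ) (k : Freq) : ℝ :=
  2 * (conj (a k - b k) *
    (-((ν * lam k : ℝ) : ℂ) * (a k - b k) + (nonlin a k - nonlin b k) + g k)).re / lam k

lemma tsum_om_mul_sq_le (c g : Freq → ℂ) :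
    (∑' k, (om k * ‖c k‖ₑ) * (om k * ‖g k‖ₑ)) ^ 2 ≤ hsq c * hsq g := tsum_mul_sq_le _ _

lemma enorm_conj_mul_div_le (z w : ℂ) (k : Freq) :
    ‖conj z * w / (lam k : ℂ)‖ₑ = (om k * ‖z‖ₑ) * (om k * ‖w‖ₑ) := by
  have h : ‖((lam k : ℝ) : ℂ)⁻¹‖ₑ = om k ^ 2 := by
    rw [om_sq, ← Complex.ofReal_inv, ← ofReal_norm, Complex.norm_real,
      Real.norm_of_nonneg (inv_nonneg.2 (lam_nonneg k))]
  rw [div_eq_mul_inv, enorm_mul, enorm_mul, RCLike.enorm_conj, h]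
  ring

lemma rate_eq (ν : ℝ) {a b g : Freq → ℂ} (h0 : a 0 = b 0) (k : Freq) :
    rate ν a b g k = -(2 * ν) * ‖(a - b) k‖ ^ 2 +
      2 * (conj (a k - b k) * (nonlin a k - nonlin b k) / (lam k : ℂ)).re +
      2 * (conj ((a - b) k) * g k / (lam k : ℂ)).re := by
  rcases eq_or_ne k 0 with rfl | hk
  -- At the zero frequency the division by `lam 0 = 0` returns `0`. The right-hand side vanishes
  -- too, but only because the total masses agree.
  · simp [rate, h0]
  · have hl := (lam_pos hk).ne'
    have e : (‖a k - b k‖ ^ 2 : ℝ) = (conj (a k - b k) * (a k - b k)).re := by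
      rw [mul_comm, Complex.mul_conj, Complex.ofReal_re, Complex.normSq_eq_norm_sq]
    rw [rate, Pi.sub_apply, e, Complex.div_ofReal_re, Complex.div_ofReal_re]
    rw [show conj (a k - b k) *
      (-((ν * lam k : ℝ) : ℂ) * (a k - b k) + (nonlin a k - nonlin b k) + g k) =
      ((-(ν * lam k) : ℝ) : ℂ) * (conj (a k - b k) * (a k - b k)) +
      conj (a k - b k) * (nonlin a k - nonlin b k) + conj (a k - b k) * g k by push_cast; ring]
    rw [Complex.add_re, Complex.add_re, Complex.re_ofReal_mul]
    field_simp

/-- The fourth power of `tri` has degree four in the squared `ℓ²` norms, so `tri` grows linearly in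
them once the `H⁻¹` norms are bounded. Linear growth is what makes it integrable in time. The
constant comes from `320000 ≤ 30 ^ 4`. -/
lemma tri_self_le {a b : Freq → ℂ} {M : ℝ≥0∞} (hM : hsq a ≤ M) (hM' : hsq b ≤ M) :
    tri (a - b) (a - b) a ≤ 30 * (1 + M) * (1 + nsq a + nsq b) := by
  set S := 1 + nsq a + nsq b
  have ha : nsq a ≤ S := le_add_right (le_add_left le_rfl)
  have hc : nsq (a - b) ≤ 2 * S := (nsq_sub_le a b).trans (by
    gcongr; rw [show S = 1 + (nsq a + nsq b) from add_assoc _ _ _]; exact le_add_left le_rfl)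
  have hhc : hsq (a - b) ≤ 4 * M := (hsq_sub_le a b).trans (by
    calc 2 * (hsq a + hsq b) ≤ 2 * (M + M) := by gcongr
      _ = 4 * M := by ring)
  have h1M : M ≤ 1 + M := le_add_left le_rfl
  rw [← ENNReal.pow_le_pow_left_iff (n := 4) (by norm_num)]
  refine (tri_pow_four_le _ _ _).trans ?_
  calc 10000 * nsq (a - b) ^ 2 * (hsq (a - b) * nsq (a - b)) * (hsq a * nsq a)
      ≤ 10000 * (2 * S) ^ 2 * (4 * (1 + M) * (2 * S)) * ((1 + M) * S) := by
        gcongr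
        · exact hhc.trans (by gcongr)
        · exact hM.trans h1M
    _ = 320000 * (1 + M) ^ 2 * S ^ 4 := by ring
    _ ≤ 810000 * (1 + M) ^ 4 * S ^ 4 := by
        gcongr <;> norm_num
    _ = (30 * (1 + M) * S) ^ 4 := by ring

/-- The corresponding sum has zero real part, but its absolute convergence, with a bound integrable
in time, is needed before sums and integrals are exchanged. -/
lemma tri_other_le {a b : Freq → ℂ} {M : ℝ≥0∞} (hM : hsq a ≤ M) (hM' : hsq b ≤ M) :
    tri b (a - b) (a - b) ≤ 30 * (1 + M) * (1 + nsq a + nsq b) := by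
  set S := 1 + nsq a + nsq b
  have hb : nsq b ≤ S := le_add_left le_rfl
  have hc : nsq (a - b) ≤ 2 * S := (nsq_sub_le a b).trans (by
    gcongr; rw [show S = 1 + (nsq a + nsq b) from add_assoc _ _ _]; exact le_add_left le_rfl)
  have hhc : hsq (a - b) ≤ 4 * M := (hsq_sub_le a b).trans (by
    calc 2 * (hsq a + hsq b) ≤ 2 * (M + M) := by gcongr
      _ = 4 * M := by ring)
  have h1M : M ≤ 1 + M := le_add_left le_rfl
  rw [← ENNReal.pow_le_pow_left_iff (n := 4) (by norm_num)]
  refine (tri_pow_four_le _ _ _).trans ?_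
  calc 10000 * nsq b ^ 2 * (hsq (a - b) * nsq (a - b)) * (hsq (a - b) * nsq (a - b))
      ≤ 10000 * S ^ 2 * (4 * (1 + M) * (2 * S)) * (4 * (1 + M) * (2 * S)) := by
        gcongr <;> exact hhc.trans (by gcongr)
    _ = 640000 * (1 + M) ^ 2 * S ^ 4 := by ring
    _ ≤ 810000 * (1 + M) ^ 4 * S ^ 4 := by
        gcongr <;> norm_num
    _ = (30 * (1 + M) * S) ^ 4 := by ring

lemma drift_le {a b g : Freq → ℂ} {M W : ℝ≥0∞} (hM : hsq a ≤ M) (hM' : hsq b ≤ M)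
    (hg : hsq g ≤ W * nsq (a - b)) :
    ∑' k, (om k * ‖(a - b) k‖ₑ) * (om k * ‖g k‖ₑ) ≤ 3 * (1 + M + W) * (1 + nsq a + nsq b) := by
  set S := 1 + nsq a + nsq b
  have hS : 1 ≤ S := le_add_right (le_add_right le_rfl)
  have hc : nsq (a - b) ≤ 2 * S := (nsq_sub_le a b).trans (by
    gcongr; rw [show S = 1 + (nsq a + nsq b) from add_assoc _ _ _]; exact le_add_left le_rfl)
  have hhc : hsq (a - b) ≤ 4 * M := (hsq_sub_le a b).trans (by
    calc 2 * (hsq a + hsq b) ≤ 2 * (M + M) := by gcongr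
      _ = 4 * M := by ring)
  rw [← ENNReal.pow_le_pow_left_iff (n := 2) (by norm_num)]
  refine (tsum_om_mul_sq_le _ _).trans ?_
  calc hsq (a - b) * hsq g ≤ (4 * (1 + M + W)) * ((1 + M + W) * (2 * S)) := by
        gcongr
        · exact hhc.trans (by gcongr; exact le_add_right (le_add_left le_rfl))
        · exact hg.trans (by gcongr; exact le_add_left le_rfl)
    _ = 8 * (1 + M + W) ^ 2 * S := by ring
    _ ≤ 9 * (1 + M + W) ^ 2 * S ^ 2 := by
        gcongr
        · norm_num
        · exact le_self_pow hS two_ne_zero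
    _ = _ := by ring

lemma enorm_re_le (z : ℂ) : ‖z.re‖ₑ ≤ ‖z‖ₑ := by
  rw [← ofReal_norm, ← ofReal_norm]
  exact ENNReal.ofReal_le_ofReal (Complex.abs_re_le_norm z)

/-- A crude bound, without any cancellation, whose only purpose is to dominate the sum of the rates
over all modes by a function integrable in time. The constant is `126 = 2 * (30 + 30) + 2 * 3`. -/
lemma tsum_enorm_rate_le {ν : ℝ} (hν : 0 < ν) {a b g : Freq → ℂ} {M W : ℝ≥0∞} (h0 : a 0 = b 0)
    (ha : nsq a ≠ ⊤) (hb : nsq b ≠ ⊤) (hM : hsq a ≤ M) (hM' : hsq b ≤ M)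
    (hg : hsq g ≤ W * nsq (a - b)) :
    ∑' k, ‖rate ν a b g k‖ₑ ≤
      (4 * ENNReal.ofReal ν + 126 * (1 + M + W)) * (1 + nsq a + nsq b) := by
  have hc : nsq (a - b) ≤ 2 * (1 + nsq a + nsq b) := (nsq_sub_le a b).trans (by
    gcongr; exact le_add_left le_rfl)
  have h2 : ‖(2 : ℝ)‖ₑ = 2 := by
    rw [← ofReal_norm]; norm_num
  calc ∑' k, ‖rate ν a b g k‖ₑ
      ≤ ∑' k, (2 * ENNReal.ofReal ν * ‖(a - b) k‖ₑ ^ 2 +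
        2 * ‖conj (a k - b k) * (nonlin a k - nonlin b k) / (lam k : ℂ)‖ₑ +
        2 * ((om k * ‖(a - b) k‖ₑ) * (om k * ‖g k‖ₑ))) := by
        refine ENNReal.tsum_le_tsum fun k => ?_
        rw [rate_eq ν h0, ← enorm_conj_mul_div_le]
        refine (enorm_add_le _ _).trans (add_le_add ((enorm_add_le _ _).trans (add_le_add ?_ ?_)) ?_)
        · rw [enorm_mul, enorm_neg, enorm_mul, h2, enorm_pow, enorm_norm, ← ofReal_norm ν,
            Real.norm_of_nonneg hν.le]
        · rw [enorm_mul, h2]; gcongr; exact enorm_re_le _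
        · rw [enorm_mul, h2]; gcongr; exact enorm_re_le _
    _ = 2 * ENNReal.ofReal ν * nsq (a - b) +
        2 * ∑' k, ‖conj (a k - b k) * (nonlin a k - nonlin b k) / (lam k : ℂ)‖ₑ +
        2 * ∑' k, ((om k * ‖(a - b) k‖ₑ) * (om k * ‖g k‖ₑ)) := by
        rw [ENNReal.tsum_add, ENNReal.tsum_add, ENNReal.tsum_mul_left, ENNReal.tsum_mul_left,
          ENNReal.tsum_mul_left, nsq]
    _ ≤ 2 * ENNReal.ofReal ν * (2 * (1 + nsq a + nsq b)) +
        2 * (30 * (1 + M + W) * (1 + nsq a + nsq b) + 30 * (1 + M + W) * (1 + nsq a + nsq b)) +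
        2 * (3 * (1 + M + W) * (1 + nsq a + nsq b)) := by
        gcongr
        · refine (tsum_enorm_nonlin_le ha hb).trans (add_le_add ?_ ?_)
          · exact (tri_self_le hM hM').trans (mul_le_mul' (mul_le_mul' le_rfl le_self_add) le_rfl)
          · exact (tri_other_le hM hM').trans (mul_le_mul' (mul_le_mul' le_rfl le_self_add) le_rfl)
        · exact drift_le hM hM' hg
    _ = _ := by ring

/-- Young's inequality with exponents `4/3` and `4`. The constant `160000 = 16 * 10000` is chosen so
that, if both summands were smaller than `2 * t`, multiplying the cube of the first by the second
would contradict the hypothesis. -/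
lemma add_le_of_pow_four_le {ν x t z : ℝ} (hν : 0 < ν) (hx : 0 ≤ x) (hz : 0 ≤ z)
    (h : t ^ 4 ≤ 10000 * x ^ 3 * z) : 2 * t ≤ ν * x + 160000 / ν ^ 3 * z := by
  by_contra! hlt
  have h1 : ν * x < 2 * t := by
    have : 0 ≤ 160000 / ν ^ 3 * z := by positivity
    linarith
  have h2 : 160000 / ν ^ 3 * z < 2 * t := by
    have : 0 ≤ ν * x := by positivity
    linarith
  have h3 : (ν * x) ^ 3 < (2 * t) ^ 3 := pow_lt_pow_left₀ h1 (by positivity) (by norm_num)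
  have h4 : (ν * x) ^ 3 * (160000 / ν ^ 3 * z) < (2 * t) ^ 3 * (2 * t) :=
    mul_lt_mul'' h3 h2 (by positivity) (by positivity)
  have h5 : (ν * x) ^ 3 * (160000 / ν ^ 3 * z) = 16 * (10000 * x ^ 3 * z) := by
    field_simp; ring
  nlinarith

lemma add_le_of_sq_le {ν x w h z : ℝ} (hν : 0 < ν) (hx : 0 ≤ x) (hw : 0 ≤ w) (hh : 0 ≤ h)
    (hz : z ^ 2 ≤ h * (w * x)) : 2 * z ≤ ν * x + w / ν * h := by
  refine le_of_sq_le_sq (?_ : (2 * z) ^ 2 ≤ _) (by positivity)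
  have h1 : (ν * x) * (w / ν * h) = h * (w * x) := by field_simp
  nlinarith [sq_nonneg (ν * x - w / ν * h)]

/-- The heart of the uniqueness argument. Viscosity gives `-2ν‖c‖₂²` for `c = a - b`; the surviving
trilinear term uses up one copy of `ν‖c‖₂²` and the drift the other. What remains is a multiple of
the squared `H⁻¹` norm whose coefficient is affine in `nsq a`. -/
lemma tsum_rate_le {ν : ℝ} (hν : 0 < ν) {a b g : Freq → ℂ} {M W : ℝ≥0∞} (h0 : a 0 = b 0)
    (ha : nsq a ≠ ⊤) (hb : nsq b ≠ ⊤) (hbc : ∀ k, b (-k) = conj (b k)) (hM : hsq a ≤ M)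
    (hMt : M ≠ ⊤) (hWt : W ≠ ⊤) (hg : hsq g ≤ W * nsq (a - b)) :
    ∑' k, rate ν a b g k ≤
      (160000 / ν ^ 3 * M.toReal * (nsq a).toReal + W.toReal / ν) * (hsq (a - b)).toReal := by
  have hc := nsq_sub_ne_top ha hb
  have hhc : hsq (a - b) ≠ ⊤ := ne_top_of_le_ne_top hc (hsq_le_nsq _)
  have hgt : hsq g ≠ ⊤ := ne_top_of_le_ne_top (ENNReal.mul_ne_top hWt hc) hg
  have ht := tri_ne_top hc hc ha
  set z := ∑' k, (om k * ‖(a - b) k‖ₑ) * (om k * ‖g k‖ₑ) with hz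
  have hz2 : z ^ 2 ≤ hsq (a - b) * hsq g := tsum_om_mul_sq_le _ _
  have hzt : z ≠ ⊤ := by
    intro h
    rw [h] at hz2
    simp only [ne_eq, OfNat.ofNat_ne_zero, not_false_eq_true, ENNReal.top_pow, top_le_iff] at hz2
    exact ENNReal.mul_ne_top hhc hgt hz2
  have s1 : HasSum (fun k => ‖(a - b) k‖ ^ 2) (nsq (a - b)).toReal := by
    have := ENNReal.hasSum_toReal (f := fun k => ‖(a - b) k‖ₑ ^ 2) hc
    rw [← ENNReal.tsum_toReal_eq (fun k => by simp)] at this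
    refine this.congr_fun fun k => ?_
    simp
  have s2 : Summable (fun k => conj (a k - b k) * (nonlin a k - nonlin b k) / (lam k : ℂ)) := by
    refine summable_of_tsum_enorm_ne_top (ne_top_of_le_ne_top ?_ (tsum_enorm_nonlin_le ha hb))
    exact ENNReal.add_ne_top.2 ⟨ht, tri_ne_top hb hc hc⟩
  have s3 : Summable (fun k => conj ((a - b) k) * g k / (lam k : ℂ)) := by
    refine summable_of_tsum_enorm_ne_top ?_
    simp only [enorm_conj_mul_div_le]
    exact hzt
  have e : ∑' k, rate ν a b g k = -(2 * ν) * (nsq (a - b)).toReal +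
      2 * (∑' k, conj (a k - b k) * (nonlin a k - nonlin b k) / (lam k : ℂ)).re +
      2 * (∑' k, conj ((a - b) k) * g k / (lam k : ℂ)).re := by
    refine HasSum.tsum_eq ?_
    refine HasSum.congr_fun (((s1.mul_left _).add ((Complex.hasSum_re s2.hasSum).mul_left 2)).add
      ((Complex.hasSum_re s3.hasSum).mul_left 2)) fun k => ?_
    exact rate_eq ν h0 k
  have hz3 : (∑' k, conj ((a - b) k) * g k / (lam k : ℂ)).re ≤ z.toReal := by
    refine (Complex.re_le_norm _).trans ?_
    rw [← toReal_enorm]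
    refine ENNReal.toReal_mono hzt (enorm_tsum_le_tsum_enorm.trans (le_of_eq ?_))
    simp only [enorm_conj_mul_div_le, hz]
  have hn := re_tsum_nonlin_le ha hb hbc
  set x := (nsq (a - b)).toReal
  set h := (hsq (a - b)).toReal
  have k1 : (tri (a - b) (a - b) a).toReal ^ 4 ≤
      10000 * x ^ 3 * (h * (M.toReal * (nsq a).toReal)) := by
    have h1 : tri (a - b) (a - b) a ^ 4 ≤
        10000 * nsq (a - b) ^ 2 * (hsq (a - b) * nsq (a - b)) * (M * nsq a) :=
      (tri_pow_four_le _ _ _).trans (by gcongr)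
    have h2 := ENNReal.toReal_mono (by
      refine ENNReal.mul_ne_top (ENNReal.mul_ne_top (ENNReal.mul_ne_top (by norm_num)
        (ENNReal.pow_ne_top hc)) (ENNReal.mul_ne_top hhc hc)) (ENNReal.mul_ne_top hMt ha)) h1
    simp only [ENNReal.toReal_mul, ENNReal.toReal_pow, ENNReal.toReal_ofNat] at h2
    refine h2.trans (le_of_eq ?_)
    ring
  have k2 : z.toReal ^ 2 ≤ h * (W.toReal * x) := by
    have h1 : z ^ 2 ≤ hsq (a - b) * (W * nsq (a - b)) := hz2.trans (by gcongr)
    have h2 := ENNReal.toReal_mono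
      (ENNReal.mul_ne_top hhc (ENNReal.mul_ne_top hWt hc)) h1
    simpa only [ENNReal.toReal_mul, ENNReal.toReal_pow] using h2
  have k3 := add_le_of_pow_four_le hν ENNReal.toReal_nonneg (by positivity) k1
  have k4 := add_le_of_sq_le hν ENNReal.toReal_nonneg ENNReal.toReal_nonneg
    ENNReal.toReal_nonneg k2
  rw [e]
  have k5 : (160000 / ν ^ 3 * M.toReal * (nsq a).toReal + W.toReal / ν) * h =
      160000 / ν ^ 3 * (h * (M.toReal * (nsq a).toReal)) + W.toReal / ν * h := by ring
  rw [k5]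
  linarith

/-! ### Evolution of the Fourier coefficients -/

lemma intervalIntegrable_of_mem_Icc {E : Type*} [NormedAddCommGroup E] {f : ℝ → E} {T s t : ℝ}
    (hf : IntegrableOn f (Set.Icc 0 T)) (hs : s ∈ Set.Icc 0 T) (ht : t ∈ Set.Icc 0 T) :
    IntervalIntegrable f volume s t := by
  rw [intervalIntegrable_iff]
  refine hf.mono_set (Set.uIoc_subset_uIcc.trans ?_)
  exact Set.uIcc_subset_Icc hs ht

/-- Gronwall's lemma with an integrable coefficient. -/
lemma eq_zero_of_le_integral {T : ℝ} {e g : ℝ → ℝ} (he : ∀ t ∈ Set.Icc 0 T, 0 ≤ e t)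
    (hg : ∀ t ∈ Set.Icc 0 T, 0 ≤ g t) (hgi : IntegrableOn g (Set.Icc 0 T))
    (hge : IntegrableOn (fun t => g t * e t) (Set.Icc 0 T))
    (hle : ∀ t ∈ Set.Icc 0 T, e t ≤ ∫ r in (0 : ℝ)..t, g r * e r) :
    ∀ t ∈ Set.Icc 0 T, e t = 0 := by
  intro t ht
  have hT : 0 ≤ T := ht.1.trans ht.2
  have h0 : (0 : ℝ) ∈ Set.Icc 0 T := ⟨le_rfl, hT⟩
  set y : ℝ → ℝ := fun t => ∫ r in (0 : ℝ)..t, g r * e r with hy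
  have hyc : ContinuousOn y (Set.Icc 0 T) := by
    have := intervalIntegral.continuousOn_primitive_interval (μ := volume) (a := 0) (b := T)
      (f := fun r => g r * e r) (by rwa [Set.uIcc_of_le hT])
    rwa [Set.uIcc_of_le hT] at this
  have hGc : ContinuousOn (fun t => ∫ r in (0 : ℝ)..t, g r) (Set.Icc 0 T) := by
    have := intervalIntegral.continuousOn_primitive_interval (μ := volume) (a := 0) (b := T)
      (f := g) (by rwa [Set.uIcc_of_le hT])
    rwa [Set.uIcc_of_le hT] at this
  have hdiff : ∀ f : ℝ → ℝ, IntegrableOn f (Set.Icc 0 T) → ∀ s ∈ Set.Icc 0 T, ∀ t ∈ Set.Icc 0 T,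
      (∫ r in (0 : ℝ)..t, f r) - ∫ r in (0 : ℝ)..s, f r = ∫ r in s..t, f r :=
    fun f hf s hs t ht => intervalIntegral.integral_interval_sub_left
      (intervalIntegrable_of_mem_Icc hf h0 ht) (intervalIntegrable_of_mem_Icc hf h0 hs)
  have hmono : ∀ s ∈ Set.Icc 0 T, ∀ t ∈ Set.Icc 0 T, s ≤ t → y s ≤ y t := by
    intro s hs t ht hst
    rw [← sub_nonneg, hy]
    simp only
    rw [hdiff _ hge s hs t ht]
    refine intervalIntegral.integral_nonneg hst fun r hr => ?_
    have hr' : r ∈ Set.Icc 0 T := ⟨hs.1.trans hr.1, hr.2.trans ht.2⟩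
    exact mul_nonneg (hg r hr') (he r hr')
  -- A continuity argument instead of exponentials: the zero set of the primitive `y` is closed,
  -- contains `0`, and extends to the right of each of its points.
  have hkey : Set.Icc 0 T ⊆ {t | y t = 0} := by
    refine IsClosed.Icc_subset_of_forall_mem_nhdsWithin ?_ ?_ ?_
    · have : {t | y t = 0} ∩ Set.Icc 0 T = Set.Icc 0 T ∩ y ⁻¹' {0} := by
        ext; simp [and_comm]
      rw [this]
      exact hyc.preimage_isClosed_of_isClosed isClosed_Icc isClosed_singleton
    · simp [hy]
    · rintro s ⟨hs0, hs⟩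
      have hsI : s ∈ Set.Icc 0 T := ⟨hs.1, hs.2.le⟩
      have hc := (hGc s hsI).mono (show Set.Ioo s T ⊆ Set.Icc 0 T from
        fun r hr => ⟨hs.1.trans hr.1.le, hr.2.le⟩)
      have hev : ∀ᶠ r in nhdsWithin s (Set.Ioi s),
          (∫ q in (0 : ℝ)..r, g q) < (∫ q in (0 : ℝ)..s, g q) + 1 / 2 := by
        have h1 : nhdsWithin s (Set.Ioi s) = nhdsWithin s (Set.Ioo s T) :=
          (nhdsWithin_Ioo_eq_nhdsGT hs.2).symm
        rw [h1]
        exact hc.eventually_lt_const (by linarith)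
      filter_upwards [hev, Ioo_mem_nhdsGT hs.2] with t hlt htm
      have htI : t ∈ Set.Icc 0 T := ⟨hs.1.trans htm.1.le, htm.2.le⟩
      have hst : s ≤ t := htm.1.le
      have hy0 : 0 ≤ y t := by
        have := hmono 0 h0 t htI htI.1
        simpa [hy] using this
      have h1 : y t = ∫ r in s..t, g r * e r := by
        rw [← hdiff _ hge s hsI t htI]
        have : (∫ r in (0 : ℝ)..s, g r * e r) = 0 := hs0
        rw [this, sub_zero]
      -- On a short interval the integral of `g` is below `1 / 2` and `e ≤ y t` by monotonicity, so
      -- `y t ≤ y t / 2`. Continuity of `e` is not used.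
      have h2 : ∫ r in s..t, g r * e r ≤ ∫ r in s..t, g r * y t := by
        refine intervalIntegral.integral_mono_on hst
          (intervalIntegrable_of_mem_Icc hge hsI htI)
          ((intervalIntegrable_of_mem_Icc hgi hsI htI).mul_const _) fun r hr => ?_
        have hr' : r ∈ Set.Icc 0 T := ⟨hs.1.trans hr.1, hr.2.trans htI.2⟩
        exact mul_le_mul_of_nonneg_left ((hle r hr').trans (hmono r hr' t htI hr.2)) (hg r hr')
      rw [intervalIntegral.integral_mul_const, ← hdiff _ hgi s hsI t htI] at h2
      change y t = 0
      nlinarith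
  exact le_antisymm ((hle t ht).trans_eq (hkey ht)) (he t ht)

/-- `u` is differentiable only almost everywhere, but as a primitive of an integrable function it is
absolutely continuous, so the product rule may be integrated. -/
lemma sq_integral_eq {T : ℝ} {u h : ℝ → ℝ} (hT : 0 ≤ T) (hi : IntervalIntegrable h volume 0 T)
    (hu : ∀ t ∈ Set.Icc 0 T, u t = ∫ r in (0 : ℝ)..t, h r) :
    u T ^ 2 = ∫ r in (0 : ℝ)..T, 2 * (u r * h r) := by
  set w : ℝ → ℝ := fun t => ∫ r in (0 : ℝ)..t, h r
  have hac : AbsolutelyContinuousOnInterval w 0 T :=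
    hi.absolutelyContinuousOnInterval_intervalIntegral (by simp)
  have h1 := AbsolutelyContinuousOnInterval.integral_deriv_mul_eq_sub hac hac
  have h2 : w 0 = 0 := by simp [w]
  rw [h2, mul_zero, sub_zero] at h1
  rw [hu T ⟨hT, le_rfl⟩, sq, ← h1]
  refine intervalIntegral.integral_congr_ae ?_
  filter_upwards [hi.ae_hasDerivAt_integral] with r hr hrm
  have hd := (hr (Set.uIoc_subset_uIcc hrm) 0 (by simp)).deriv
  rw [Set.uIoc_of_le hT] at hrm
  rw [hd, hu r ⟨hrm.1.le, hrm.2⟩]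
  ring

lemma normSq_integral_eq {T : ℝ} {u h : ℝ → ℂ} (hT : 0 ≤ T) (hi : IntervalIntegrable h volume 0 T)
    (hu : ∀ t ∈ Set.Icc 0 T, u t = ∫ r in (0 : ℝ)..t, h r) :
    ‖u T‖ ^ 2 = ∫ r in (0 : ℝ)..T, 2 * (conj (u r) * h r).re := by
  have hiI : ∀ t ∈ Set.Icc 0 T, IntervalIntegrable h volume 0 t := fun t ht =>
    hi.mono_set (by rw [Set.uIcc_of_le hT, Set.uIcc_of_le ht.1]; exact Set.Icc_subset_Icc_right ht.2)
  have hre : ∀ t ∈ Set.Icc 0 T, (u t).re = ∫ r in (0 : ℝ)..t, (h r).re := fun t ht => by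
    rw [hu t ht]
    exact (Complex.reCLM.intervalIntegral_comp_comm (hiI t ht)).symm
  have him : ∀ t ∈ Set.Icc 0 T, (u t).im = ∫ r in (0 : ℝ)..t, (h r).im := fun t ht => by
    rw [hu t ht]
    exact (Complex.imCLM.intervalIntegral_comp_comm (hiI t ht)).symm
  have hir : IntervalIntegrable (fun r => (h r).re) volume 0 T := ⟨hi.1.re, hi.2.re⟩
  have hii : IntervalIntegrable (fun r => (h r).im) volume 0 T := ⟨hi.1.im, hi.2.im⟩
  have hcont : ∀ f : ℝ → ℝ, IntervalIntegrable f volume 0 T → ∀ w : ℝ → ℝ,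
      (∀ t ∈ Set.Icc 0 T, w t = ∫ r in (0 : ℝ)..t, f r) → ContinuousOn w (Set.uIcc 0 T) := by
    intro f hf w hw
    have := intervalIntegral.continuousOn_primitive_interval (μ := volume) (a := 0) (b := T)
      (f := f) (by rw [Set.uIcc_of_le hT]; exact (intervalIntegrable_iff_integrableOn_Icc_of_le hT).1 hf)
    refine this.congr fun t ht => hw t (by rwa [Set.uIcc_of_le hT] at ht)
  rw [← Complex.normSq_eq_norm_sq, Complex.normSq_apply, ← sq, ← sq,
    sq_integral_eq hT hir hre, sq_integral_eq hT hii him, ← intervalIntegral.integral_add]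
  · refine intervalIntegral.integral_congr fun r _ => ?_
    simp only [Complex.mul_re, Complex.conj_re, Complex.conj_im]
    ring
  · exact (hir.continuousOn_mul (hcont _ hir _ hre)).const_mul 2
  · exact (hii.continuousOn_mul (hcont _ hii _ him)).const_mul 2

/-! ### Measurability and integrability in time -/

lemma aemeasurable_nonlin {μ : Measure ℝ} {a : ℝ → Freq → ℂ}
    (ha : ∀ k, AEMeasurable (fun t => a t k) μ) (k : Freq) :
    AEMeasurable (fun t => nonlin (a t) k) μ :=
  AEMeasurable.tsum fun l => ((ha l).mul (ha (k - l))).const_mul _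

lemma aemeasurable_nsq {μ : Measure ℝ} {a : ℝ → Freq → ℂ}
    (ha : ∀ k, AEMeasurable (fun t => a t k) μ) : AEMeasurable (fun t => nsq (a t)) μ :=
  AEMeasurable.tsum fun k => (ha k).enorm.pow_const 2

lemma aemeasurable_hsq {μ : Measure ℝ} {a : ℝ → Freq → ℂ}
    (ha : ∀ k, AEMeasurable (fun t => a t k) μ) : AEMeasurable (fun t => hsq (a t)) μ :=
  AEMeasurable.tsum fun k => ((ha k).enorm.const_mul _).pow_const 2

lemma integrable_nonlin {μ : Measure ℝ} {a : ℝ → Freq → ℂ}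
    (ha : ∀ k, AEMeasurable (fun t => a t k) μ) (hY : ∫⁻ t, nsq (a t) ∂μ ≠ ⊤) (k : Freq) :
    Integrable (fun t => nonlin (a t) k) μ := by
  refine ⟨(aemeasurable_nonlin ha k).aestronglyMeasurable, ?_⟩
  calc ∫⁻ t, ‖nonlin (a t) k‖ₑ ∂μ
      ≤ ∫⁻ t, ENNReal.ofReal (Real.sqrt (lam k)) * nsq (a t) ∂μ :=
        lintegral_mono fun t => enorm_nonlin_le (a t) k
    _ = ENNReal.ofReal (Real.sqrt (lam k)) * ∫⁻ t, nsq (a t) ∂μ :=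
        lintegral_const_mul' _ _ ENNReal.ofReal_ne_top
    _ < ⊤ := ENNReal.mul_lt_top ENNReal.ofReal_lt_top (lt_top_iff_ne_top.2 hY)

/-- Uniqueness for the evolution of the Fourier coefficients. -/
theorem coeff_eq_of_integral_eq {ν T : ℝ} (hν : 0 < ν) {a b g : ℝ → Freq → ℂ} {M W : ℝ≥0∞}
    (hMt : M ≠ ⊤) (hWt : W ≠ ⊤)
    (ha : ∀ k, ContinuousOn (fun t => a t k) (Set.Icc 0 T))
    (hb : ∀ k, ContinuousOn (fun t => b t k) (Set.Icc 0 T))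
    (h0 : ∀ t ∈ Set.Icc 0 T, a t 0 = b t 0)
    (hbc : ∀ t ∈ Set.Icc 0 T, ∀ k, b t (-k) = conj (b t k))
    (hYa : ∫⁻ t in Set.Icc 0 T, nsq (a t) ≠ ⊤) (hYb : ∫⁻ t in Set.Icc 0 T, nsq (b t) ≠ ⊤)
    (hMa : ∀ᵐ t ∂volume.restrict (Set.Icc 0 T), hsq (a t) ≤ M)
    (hMb : ∀ᵐ t ∂volume.restrict (Set.Icc 0 T), hsq (b t) ≤ M)
    (hg : ∀ k, IntegrableOn (fun t => g t k) (Set.Icc 0 T))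
    (hgW : ∀ᵐ t ∂volume.restrict (Set.Icc 0 T), hsq (g t) ≤ W * nsq (a t - b t))
    (heq : ∀ t ∈ Set.Icc 0 T, ∀ k, a t k - b t k = ∫ r in (0 : ℝ)..t,
      (-((ν * lam k : ℝ) : ℂ) * (a r k - b r k) + (nonlin (a r) k - nonlin (b r) k) + g r k)) :
    ∀ t ∈ Set.Icc 0 T, a t = b t := by
  set μ := volume.restrict (Set.Icc 0 T) with hμ
  have ham : ∀ k, AEMeasurable (fun t => a t k) μ := fun k =>
    ((ha k).aestronglyMeasurable measurableSet_Icc).aemeasurable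
  have hbm : ∀ k, AEMeasurable (fun t => b t k) μ := fun k =>
    ((hb k).aestronglyMeasurable measurableSet_Icc).aemeasurable
  have hcm : ∀ k, AEMeasurable (fun t => (a t - b t) k) μ := fun k => (ham k).sub (hbm k)
  have hmem : ∀ᵐ t ∂μ, t ∈ Set.Icc 0 T := ae_restrict_mem measurableSet_Icc
  have hna : ∀ᵐ t ∂μ, nsq (a t) < ⊤ := ae_lt_top' (aemeasurable_nsq ham) hYa
  have hnb : ∀ᵐ t ∂μ, nsq (b t) < ⊤ := ae_lt_top' (aemeasurable_nsq hbm) hYb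
  have hci : ∀ k, IntegrableOn (fun t => a t k - b t k) (Set.Icc 0 T) := fun k =>
    ((ha k).sub (hb k)).integrableOn_Icc
  have hFi : ∀ k, IntegrableOn (fun r => -((ν * lam k : ℝ) : ℂ) * (a r k - b r k) +
      (nonlin (a r) k - nonlin (b r) k) + g r k) (Set.Icc 0 T) := fun k =>
    (((hci k).const_mul _).add ((integrable_nonlin ham hYa k).sub (integrable_nonlin hbm hYb k))).add
      (hg k)
  have hsqe : ∀ t ∈ Set.Icc 0 T, ∀ k, ‖a t k - b t k‖ ^ 2 / lam k =
      ∫ r in (0 : ℝ)..t, rate ν (a r) (b r) (g r) k := by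
    intro t ht k
    have hT : (0 : ℝ) ∈ Set.Icc 0 T := ⟨le_rfl, ht.1.trans ht.2⟩
    rw [normSq_integral_eq (u := fun t => a t k - b t k) ht.1
      (intervalIntegrable_of_mem_Icc (hFi k) hT ht) fun s hs => heq s ⟨hs.1, hs.2.trans ht.2⟩ k,
      ← intervalIntegral.integral_div]
    rfl
  have hrm : ∀ k, AEStronglyMeasurable (fun r => rate ν (a r) (b r) (g r) k) μ := by
    intro k
    refine AEMeasurable.aestronglyMeasurable ?_
    refine AEMeasurable.div_const (AEMeasurable.const_mul ?_ 2) _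
    refine Complex.measurable_re.comp_aemeasurable ?_
    exact (Complex.continuous_conj.measurable.comp_aemeasurable (hcm k)).mul
      (hFi k).aestronglyMeasurable.aemeasurable
  -- This absolute bound replaces differentiation under the infinite sum: it permits writing the
  -- squared `H⁻¹` norm as the time integral of the sum of the rates.
  have hbound : ∑' k, ∫⁻ r, ‖rate ν (a r) (b r) (g r) k‖ₑ ∂μ ≠ ⊤ := by
    rw [← lintegral_tsum fun k => (hrm k).enorm]
    have h1 : ∫⁻ r, ∑' k, ‖rate ν (a r) (b r) (g r) k‖ₑ ∂μ ≤
        ∫⁻ r, (4 * ENNReal.ofReal ν + 126 * (1 + M + W)) * (1 + nsq (a r) + nsq (b r)) ∂μ := by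
      refine lintegral_mono_ae ?_
      filter_upwards [hmem, hna, hnb, hMa, hMb, hgW] with r hr h1 h2 h3 h4 h5
      exact tsum_enorm_rate_le hν (h0 r hr) h1.ne h2.ne h3 h4 h5
    refine ne_top_of_le_ne_top ?_ h1
    have hK : 4 * ENNReal.ofReal ν + 126 * (1 + M + W) ≠ ⊤ := by
      simp [ENNReal.add_eq_top, ENNReal.mul_eq_top, hMt, hWt]
    rw [lintegral_const_mul' _ _ hK, lintegral_add_right' _ (aemeasurable_nsq hbm),
      lintegral_add_left measurable_const]
    refine ENNReal.mul_ne_top hK (ENNReal.add_ne_top.2 ⟨ENNReal.add_ne_top.2 ⟨?_, hYa⟩, hYb⟩)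
    simp [hμ]
  set e : ℝ → ℝ := fun t => ∑' k, ‖a t k - b t k‖ ^ 2 / lam k with he
  set D : ℝ → ℝ := fun r => ∑' k, rate ν (a r) (b r) (g r) k with hD
  have hle : ∀ t ∈ Set.Icc 0 T, volume.restrict (Set.Ioc 0 t) ≤ μ := fun t ht =>
    Measure.restrict_mono
      (show Set.Ioc 0 t ⊆ Set.Icc 0 T from fun r hr => ⟨hr.1.le, hr.2.trans ht.2⟩) le_rfl
  have hbt : ∀ t ∈ Set.Icc 0 T,
      ∑' k, ∫⁻ r in Set.Ioc 0 t, ‖rate ν (a r) (b r) (g r) k‖ₑ ≠ ⊤ := fun t ht =>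
    ne_top_of_le_ne_top hbound (ENNReal.tsum_le_tsum fun k => lintegral_mono' (hle t ht) le_rfl)
  have heD : ∀ t ∈ Set.Icc 0 T, e t = ∫ r in (0 : ℝ)..t, D r := by
    intro t ht
    rw [intervalIntegral.integral_of_le ht.1, hD, integral_tsum
      (fun k => (hrm k).mono_measure (hle t ht)) (hbt t ht), he]
    refine tsum_congr fun k => ?_
    rw [hsqe t ht k, intervalIntegral.integral_of_le ht.1]
  have hDi : IntegrableOn D (Set.Icc 0 T) := by
    refine ⟨(AEMeasurable.tsum fun k => (hrm k).aemeasurable).aestronglyMeasurable, ?_⟩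
    refine lt_of_le_of_lt (lintegral_mono fun r => enorm_tsum_le_tsum_enorm) ?_
    rw [lintegral_tsum fun k => (hrm k).enorm]
    exact lt_top_iff_ne_top.2 hbound
  have hec : ∀ᵐ t ∂μ, e t = (hsq (a t - b t)).toReal := by
    filter_upwards [hna, hnb] with t h1 h2
    have hc := ne_top_of_le_ne_top (nsq_sub_ne_top h1.ne h2.ne) (hsq_le_nsq _)
    rw [hsq, ENNReal.tsum_toReal_eq (fun k => by
      exact ENNReal.pow_ne_top (ENNReal.mul_ne_top (om_ne_top k) enorm_ne_top))]
    refine tsum_congr fun k => ?_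
    rw [mul_pow, om_sq, ENNReal.toReal_mul, ENNReal.toReal_ofReal (inv_nonneg.2 (lam_nonneg k)),
      ENNReal.toReal_pow, toReal_enorm, Pi.sub_apply]
    field_simp
  have he0 : ∀ t, 0 ≤ e t := fun t => tsum_nonneg fun k => div_nonneg (sq_nonneg _) (lam_nonneg k)
  set q : ℝ → ℝ := fun r =>
    160000 / ν ^ 3 * M.toReal * (nsq (a r)).toReal + W.toReal / ν with hq
  have hqi : IntegrableOn q (Set.Icc 0 T) := by
    refine Integrable.add (Integrable.const_mul ?_ _) (by simp)
    exact integrable_toReal_of_lintegral_ne_top (aemeasurable_nsq ham) hYa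
  -- Although `q` is merely integrable, `e` is essentially bounded by `4 * M`, so Gronwall's lemma
  -- applies.
  have hqe : IntegrableOn (fun r => q r * e r) (Set.Icc 0 T) := by
    refine Integrable.mul_bdd (c := (4 * M).toReal) hqi ?_ ?_
    · exact ((aemeasurable_hsq hcm).ennreal_toReal.congr (hec.mono fun t h => h.symm)).aestronglyMeasurable
    · filter_upwards [hec, hMa, hMb] with t h1 h2 h3
      rw [Real.norm_of_nonneg (he0 t), h1]
      refine ENNReal.toReal_mono (ENNReal.mul_ne_top (by norm_num) hMt) ?_
      refine (hsq_sub_le _ _).trans ?_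
      calc 2 * (hsq (a t) + hsq (b t)) ≤ 2 * (M + M) := by gcongr
        _ = 4 * M := by ring
  have hDq : ∀ᵐ r ∂μ, D r ≤ q r * e r := by
    filter_upwards [hmem, hna, hnb, hMa, hgW, hec] with r hr h1 h2 h3 h5 h6
    rw [h6]
    exact tsum_rate_le hν (h0 r hr) h1.ne h2.ne (hbc r hr) h3 hMt hWt h5
  have hfin := eq_zero_of_le_integral (T := T) (e := e) (g := q) (fun t _ => he0 t)
    (fun t _ => by positivity) hqi hqe (fun t ht => by
      have hT : (0 : ℝ) ∈ Set.Icc 0 T := ⟨le_rfl, ht.1.trans ht.2⟩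
      rw [heD t ht]
      refine intervalIntegral.integral_mono_ae_restrict ht.1
        (intervalIntegrable_of_mem_Icc hDi hT ht) (intervalIntegrable_of_mem_Icc hqe hT ht) ?_
      exact ae_mono (Measure.restrict_mono (Set.Icc_subset_Icc_right ht.2) le_rfl) hDq)
  intro t ht
  funext k
  rcases eq_or_ne k 0 with rfl | hk
  · exact h0 t ht
  -- A divergent `tsum` takes the value `0`, so `e t = 0` says nothing without summability. It is
  -- obtained at every time from the integrated rates, whereas the `ℓ²` bounds hold at almost every
  -- time only.
  have hs : Summable (fun k => ‖a t k - b t k‖ ^ 2 / lam k) := by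
    have h1 : ∑' k, ‖∫ r in Set.Ioc 0 t, rate ν (a r) (b r) (g r) k‖ₑ ≠ ⊤ :=
      ne_top_of_le_ne_top (hbt t ht) (ENNReal.tsum_le_tsum fun k => enorm_integral_le_lintegral_enorm _)
    have h2 : Summable (fun k => ∫ r in Set.Ioc 0 t, rate ν (a r) (b r) (g r) k) :=
      Summable.of_nnnorm (ENNReal.tsum_coe_ne_top_iff_summable.1 h1)
    refine h2.congr fun k => ?_
    rw [hsqe t ht k, intervalIntegral.integral_of_le ht.1]
  have h1 : ‖a t k - b t k‖ ^ 2 / lam k ≤ e t :=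
    hs.le_tsum k fun j _ => div_nonneg (sq_nonneg _) (lam_nonneg j)
  rw [hfin t ht, div_le_iff₀ (lam_pos hk), zero_mul] at h1
  have h2 : ‖a t k - b t k‖ = 0 := pow_eq_zero_iff two_ne_zero |>.1 (le_antisymm h1 (sq_nonneg _))
  exact sub_eq_zero.1 (norm_eq_zero.1 h2)

/-! ### Fourier series on the torus -/

lemma volume_torus_eq :
    (volume : Measure Torus) = Measure.pi fun _ : Fin 2 => AddCircle.haarAddCircle := by
  have h : (volume : Measure UnitAddCircle) = AddCircle.haarAddCircle := by
    rw [AddCircle.volume_eq_smul_haarAddCircle]; simp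
  rw [volume_pi, h]

instance : IsProbabilityMeasure (volume : Measure Torus) := by
  rw [volume_torus_eq]; infer_instance

/-- Fourier coefficients of a function. -/
def fc (f : Torus → ℂ) (k : Freq) : ℂ := ∫ x, UnitAddTorus.mFourier (-k) x * f x

/-- Fourier coefficients of a measure. -/
def mc (γ : Measure Torus) (k : Freq) : ℂ := ∫ x, UnitAddTorus.mFourier (-k) x ∂γ

lemma norm_mFourier_le (k : Freq) (x : Torus) : ‖UnitAddTorus.mFourier k x‖ ≤ 1 :=
  ((UnitAddTorus.mFourier k).norm_coe_le_norm x).trans UnitAddTorus.mFourier_norm.le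

lemma fc_eq {f : Torus → ℂ}
    (hf : MemLp f 2 (Measure.pi fun _ : Fin 2 => AddCircle.haarAddCircle)) (k : Freq) :
    UnitAddTorus.mFourierCoeff (hf.toLp f : Torus → ℂ) k = fc f k := by
  rw [fc, volume_torus_eq]
  refine integral_congr_ae ?_
  filter_upwards [hf.coeFn_toLp] with x hx
  simp only [smul_eq_mul]
  exact congrArg _ hx

lemma hasSum_parseval {f g : Torus → ℂ} (hf : MemLp f 2 volume) (hg : MemLp g 2 volume) :
    HasSum (fun k => conj (fc f k) * fc g k) (∫ x, conj (f x) * g x) := by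
  rw [volume_torus_eq] at hf hg ⊢
  have h := UnitAddTorus.hasSum_prod_mFourierCoeff (hf.toLp f) (hg.toLp g)
  simp only [fc_eq] at h
  convert! h using 1
  refine integral_congr_ae ?_
  filter_upwards [hf.coeFn_toLp, hg.coeFn_toLp] with x hx hy
  exact congrArg₂ (fun a b => conj a * b) hx.symm hy.symm

lemma nsq_fc {f : Torus → ℂ} (hf : MemLp f 2 volume) :
    nsq (fc f) = ∫⁻ x, ‖f x‖ₑ ^ 2 := by
  have h1 := Complex.hasSum_re (hasSum_parseval hf hf)
  have h2 : HasSum (fun k => ‖fc f k‖ ^ 2) (∫ x, conj (f x) * f x).re := by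
    refine h1.congr_fun fun k => ?_
    rw [mul_comm, Complex.mul_conj, Complex.ofReal_re, Complex.normSq_eq_norm_sq]
  have hi : Integrable (fun x => conj (f x) * f x) := by
    have := hf.star.integrable_mul hf
    exact this
  have h3 : (∫ x, conj (f x) * f x).re = ∫ x, ‖f x‖ ^ 2 := by
    rw [← RCLike.re_eq_complex_re, ← integral_re hi]
    refine integral_congr_ae (Filter.Eventually.of_forall fun x => ?_)
    simp only
    rw [mul_comm, Complex.mul_conj, RCLike.re_eq_complex_re, Complex.ofReal_re,
      Complex.normSq_eq_norm_sq]
  rw [h3] at h2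
  have h4 : ∀ z : ℂ, ‖z‖ₑ ^ 2 = ENNReal.ofReal (‖z‖ ^ 2) := fun z => by
    rw [ENNReal.ofReal_pow (norm_nonneg _), ofReal_norm]
  simp only [nsq, h4]
  rw [← ENNReal.ofReal_tsum_of_nonneg (fun k => sq_nonneg _) h2.summable, h2.tsum_eq,
    ofReal_integral_eq_lintegral_ofReal (hf.integrable_norm_pow two_ne_zero)
      (Filter.Eventually.of_forall fun x => sq_nonneg _)]

/-- Riesz–Fischer: the characters form a Hilbert basis, so every square summable family consists of
the coefficients of an `L²` function. -/
lemma exists_fc_eq {c : Freq → ℂ} (hc : nsq c ≠ ⊤) :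
    ∃ f : Torus → ℂ, StronglyMeasurable f ∧ MemLp f 2 volume ∧ ∀ k, fc f k = c k := by
  have hm : Memℓp c 2 := by
    refine memℓp_gen ?_
    have h : Summable (fun k => ‖c k‖₊ ^ 2) := by
      refine ENNReal.tsum_coe_ne_top_iff_summable.1 ?_
      refine fun h => hc ?_
      rw [nsq, ← h]
      exact tsum_congr fun k => by rw [ENNReal.coe_pow]; rfl
    have h2 := NNReal.summable_coe.2 h
    refine h2.congr fun k => ?_
    simp
  set g := (UnitAddTorus.mFourierBasis (d := Fin 2)).repr.symm ⟨c, hm⟩ with hg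
  refine ⟨g, Lp.stronglyMeasurable g, ?_, fun k => ?_⟩
  · rw [volume_torus_eq]; exact Lp.memLp g
  · have h1 := UnitAddTorus.mFourierBasis_repr g k
    rw [hg, LinearIsometryEquiv.apply_symm_apply] at h1
    have h2 : UnitAddTorus.mFourierCoeff (g : Torus → ℂ) k = fc g k := by
      rw [fc, volume_torus_eq]; rfl
    rw [← h2]; exact h1.symm

/-! ### Measures and their Fourier coefficients -/

/-- The functional `φ ↦ ∫ φ g dμ` on continuous functions. -/
def intCLM (μ : Measure Torus) [IsFiniteMeasure μ] (g : Torus → ℂ) (hg : Integrable g μ) :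
    C(Torus, ℂ) →L[ℂ] ℂ :=
  LinearMap.mkContinuous
    { toFun := fun φ => ∫ x, φ x * g x ∂μ
      map_add' := fun φ ψ => by
        simp only [ContinuousMap.add_apply, add_mul]
        exact integral_add (hg.bdd_mul φ.continuous.aestronglyMeasurable
          (Filter.Eventually.of_forall φ.norm_coe_le_norm)) (hg.bdd_mul
          ψ.continuous.aestronglyMeasurable (Filter.Eventually.of_forall ψ.norm_coe_le_norm))
      map_smul' := fun r φ => by
        simp only [ContinuousMap.smul_apply, smul_eq_mul, mul_assoc, RingHom.id_apply]
        exact integral_const_mul _ _ }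
    (∫ x, ‖g x‖ ∂μ) fun φ => by
      refine (norm_integral_le_of_norm_le (hg.norm.const_mul ‖φ‖)
        (Filter.Eventually.of_forall fun x => ?_)).trans (le_of_eq ?_)
      · rw [norm_mul]; gcongr; exact φ.norm_coe_le_norm x
      · rw [integral_const_mul, mul_comm]

lemma intCLM_apply (μ : Measure Torus) [IsFiniteMeasure μ] (g : Torus → ℂ) (hg : Integrable g μ)
    (φ : C(Torus, ℂ)) : intCLM μ g hg φ = ∫ x, φ x * g x ∂μ := rfl

/-- Trigonometric polynomials are dense in the continuous functions. -/
lemma clm_ext {L L' : C(Torus, ℂ) →L[ℂ] ℂ}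
    (h : ∀ k : Freq, L (UnitAddTorus.mFourier (-k)) = L' (UnitAddTorus.mFourier (-k))) :
    L = L' := by
  refine ContinuousLinearMap.ext_on (s := Set.range (UnitAddTorus.mFourier (d := Fin 2))) ?_ ?_
  · rw [Submodule.dense_iff_topologicalClosure_eq_top]
    exact UnitAddTorus.span_mFourier_closure_eq_top
  · rintro _ ⟨k, rfl⟩
    simpa using h (-k)

/-- A finite measure is determined by its Fourier coefficients. -/
lemma measure_eq_of_mc_eq {μ μ' : Measure Torus} [IsFiniteMeasure μ] [IsFiniteMeasure μ']
    (h : ∀ k, mc μ k = mc μ' k) : μ = μ' := by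
  have hL : intCLM μ (fun _ => 1) (integrable_const _) =
      intCLM μ' (fun _ => 1) (integrable_const _) := clm_ext fun k => by
    simpa [intCLM_apply, mc] using h k
  refine ext_of_forall_integral_eq_of_IsFiniteMeasure fun f => ?_
  have h1 := congrArg (fun L => L ⟨fun x => (f x : ℂ), by fun_prop⟩) hL
  simp only [intCLM_apply, ContinuousMap.coe_mk, mul_one, integral_complex_ofReal] at h1
  exact_mod_cast h1

/-- A finite measure with square summable Fourier coefficients has a density in `L²`. -/
lemma exists_density {γ : Measure Torus} [IsFiniteMeasure γ] (h : nsq (mc γ) ≠ ⊤) :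
    ∃ f : Torus → ℝ, Measurable f ∧ (∀ x, 0 ≤ f x) ∧ MemLp f 2 volume ∧
      γ = volume.withDensity fun x => ENNReal.ofReal (f x) := by
  obtain ⟨g, hgm, hg2, hgc⟩ := exists_fc_eq h
  have hgi : Integrable g := hg2.integrable one_le_two
  set f : Torus → ℝ := fun x => (g x).re with hf
  have hfm : Measurable f := Complex.measurable_re.comp hgm.measurable
  have hf2 : MemLp f 2 volume := hg2.re
  have hfi : Integrable f := hf2.integrable one_le_two
  have hL : intCLM γ (fun _ => 1) (integrable_const _) = intCLM volume g hgi := clm_ext fun k => by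
    simpa [intCLM_apply, mc, fc] using (hgc k).symm
  have hint : ∀ φ : BoundedContinuousFunction Torus ℝ, ∫ x, φ x ∂γ = ∫ x, φ x * f x := by
    intro φ
    have h1 := congrArg (fun L => L ⟨fun x => (φ x : ℂ), by fun_prop⟩) hL
    simp only [intCLM_apply, ContinuousMap.coe_mk, mul_one, integral_complex_ofReal] at h1
    have h2 := congrArg Complex.re h1
    rw [Complex.ofReal_re, ← RCLike.re_eq_complex_re, ← integral_re] at h2
    · rw [h2]
      refine integral_congr_ae (Filter.Eventually.of_forall fun x => ?_)
      simp [hf]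
    · refine hgi.bdd_mul (c := ‖φ‖) ?_ (Filter.Eventually.of_forall fun x => ?_)
      · exact (show Continuous fun x => (φ x : ℂ) by fun_prop).aestronglyMeasurable
      · rw [Complex.norm_real]; exact φ.norm_coe_le_norm x
  set n : Measure Torus := volume.withDensity fun x => ENNReal.ofReal (-f x) with hn
  set p : Measure Torus := volume.withDensity fun x => ENNReal.ofReal (f x) with hp
  have : IsFiniteMeasure n := isFiniteMeasure_withDensity_ofReal hfi.neg.2
  have : IsFiniteMeasure p := isFiniteMeasure_withDensity_ofReal hfi.2
  have hnp : γ + n = p := by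
    refine ext_of_forall_integral_eq_of_IsFiniteMeasure fun φ => ?_
    rw [integral_add_measure (φ.integrable _) (φ.integrable _), hint φ, hn, hp,
      integral_withDensity_eq_integral_toReal_smul (by fun_prop) (by simp),
      integral_withDensity_eq_integral_toReal_smul (by fun_prop) (by simp), ← integral_add]
    · refine integral_congr_ae (Filter.Eventually.of_forall fun x => ?_)
      simp only [smul_eq_mul]
      rcases le_total 0 (f x) with hx | hx
      · rw [ENNReal.toReal_ofReal hx, ENNReal.ofReal_of_nonpos (by linarith)]; simp [mul_comm]
      · rw [ENNReal.toReal_ofReal (by linarith), ENNReal.ofReal_of_nonpos hx]; simp; ring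
    · exact hfi.bdd_mul (c := ‖φ‖) φ.continuous.aestronglyMeasurable
        (Filter.Eventually.of_forall φ.norm_coe_le_norm)
    · refine Integrable.mul_bdd (c := ‖φ‖) ?_ φ.continuous.aestronglyMeasurable
        (Filter.Eventually.of_forall φ.norm_coe_le_norm)
      refine (hfi.neg.pos_part).congr (Filter.Eventually.of_forall fun x => ?_)
      simp only [Pi.neg_apply]
      rw [ENNReal.toReal_ofReal']
  have hA : MeasurableSet {x | f x < 0} := measurableSet_lt hfm measurable_const
  -- The negative part lives on the set where `f < 0`; there `p` vanishes, and `n ≤ p` because `γ`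
  -- is positive.
  have hn0 : n = 0 := by
    have h1 : p {x | f x < 0} = 0 := by
      rw [hp, withDensity_apply _ hA]
      refine (setLIntegral_congr_fun hA (g := 0) fun x hx => ?_).trans (by simp)
      exact ENNReal.ofReal_of_nonpos (le_of_lt hx)
    have h2 : n {x | f x < 0} = 0 := by
      refine le_antisymm ?_ zero_le
      rw [← h1, ← hnp, Measure.add_apply]
      exact le_add_self
    have h3 : n {x | f x < 0}ᶜ = 0 := by
      rw [hn, withDensity_apply _ hA.compl]
      refine (setLIntegral_congr_fun hA.compl (g := 0) fun x hx => ?_).trans (by simp)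
      have : ¬ f x < 0 := hx
      exact ENNReal.ofReal_of_nonpos (by linarith)
    rw [← Measure.measure_univ_eq_zero, ← Set.union_compl_self {x | f x < 0}]
    exact measure_union_null h2 h3
  refine ⟨fun x => max (f x) 0, hfm.max measurable_const, fun x => le_max_right _ _, hf2.pos_part, ?_⟩
  rw [← add_zero γ, ← hn0, hnp, hp]
  congr 1; ext x
  rcases le_total 0 (f x) with hx | hx <;> simp only
  · rw [max_eq_left hx]
  · rw [max_eq_right hx, ENNReal.ofReal_of_nonpos hx, ENNReal.ofReal_zero]

lemma mc_eq_fc {γ : Measure Torus} {f : Torus → ℝ} (hfm : Measurable f) (hf0 : ∀ x, 0 ≤ f x)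
    (hγ : γ = volume.withDensity fun x => ENNReal.ofReal (f x)) :
    mc γ = fc fun x => (f x : ℂ) := by
  ext k
  rw [mc, fc, hγ, integral_withDensity_eq_integral_toReal_smul (by fun_prop) (by simp)]
  refine integral_congr_ae (Filter.Eventually.of_forall fun x => ?_)
  simp only [ENNReal.toReal_ofReal (hf0 x), Complex.real_smul]
  ring

lemma mc_zero (γ : Measure Torus) [IsProbabilityMeasure γ] : mc γ 0 = 1 := by
  simp [mc, UnitAddTorus.mFourier_zero]

lemma mc_neg (γ : Measure Torus) (k : Freq) : mc γ (-k) = conj (mc γ k) := by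
  rw [mc, mc, ← integral_conj]
  refine integral_congr_ae (Filter.Eventually.of_forall fun x => ?_)
  simp only [UnitAddTorus.mFourier_neg, neg_neg, Complex.conj_conj]

/-- For a density `f` of integral one, `∫ (f - 1)² = ∫ f² - 1`, and Parseval identifies `∫ f²`.
Without a density the right-hand side is infinite. -/
lemma nsq_mc_le (γ : ProbabilityMeasure Torus) : nsq (mc γ) ≤ 1 + sqDistToOne γ := by
  by_cases hγ : (γ : Measure Torus) ≪ volume
  swap
  · rw [sqDistToOne, if_neg hγ]; simp
  set f : Torus → ℝ := fun x => ((γ : Measure Torus).rnDeriv volume x).toReal with hf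
  have hfm : Measurable f := (Measure.measurable_rnDeriv _ _).ennreal_toReal
  have e1 : (γ : Measure Torus) = volume.withDensity fun x => ENNReal.ofReal (f x) := by
    nth_rw 1 [← Measure.withDensity_rnDeriv_eq _ _ hγ]
    refine withDensity_congr_ae ?_
    filter_upwards [Measure.rnDeriv_lt_top (γ : Measure Torus) volume] with x hx
    rw [hf, ENNReal.ofReal_toReal hx.ne]
  have hs : sqDistToOne γ = ∫⁻ x : Torus, ENNReal.ofReal ((f x - 1) ^ 2) := by
    rw [sqDistToOne, if_pos hγ]
  rcases eq_or_ne (sqDistToOne γ) ⊤ with ht | ht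
  · rw [ht]; simp
  have hm1 : MemLp (fun x => f x - 1) 2 volume := by
    rw [memLp_two_iff_integrable_sq (hfm.sub_const 1).aestronglyMeasurable]
    refine ⟨((hfm.sub_const 1).pow_const 2).aestronglyMeasurable, ?_⟩
    rw [hasFiniteIntegral_iff_ofReal (Filter.Eventually.of_forall fun x => sq_nonneg _), ← hs]
    exact lt_top_iff_ne_top.2 ht
  have hm : MemLp f 2 volume := by
    have := hm1.add (memLp_const (1 : ℝ))
    refine this.ae_eq (Filter.Eventually.of_forall fun x => ?_)
    simp
  have hf1 : ∫ x, f x = 1 := by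
    rw [hf, Measure.integral_toReal_rnDeriv hγ]; simp
  have hi : Integrable f := hm.integrable one_le_two
  have hmc : MemLp (fun x => (f x : ℂ)) 2 volume := hm.ofReal
  rw [mc_eq_fc hfm (fun x => ENNReal.toReal_nonneg) e1, nsq_fc hmc, hs,
    ← ofReal_integral_eq_lintegral_ofReal hm1.integrable_sq
      (Filter.Eventually.of_forall fun x => sq_nonneg _)]
  have h4 : ∀ x, ‖(f x : ℂ)‖ₑ ^ 2 = ENNReal.ofReal (f x ^ 2) := fun x => by
    rw [← ofReal_norm, Complex.norm_real, ← ENNReal.ofReal_pow (norm_nonneg _), Real.norm_eq_abs,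
      sq_abs]
  simp only [h4]
  rw [← ofReal_integral_eq_lintegral_ofReal hm.integrable_sq
      (Filter.Eventually.of_forall fun x => sq_nonneg _), ← ENNReal.ofReal_one,
    ← ENNReal.ofReal_add zero_le_one (integral_nonneg fun x => sq_nonneg _)]
  refine ENNReal.ofReal_le_ofReal (le_of_eq ?_)
  have e2 : ∫ x, (f x - 1) ^ 2 = ∫ x, (f x ^ 2 - (2 * f x - 1)) := by
    congr 1; ext x; ring
  have e3 : ∫ x, (2 * f x - 1) = 1 := by
    rw [integral_sub (hi.const_mul 2) (integrable_const 1), integral_const_mul, hf1]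
    simp; norm_num
  rw [e2, integral_sub (f := fun x => f x ^ 2) (g := fun x => 2 * f x - 1) hm.integrable_sq
    ((hi.const_mul 2).sub (integrable_const 1)), e3]
  ring

/-! ### Trigonometric series on the circle -/

/-- The trigonometric series with coefficients `c`. -/
def fs (c : ℤ → ℂ) (a : UnitAddCircle) : ℂ := ∑' n, c n * fourier n a

lemma norm_fourier_le (n : ℤ) (a : UnitAddCircle) : ‖(fourier n a : ℂ)‖ ≤ 1 := by
  rw [fourier_apply, Circle.norm_coe]

lemma norm_mul_fourier_le (c : ℤ → ℂ) (n : ℤ) (a : UnitAddCircle) :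
    ‖c n * fourier n a‖ ≤ ‖c n‖ := by
  rw [norm_mul]; exact mul_le_of_le_one_right (norm_nonneg _) (norm_fourier_le n a)

lemma summable_fs {c : ℤ → ℂ} (hc : Summable fun n => ‖c n‖) (a : UnitAddCircle) :
    Summable (fun n => c n * fourier n a) :=
  Summable.of_norm_bounded hc fun n => norm_mul_fourier_le c n a

lemma continuous_fs {c : ℤ → ℂ} (hc : Summable fun n => ‖c n‖) : Continuous (fs c) :=
  continuous_tsum (fun n => by fun_prop) hc fun n a => norm_mul_fourier_le c n a

lemma norm_fs_le {c : ℤ → ℂ} (hc : Summable fun n => ‖c n‖) (a : UnitAddCircle) :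
    ‖fs c a‖ ≤ ∑' n, ‖c n‖ :=
  tsum_of_norm_bounded hc.hasSum fun n => norm_mul_fourier_le c n a

lemma integral_fourier (m : ℤ) :
    ∫ a : UnitAddCircle, (fourier m a : ℂ) = if m = 0 then (1 : ℂ) else 0 := by
  split_ifs with hm
  · subst hm; simp [measureReal_def]
  · exact integral_eq_zero_of_add_right_eq_neg (fourier_add_half_inv_index hm one_pos)

lemma hasSum_integral_fs_mul {c : ℤ → ℂ} (hc : Summable fun n => ‖c n‖) {g : UnitAddCircle → ℂ}
    (hg : Continuous g) :
    HasSum (fun n => c n * ∫ a, fourier n a * g a) (∫ a, fs c a * g a) := by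
  have hgi : ∀ f : UnitAddCircle → ℂ, Continuous f → Integrable f := fun f hf =>
    hf.integrable_of_hasCompactSupport (HasCompactSupport.of_compactSpace _)
  have h := hasSum_integral_of_dominated_convergence (μ := (volume : Measure UnitAddCircle))
    (F := fun n a => c n * (fourier n a * g a)) (f := fun a => fs c a * g a)
    (fun n a => ‖c n‖ * ‖g a‖) (fun n => by
      refine Continuous.aestronglyMeasurable ?_
      fun_prop)
    (fun n => Filter.Eventually.of_forall fun a => by
      rw [← mul_assoc, norm_mul]
      exact mul_le_mul_of_nonneg_right (norm_mul_fourier_le c n a) (norm_nonneg _))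
    (Filter.Eventually.of_forall fun a => hc.mul_right _)
    (by simp_rw [tsum_mul_right]; exact (hgi g hg).norm.const_mul _)
    (Filter.Eventually.of_forall fun a => by
      refine ((summable_fs hc a).hasSum.mul_right (g a)).congr_fun fun n => ?_
      exact (mul_assoc _ _ _).symm)
  simpa only [integral_const_mul] using h

lemma integral_fs_mul_fourier {c : ℤ → ℂ} (hc : Summable fun n => ‖c n‖) (m : ℤ) :
    ∫ a, fs c a * fourier (-m) a = c m := by
  have h := hasSum_integral_fs_mul hc (g := fun a => fourier (-m) a) (by fun_prop)
  simp_rw [← fourier_add, integral_fourier] at h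
  refine h.unique ?_
  convert! hasSum_ite_eq m (c m) using 2 with n
  by_cases hn : n = m
  · simp [hn]
  · rw [if_neg hn, if_neg (fun h => hn (by omega)), mul_zero]

lemma integral_normSq_fs {c : ℤ → ℂ} (hc : Summable fun n => ‖c n‖) :
    HasSum (fun n => ‖c n‖ ^ 2) (∫ a, ‖fs c a‖ ^ 2) := by
  have hcc := continuous_fs hc
  have h := hasSum_integral_fs_mul hc (g := fun a => conj (fs c a)) (by fun_prop)
  have e : ∀ n, ∫ a, fourier n a * conj (fs c a) = conj (c n) := by
    intro n
    rw [← integral_fs_mul_fourier hc n, ← integral_conj]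
    refine integral_congr_ae (Filter.Eventually.of_forall fun a => ?_)
    simp only [map_mul, fourier_neg, Complex.conj_conj]
    ring
  simp_rw [e, Complex.mul_conj, Complex.normSq_eq_norm_sq] at h
  rw [integral_complex_ofReal] at h
  exact_mod_cast h

lemma hasDerivAt_fs {c : ℤ → ℂ} (hc : Summable fun n => ‖c n‖)
    (hc' : Summable fun n : ℤ => ‖c n * (2 * Real.pi * Complex.I * n)‖) (a : UnitAddCircle) (s : ℝ) :
    HasDerivAt (fun h : ℝ => fs c (a + (h : UnitAddCircle)))
      (fs (fun n => c n * (2 * Real.pi * Complex.I * n)) (a + (s : UnitAddCircle))) s := by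
  obtain ⟨y, rfl⟩ : ∃ y : ℝ, (y : UnitAddCircle) = a := QuotientAddGroup.mk_surjective a
  unfold fs
  refine hasDerivAt_tsum (g := fun n (h : ℝ) => c n * fourier n ((y : UnitAddCircle) + (h : UnitAddCircle)))
    (g' := fun n (h : ℝ) => c n * (2 * Real.pi * Complex.I * n) *
      fourier n ((y : UnitAddCircle) + (h : UnitAddCircle))) (y₀ := s) hc' (fun n h => ?_) (fun n h => ?_)
    (summable_fs hc ((y : UnitAddCircle) + (s : UnitAddCircle))) s
  · have h1 := ((hasDerivAt_fourier 1 n (y + h)).comp_const_add y h).const_mul (c n)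
    simp only [AddCircle.coe_add] at h1
    refine h1.congr_deriv ?_
    rw [Complex.ofReal_one, div_one]; ring
  · exact norm_mul_fourier_le (fun n => c n * (2 * Real.pi * Complex.I * n)) n _

/-! ### The heat kernel of the circle -/

/-- The Fourier coefficients of the heat kernel of the circle. -/
def hw (t : ℝ) (n : ℤ) : ℝ := Real.exp (-(4 * Real.pi ^ 2 * (n : ℝ) ^ 2) * t)

/-- The Fourier coefficients of the derivative of the heat kernel of the circle. -/
def hwd (t : ℝ) (n : ℤ) : ℂ := (hw t n : ℂ) * (2 * Real.pi * Complex.I * n)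

/-- The heat kernel of the circle. -/
def th (t : ℝ) (a : UnitAddCircle) : ℝ := (fs (fun n => (hw t n : ℂ)) a).re

/-- The derivative of the heat kernel of the circle. -/
def thd (t : ℝ) (a : UnitAddCircle) : ℝ := (fs (hwd t) a).re

lemma hw_pos (t : ℝ) (n : ℤ) : 0 < hw t n := Real.exp_pos _

lemma norm_hw (t : ℝ) (n : ℤ) : ‖(hw t n : ℂ)‖ = hw t n := by
  rw [Complex.norm_real, Real.norm_of_nonneg (hw_pos t n).le]

lemma summable_norm_hw {t : ℝ} (ht : 0 < t) : Summable (fun n => ‖(hw t n : ℂ)‖) := by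
  simp only [norm_hw]
  exact summable_weight ht

lemma ofReal_th {t : ℝ} (ht : 0 < t) (a : UnitAddCircle) :
    (th t a : ℂ) = fs (fun n => (hw t n : ℂ)) a ∧
      th t a = HurwitzZeta.cosKernel a (4 * Real.pi * t) := by
  have h : fs (fun n => (hw t n : ℂ)) a = ((HurwitzZeta.cosKernel a (4 * Real.pi * t) : ℝ) : ℂ) :=
    (hasSum_circle a ht).tsum_eq
  rw [th, h, Complex.ofReal_re]
  exact ⟨rfl, rfl⟩

lemma th_nonneg {t : ℝ} (ht : 0 < t) (a : UnitAddCircle) : 0 ≤ th t a := by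
  have := Real.pi_pos
  rw [(ofReal_th ht a).2]; exact cosKernel_nonneg a (by positivity)

lemma norm_hwd (t : ℝ) (n : ℤ) : ‖hwd t n‖ = 2 * Real.pi * |(n : ℝ)| * hw t n := by
  rw [hwd, norm_mul, norm_hw]
  simp [abs_of_pos Real.pi_pos]
  ring

/-- From `exp y ≥ y² / 2`. After the factor `n` of the derivative the terms still decay like
`|n|⁻³`. The rate `t⁻²` is integrable at infinity, and near zero it is compensated by
`exists_th_le`. -/
lemma hw_le_sq {t : ℝ} (ht : 0 < t) {n : ℤ} (hn : n ≠ 0) :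
    hw t n ≤ 2 * ((t ^ 2)⁻¹ * (1 / |(n : ℝ)|) ^ 4) := by
  have hn1 : (1 : ℝ) ≤ |(n : ℝ)| := by
    have : (1 : ℤ) ≤ |n| := Int.one_le_abs hn
    exact_mod_cast this
  have h2 : |(n : ℝ)| ^ 2 = (n : ℝ) ^ 2 := sq_abs _
  set y := 4 * Real.pi ^ 2 * (n : ℝ) ^ 2 * t with hy
  have hy0 : 0 ≤ y := by positivity
  have h1 : y ^ 2 / 2 ≤ Real.exp y := by
    have := Real.quadratic_le_exp_of_nonneg hy0
    nlinarith
  have hyn : |(n : ℝ)| ^ 2 * t ≤ y := by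
    rw [hy, h2]
    have : (1 : ℝ) ≤ 4 * Real.pi ^ 2 := by nlinarith [Real.pi_gt_three]
    nlinarith [mul_nonneg (sq_nonneg (n : ℝ)) ht.le]
  have h3 : (|(n : ℝ)| ^ 2 * t) ^ 2 ≤ 2 * Real.exp y := by
    have : (|(n : ℝ)| ^ 2 * t) ^ 2 ≤ y ^ 2 := by gcongr
    linarith
  rw [hw, neg_mul, ← hy, Real.exp_neg]
  have h4 : 2 * ((t ^ 2)⁻¹ * (1 / |(n : ℝ)|) ^ 4) = 2 / (|(n : ℝ)| ^ 2 * t) ^ 2 := by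
    have : |(n : ℝ)| ≠ 0 := by linarith
    field_simp
  rw [h4, inv_eq_one_div, div_le_div_iff₀ (Real.exp_pos _) (by positivity)]
  linarith

/-- Any exponent `α` strictly between `3/2` and `2` would serve in place of `7/4`: `n² n^(-2α)` must
be summable over the modes and `t^(-α/2)` integrable near zero. -/
lemma hw_le_rpow {t : ℝ} (ht : 0 < t) {n : ℤ} (hn : n ≠ 0) :
    hw t n ^ 2 ≤ 2 * (t ^ (-(7 / 4) : ℝ) * |(n : ℝ)| ^ (-(7 / 2) : ℝ)) := by
  have hn1 : (1 : ℝ) ≤ |(n : ℝ)| := by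
    have : (1 : ℤ) ≤ |n| := Int.one_le_abs hn
    exact_mod_cast this
  have hn0 : 0 < |(n : ℝ)| := by linarith
  set z := |(n : ℝ)| ^ (2 : ℝ) * t with hz
  have hz0 : 0 < z := by positivity
  have hz74 : z ^ (7 / 4 : ℝ) ≤ 1 + z ^ 2 := by
    rcases le_total z 1 with h | h
    · have := Real.rpow_le_one hz0.le h (z := 7 / 4) (by norm_num)
      nlinarith [sq_nonneg z]
    · have h1 := Real.rpow_le_rpow_of_exponent_le h (show (7 / 4 : ℝ) ≤ 2 by norm_num)
      rw [Real.rpow_two] at h1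
      linarith
  have hexp : 1 + z ^ 2 ≤ 2 * Real.exp z := by
    have := Real.quadratic_le_exp_of_nonneg hz0.le
    nlinarith
  have h1 : hw t n ^ 2 ≤ Real.exp (-z) := by
    rw [hw, ← Real.exp_nat_mul]
    refine Real.exp_le_exp.2 ?_
    rw [hz, Real.rpow_two, sq_abs]
    have : (1 : ℝ) ≤ 2 * (4 * Real.pi ^ 2) := by nlinarith [Real.pi_gt_three]
    push_cast
    nlinarith [mul_nonneg (sq_nonneg (n : ℝ)) ht.le]
  have h2 : t ^ (-(7 / 4) : ℝ) * |(n : ℝ)| ^ (-(7 / 2) : ℝ) = (z ^ (7 / 4 : ℝ))⁻¹ := by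
    rw [hz, ← Real.rpow_neg (by positivity), Real.mul_rpow (by positivity) ht.le,
      ← Real.rpow_mul (by positivity), mul_comm]
    norm_num
  rw [h2]
  refine h1.trans ?_
  rw [Real.exp_neg, inv_eq_one_div, ← div_eq_mul_inv,
    div_le_div_iff₀ (Real.exp_pos _) (by positivity)]
  linarith

/-- The constant in the bounds of `thd`. -/
def Cd : ℝ := ∑' n : ℤ, 2 * Real.pi * |(n : ℝ)| * (2 * (1 / |(n : ℝ)|) ^ 4)

lemma summable_Cd : Summable fun n : ℤ => 2 * Real.pi * |(n : ℝ)| * (2 * (1 / |(n : ℝ)|) ^ 4) := by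
  have h : Summable fun n : ℤ => 1 / |(n : ℝ)| ^ 2 := by
    simpa using Real.summable_one_div_int_pow.2 (show 1 < 2 by norm_num)
  refine Summable.of_nonneg_of_le (fun n => by have := Real.pi_pos; positivity) (fun n => ?_)
    (h.mul_left (4 * Real.pi))
  rcases eq_or_ne n 0 with rfl | hn
  · simp
  have hn1 : (1 : ℝ) ≤ |(n : ℝ)| := by
    have : (1 : ℤ) ≤ |n| := Int.one_le_abs hn
    exact_mod_cast this
  rw [show 2 * Real.pi * |(n : ℝ)| * (2 * (1 / |(n : ℝ)|) ^ 4) =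
    4 * Real.pi * (1 / |(n : ℝ)| ^ 3) by field_simp; ring]
  have := Real.pi_pos
  gcongr
  · norm_num

lemma Cd_nonneg : 0 ≤ Cd := tsum_nonneg fun _ => by have := Real.pi_pos; positivity

lemma norm_hwd_le {t : ℝ} (ht : 0 < t) (n : ℤ) :
    ‖hwd t n‖ ≤ (t ^ 2)⁻¹ * (2 * Real.pi * |(n : ℝ)| * (2 * (1 / |(n : ℝ)|) ^ 4)) := by
  rw [norm_hwd]
  rcases eq_or_ne n 0 with rfl | hn
  · simp
  have := Real.pi_pos
  calc _ ≤ 2 * Real.pi * |(n : ℝ)| * (2 * ((t ^ 2)⁻¹ * (1 / |(n : ℝ)|) ^ 4)) := by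
        gcongr; exact hw_le_sq ht hn
    _ = _ := by ring

lemma summable_norm_hwd {t : ℝ} (ht : 0 < t) : Summable fun n => ‖hwd t n‖ :=
  Summable.of_nonneg_of_le (fun _ => norm_nonneg _) (norm_hwd_le ht) (summable_Cd.mul_left _)

lemma norm_fs_hwd_le {t : ℝ} (ht : 0 < t) (a : UnitAddCircle) :
    ‖fs (hwd t) a‖ ≤ Cd * (t ^ 2)⁻¹ := by
  refine (norm_fs_le (summable_norm_hwd ht) a).trans ?_
  rw [mul_comm, Cd, ← tsum_mul_left]
  exact (summable_norm_hwd ht).tsum_le_tsum (norm_hwd_le ht) (summable_Cd.mul_left _)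

/-- The second assertion says that the differentiated series is real: the complex series is the
coercion of the real function `th`, so its derivative is the coercion of a real derivative. -/
lemma hasDerivAt_th {t : ℝ} (ht : 0 < t) (a : UnitAddCircle) (s : ℝ) :
    HasDerivAt (fun h : ℝ => th t (a + (h : UnitAddCircle))) (thd t (a + (s : UnitAddCircle))) s ∧
      (thd t (a + (s : UnitAddCircle)) : ℂ) = fs (hwd t) (a + (s : UnitAddCircle)) := by
  have h := hasDerivAt_fs (summable_norm_hw ht) (summable_norm_hwd ht) a s
  have h1 : HasDerivAt (fun h : ℝ => th t (a + (h : UnitAddCircle)))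
      (thd t (a + (s : UnitAddCircle))) s := by
    have := Complex.reCLM.hasFDerivAt.comp_hasDerivAt s h
    exact this
  refine ⟨h1, ?_⟩
  have h2 := h1.ofReal_comp
  have e : (fun h : ℝ => fs (fun n => (hw t n : ℂ)) (a + (h : UnitAddCircle))) =
      fun h : ℝ => (th t (a + (h : UnitAddCircle)) : ℂ) := by
    ext h; rw [(ofReal_th ht _).1]
  rw [e] at h
  exact h2.unique h

lemma ofReal_thd {t : ℝ} (ht : 0 < t) (a : UnitAddCircle) : (thd t a : ℂ) = fs (hwd t) a := by
  simpa using (hasDerivAt_th ht a 0).2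

lemma abs_thd_le {t : ℝ} (ht : 0 < t) (a : UnitAddCircle) : |thd t a| ≤ Cd * (t ^ 2)⁻¹ :=
  (Complex.abs_re_le_norm _).trans (norm_fs_hwd_le ht a)

lemma continuous_th {t : ℝ} (ht : 0 < t) : Continuous (th t) :=
  Complex.continuous_re.comp (continuous_fs (summable_norm_hw ht))

lemma continuous_thd {t : ℝ} (ht : 0 < t) : Continuous (thd t) :=
  Complex.continuous_re.comp (continuous_fs (summable_norm_hwd ht))

lemma measurable_th : Measurable fun p : ℝ × UnitAddCircle => th p.1 p.2 := by
  unfold th fs hw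
  refine Complex.measurable_re.comp (Measurable.tsum fun n => ?_)
  fun_prop

lemma measurable_thd : Measurable fun p : ℝ × UnitAddCircle => thd p.1 p.2 := by
  unfold thd fs hwd hw
  refine Complex.measurable_re.comp (Measurable.tsum fun n => ?_)
  fun_prop

/-- The constant in the `L²` bound of `thd`. -/
def Cq : ℝ := ∑' n : ℤ, 8 * Real.pi ^ 2 * |(n : ℝ)| ^ (-(3 / 2) : ℝ)

lemma summable_Cq : Summable fun n : ℤ => 8 * Real.pi ^ 2 * |(n : ℝ)| ^ (-(3 / 2) : ℝ) :=
  (Real.summable_abs_int_rpow (by norm_num)).mul_left _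

lemma integral_sq_thd_le {t : ℝ} (ht : 0 < t) :
    ∫ a, ‖fs (hwd t) a‖ ^ 2 ≤ Cq * t ^ (-(7 / 4) : ℝ) := by
  have h := integral_normSq_fs (summable_norm_hwd ht)
  rw [← h.tsum_eq, mul_comm, Cq, ← tsum_mul_left]
  refine h.summable.tsum_le_tsum (fun n => ?_) (summable_Cq.mul_left _)
  rw [norm_hwd]
  rcases eq_or_ne n 0 with rfl | hn
  · simp
  have hn0 : 0 < |(n : ℝ)| := by positivity
  calc (2 * Real.pi * |(n : ℝ)| * hw t n) ^ 2
      = 4 * Real.pi ^ 2 * |(n : ℝ)| ^ (2 : ℝ) * hw t n ^ 2 := by rw [Real.rpow_two]; ring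
    _ ≤ 4 * Real.pi ^ 2 * |(n : ℝ)| ^ (2 : ℝ) *
        (2 * (t ^ (-(7 / 4) : ℝ) * |(n : ℝ)| ^ (-(7 / 2) : ℝ))) := by
        gcongr; exact hw_le_rpow ht hn
    _ = t ^ (-(7 / 4) : ℝ) * (8 * Real.pi ^ 2 *
        (|(n : ℝ)| ^ (2 : ℝ) * |(n : ℝ)| ^ (-(7 / 2) : ℝ))) := by ring
    _ = _ := by rw [← Real.rpow_add hn0]; norm_num

/-- Apply `z ≤ s + z² / s` pointwise with `s = t^(-7/8)`, the square root of the power in the `L²`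
bound, and integrate over a space of mass one. The power `-7/8 > -1` makes the result integrable
near time zero. -/
lemma integral_abs_thd_le {t : ℝ} (ht : 0 < t) :
    ∫ a, |thd t a| ≤ (1 + Cq) * t ^ (-(7 / 8) : ℝ) := by
  have hgi : ∀ f : UnitAddCircle → ℝ, Continuous f → Integrable f := fun f hf =>
    hf.integrable_of_hasCompactSupport (HasCompactSupport.of_compactSpace _)
  have hc := continuous_fs (summable_norm_hwd ht)
  have hcd := continuous_thd ht
  set s := t ^ (-(7 / 8) : ℝ) with hs
  have hs0 : 0 < s := by positivity
  have hs2 : t ^ (-(7 / 4) : ℝ) = s * s := by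
    rw [hs, ← Real.rpow_add ht]; norm_num
  calc ∫ a, |thd t a| ≤ ∫ a, (s + ‖fs (hwd t) a‖ ^ 2 / s) := by
        refine integral_mono (hgi _ (by fun_prop)) (hgi _ (by fun_prop)) fun a => ?_
        refine (Complex.abs_re_le_norm _).trans ?_
        rw [← sub_nonneg]
        have : s + ‖fs (hwd t) a‖ ^ 2 / s - ‖fs (hwd t) a‖ =
          (s ^ 2 + ‖fs (hwd t) a‖ ^ 2 - s * ‖fs (hwd t) a‖) / s := by field_simp
        rw [this]
        refine div_nonneg ?_ hs0.le
        nlinarith [sq_nonneg (s - ‖fs (hwd t) a‖), norm_nonneg (fs (hwd t) a)]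
    _ = s + (∫ a, ‖fs (hwd t) a‖ ^ 2) / s := by
        rw [integral_add (hgi _ (by fun_prop)) (hgi _ (by fun_prop)), integral_div]
        simp [measureReal_def]
    _ ≤ s + Cq * (s * s) / s := by
        gcongr; rw [← hs2]; exact integral_sq_thd_le ht
    _ = _ := by field_simp

lemma integral_th {t : ℝ} (ht : 0 < t) : ∫ a, th t a = 1 := by
  have h := integral_fs_mul_fourier (summable_norm_hw ht) 0
  simp only [neg_zero, fourier_zero, mul_one, ← (ofReal_th ht _).1] at h
  rw [integral_complex_ofReal] at h
  have h2 : ((∫ a, th t a : ℝ) : ℂ) = ((1 : ℝ) : ℂ) := by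
    rw [h]; simp [hw]
  exact_mod_cast h2

/-- Off the origin the heat kernel of the circle vanishes rapidly for small times. -/
lemma exists_th_le {b : UnitAddCircle} (hb : b ≠ 0) :
    ∃ C δ : ℝ, 0 < δ ∧ 0 ≤ C ∧ ∀ t, 0 < t → t ≤ δ → th t b ≤ C * t ^ 2 := by
  obtain ⟨p, hp, h⟩ := HurwitzZeta.isBigO_atTop_evenKernel_sub b
  simp only [hb, if_false, sub_zero] at h
  -- The functional equation turns small times `s` into large arguments `1 / s`, where `evenKernel`
  -- decays exponentially off the origin. The power `-5/2` is chosen so that, with the prefactor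
  -- `s^(-1/2)`, exactly `s²` remains.
  have h1 := h.trans (isLittleO_exp_neg_mul_rpow_atTop hp (-(5 / 2))).isBigO
  obtain ⟨C, hC⟩ := h1.bound
  obtain ⟨Y, hY⟩ := Filter.eventually_atTop.1 hC
  have hpi := Real.pi_pos
  set Y' := max Y 1
  have hY' : 0 < Y' := lt_of_lt_of_le one_pos (le_max_right _ _)
  refine ⟨|C| * (4 * Real.pi) ^ 2, 1 / (4 * Real.pi * Y'), by positivity, by positivity,
    fun t ht htd => ?_⟩
  have hs : 0 < 4 * Real.pi * t := by positivity
  have hy : Y ≤ 1 / (4 * Real.pi * t) := by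
    refine (le_max_left Y 1).trans ?_
    rw [le_div_iff₀ hs]
    rw [le_div_iff₀ (by positivity)] at htd
    linarith
  have hb := hY _ hy
  rw [Real.norm_of_nonneg (Real.rpow_nonneg (one_div_nonneg.2 hs.le) _)] at hb
  have hk := HurwitzZeta.evenKernel_functional_equation b (1 / (4 * Real.pi * t))
  rw [one_div_one_div] at hk
  set s := 4 * Real.pi * t
  have hcos : HurwitzZeta.cosKernel b s = s ^ (-(1 / 2) : ℝ) * HurwitzZeta.evenKernel b (1 / s) := by
    rw [hk, ← mul_assoc, Real.rpow_neg hs.le, one_div s, Real.inv_rpow hs.le, one_div _⁻¹, inv_inv,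
      inv_mul_cancel₀ (by positivity), one_mul]
  rw [(ofReal_th ht b).2, hcos]
  calc s ^ (-(1 / 2) : ℝ) * HurwitzZeta.evenKernel b (1 / s)
      ≤ s ^ (-(1 / 2) : ℝ) * (|C| * (1 / s) ^ (-(5 / 2) : ℝ)) := by
        gcongr
        refine (le_abs_self _).trans (hb.trans ?_)
        gcongr; exact le_abs_self C
    _ = |C| * (s ^ (-(1 / 2) : ℝ) * s ^ (5 / 2 : ℝ)) := by
        rw [one_div s, Real.inv_rpow hs.le, Real.rpow_neg hs.le (5 / 2), inv_inv]; ring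
    _ = |C| * (4 * Real.pi) ^ 2 * t ^ 2 := by
        rw [← Real.rpow_add hs]; norm_num; ring

lemma th_le_of_le {δ t : ℝ} (hδ : 0 < δ) (ht : δ ≤ t) (b : UnitAddCircle) :
    th t b ≤ ∑' n, hw δ n := by
  have ht0 : 0 < t := hδ.trans_le ht
  refine (Complex.re_le_norm _).trans ((norm_fs_le (summable_norm_hw ht0) b).trans ?_)
  simp only [norm_hw]
  refine (summable_weight ht0).tsum_le_tsum (fun n => ?_) (summable_weight hδ)
  refine Real.exp_le_exp.2 ?_
  have : 0 ≤ 4 * Real.pi ^ 2 * (n : ℝ) ^ 2 := by positivity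
  nlinarith

/-! ### The gradient of Green's function -/

lemma rev_ne (i : Fin 2) : i.rev ≠ i := by fin_cases i <;> decide

lemma prod_fin_two_rev {M : Type*} [CommMonoid M] (f : Fin 2 → M) (i : Fin 2) :
    ∏ j, f j = f i * f i.rev := by
  fin_cases i
  · simp [Fin.prod_univ_two, Fin.rev]
  · simp [Fin.prod_univ_two, Fin.rev, mul_comm]

lemma heatKernel_eq_th {t : ℝ} (ht : 0 < t) (i : Fin 2) (x : Torus) :
    heatKernel t x = th t (x i) * th t (x i.rev) := by
  rw [(hasSum_heatKernel ht x).2.1, (ofReal_th ht _).2, (ofReal_th ht _).2]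
  have := prod_fin_two_rev (fun j => HurwitzZeta.cosKernel (x j) (4 * Real.pi * t)) i
  rw [← this, Fin.prod_univ_two]

/-- The integral formula for the `i`-th partial derivative of Green's function. -/
def gk (i : Fin 2) (x : Torus) : ℝ :=
  ∫ t in Set.Ioi (0 : ℝ), thd t (x i) * th t (x i.rev)

/-- A bound for the derivative of the heat kernel off a coordinate axis. -/
lemma exists_bound_thd_mul_th {b : UnitAddCircle} (hb : b ≠ 0) :
    ∃ B : ℝ → ℝ, IntegrableOn B (Set.Ioi 0) ∧
      ∀ t, 0 < t → ∀ a, ‖thd t a * th t b‖ ≤ B t := by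
  obtain ⟨C, δ, hδ, hC, h⟩ := exists_th_le hb
  have hK : 0 ≤ ∑' n, hw δ n := tsum_nonneg fun n => (hw_pos δ n).le
  -- For small times the `t²` decay of `th` at `b ≠ 0` cancels the `t⁻²` growth of `thd`; for large
  -- times `th` is bounded and `t⁻²` is integrable.
  refine ⟨fun t => if t ≤ δ then Cd * C else Cd * (∑' n, hw δ n) * t ^ (-2 : ℝ), ?_,
    fun t ht a => ?_⟩
  · rw [← Set.Ioc_union_Ioi_eq_Ioi hδ.le]
    refine IntegrableOn.union ?_ ?_
    · refine IntegrableOn.congr_fun (f := fun _ => Cd * C) (integrable_const _) (fun t ht => ?_) measurableSet_Ioc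
      exact (if_pos ht.2).symm
    · refine IntegrableOn.congr_fun ((integrableOn_Ioi_rpow_of_lt (show (-2 : ℝ) < -1 by norm_num) hδ).const_mul
        (Cd * (∑' n, hw δ n))) (fun t ht => ?_) measurableSet_Ioi
      exact (if_neg (not_le.2 (Set.mem_Ioi.1 ht))).symm
  · simp only
    rw [norm_mul, Real.norm_eq_abs, Real.norm_of_nonneg (th_nonneg ht b)]
    have h1 := abs_thd_le ht a
    have hCd := Cd_nonneg
    split_ifs with htd
    · calc _ ≤ Cd * (t ^ 2)⁻¹ * (C * t ^ 2) :=
            mul_le_mul h1 (h t ht htd) (th_nonneg ht b) (by positivity)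
        _ = Cd * C := by field_simp
    · calc _ ≤ Cd * (t ^ 2)⁻¹ * ∑' n, hw δ n :=
            mul_le_mul h1 (th_le_of_le hδ (not_le.1 htd).le b) (th_nonneg ht b) (by positivity)
        _ = _ := by
          rw [Real.rpow_neg ht.le, Real.rpow_two]; ring

lemma measurable_thd_mul_th (i : Fin 2) :
    Measurable fun p : ℝ × Torus => thd p.1 (p.2 i) * th p.1 (p.2 i.rev) := by
  refine (measurable_thd.comp (f := fun p : ℝ × Torus => (p.1, p.2 i)) ?_).mul
    (measurable_th.comp (f := fun p : ℝ × Torus => (p.1, p.2 i.rev)) ?_) <;> fun_prop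

/-- Differentiation under the integral sign. A displacement along coordinate `i` does not change the
other coordinate, which is nonzero, so one dominating function serves for all displacements. -/
lemma pd_greenReal {i : Fin 2} {x : Torus} (hx : x i.rev ≠ 0) : pd i greenReal x = gk i x := by
  obtain ⟨B, hB, hle⟩ := exists_bound_thd_mul_th hx
  have hxi : ∀ h : ℝ, (x + Pi.single i (h : UnitAddCircle) : Torus) i = x i + (h : UnitAddCircle) :=
    fun h => by simp
  have hxr : ∀ h : ℝ, (x + Pi.single i (h : UnitAddCircle) : Torus) i.rev = x i.rev :=
    fun h => by simp [Pi.single_eq_of_ne (rev_ne i)]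
  have hFm : ∀ h : ℝ, AEStronglyMeasurable
      (fun t => heatKernel t (x + Pi.single i (h : UnitAddCircle)) - 1)
      (volume.restrict (Set.Ioi (0 : ℝ))) := fun h =>
    ((measurable_heatKernel.sub_const 1).comp measurable_prodMk_right).aestronglyMeasurable
  have hFi : Integrable (fun t => heatKernel t (x + Pi.single i ((0 : ℝ) : UnitAddCircle)) - 1)
      (volume.restrict (Set.Ioi (0 : ℝ))) := by
    refine integrableOn_heatKernel fun h0 => hx ?_
    rw [← hxr 0, h0]; rfl
  have hFm' : AEStronglyMeasurable
      (fun t => thd t (x i + ((0 : ℝ) : UnitAddCircle)) * th t (x i.rev))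
      (volume.restrict (Set.Ioi (0 : ℝ))) :=
    ((measurable_thd.comp measurable_prodMk_right).mul
      (measurable_th.comp measurable_prodMk_right)).aestronglyMeasurable
  have hdiff : ∀ t : ℝ, 0 < t → ∀ h : ℝ, HasDerivAt
      (fun h : ℝ => heatKernel t (x + Pi.single i (h : UnitAddCircle)) - 1)
      (thd t (x i + (h : UnitAddCircle)) * th t (x i.rev)) h := by
    intro t ht h
    have h1 := ((hasDerivAt_th ht (x i) h).1.mul_const (th t (x i.rev))).sub_const 1
    have e : (fun h : ℝ => heatKernel t (x + Pi.single i (h : UnitAddCircle)) - 1) =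
        fun h : ℝ => th t (x i + (h : UnitAddCircle)) * th t (x i.rev) - 1 := by
      ext s
      rw [heatKernel_eq_th ht i, hxi, hxr]
    rw [e]
    exact h1
  set F : ℝ → ℝ → ℝ := fun h t => heatKernel t (x + Pi.single i (h : UnitAddCircle)) - 1 with hF
  set F' : ℝ → ℝ → ℝ := fun h t => thd t (x i + (h : UnitAddCircle)) * th t (x i.rev) with hF'
  have hb1 : ∀ᵐ t ∂volume.restrict (Set.Ioi (0 : ℝ)), ∀ h ∈ (Set.univ : Set ℝ), ‖F' h t‖ ≤ B t :=
    (ae_restrict_iff' measurableSet_Ioi).2 (Filter.Eventually.of_forall fun t ht h _ => hle t ht _)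
  have hb2 : ∀ᵐ t ∂volume.restrict (Set.Ioi (0 : ℝ)), ∀ h ∈ (Set.univ : Set ℝ),
      HasDerivAt (fun h => F h t) (F' h t) h :=
    (ae_restrict_iff' measurableSet_Ioi).2 (Filter.Eventually.of_forall fun t ht h _ => hdiff t ht h)
  have hd := (hasDerivAt_integral_of_dominated_loc_of_deriv_le (F := F) (F' := F') (x₀ := (0 : ℝ))
    Filter.univ_mem (Filter.Eventually.of_forall hFm) hFi hFm' hb1 hB hb2).2.deriv
  have e : (∫ t in Set.Ioi (0 : ℝ), F' 0 t) = gk i x := by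
    simp only [hF', AddCircle.coe_zero, add_zero, gk]
  rw [← e, ← hd]
  rfl

lemma ae_ne_zero : ∀ᵐ a : UnitAddCircle, a ≠ 0 := by
  rw [ae_iff]
  simp only [not_not]
  have h := (AddCircle.measurePreserving_mk (1 : ℝ) 0).measure_preimage
    (measurableSet_singleton (0 : UnitAddCircle)).nullMeasurableSet
  have h1 : {a : UnitAddCircle | a = 0} = {0} := rfl
  rw [h1, ← h]
  refine Set.Countable.measure_zero (Set.Countable.mono ?_ (Set.countable_range fun n : ℤ => (n : ℝ))) _
  intro y hy
  obtain ⟨n, hn⟩ := (AddCircle.coe_eq_zero_iff (1 : ℝ)).1 hy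
  exact ⟨n, by simpa using hn⟩

instance : IsProbabilityMeasure (volume : Measure UnitAddCircle) := ⟨by simp⟩

lemma ae_coord_ne_zero (j : Fin 2) : ∀ᵐ x : Torus, x j ≠ 0 :=
  (measurePreserving_eval (fun _ : Fin 2 => (volume : Measure UnitAddCircle))
    j).quasiMeasurePreserving.ae ae_ne_zero

lemma pd_greenReal_ae (i : Fin 2) : pd i greenReal =ᵐ[volume] gk i := by
  filter_upwards [ae_coord_ne_zero i.rev] with x hx using pd_greenReal hx

lemma integral_abs_thd_le_mul {t : ℝ} (ht : 0 < t) : ∫ a, |thd t a| ≤ Cd * (t ^ 2)⁻¹ := by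
  have hcd := continuous_thd ht
  have hgi : ∀ f : UnitAddCircle → ℝ, Continuous f → Integrable f := fun f hf =>
    hf.integrable_of_hasCompactSupport (HasCompactSupport.of_compactSpace _)
  calc ∫ a, |thd t a| ≤ ∫ _a : UnitAddCircle, Cd * (t ^ 2)⁻¹ :=
        integral_mono (hgi _ (by fun_prop)) (integrable_const _) fun a => abs_thd_le ht a
    _ = _ := by simp [measureReal_def]

/-- Integrals of products over the torus. -/
lemma integral_torus_mul {𝕜 : Type*} [RCLike 𝕜] (f g : UnitAddCircle → 𝕜) (i : Fin 2) :
    ∫ x : Torus, f (x i) * g (x i.rev) = (∫ a, f a) * ∫ a, g a := by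
  have h := integral_fintype_prod_volume_eq_prod (ι := Fin 2) (E := fun _ => UnitAddCircle)
    (fun j => if j = i then f else g)
  rw [prod_fin_two_rev _ i] at h
  simp only [if_true, rev_ne, if_false] at h
  rw [← h]
  congr 1; ext x
  rw [prod_fin_two_rev _ i]
  simp [rev_ne]

/-- The heat kernel of the circle is nonnegative with integral one, so the spatial `L¹` norm reduces
to that of `thd`. This is integrable in time by `t^(-7/8)` near zero and by `t⁻²` at infinity. -/
lemma integrable_thd_mul_th (i : Fin 2) :
    Integrable (fun p : ℝ × Torus => thd p.1 (p.2 i) * th p.1 (p.2 i.rev))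
      ((volume.restrict (Set.Ioi (0 : ℝ))).prod (volume : Measure Torus)) := by
  have hm := measurable_thd_mul_th i
  have hT : ∀ f : Torus → ℝ, Continuous f → Integrable f := fun f hf =>
    hf.integrable_of_hasCompactSupport (HasCompactSupport.of_compactSpace _)
  rw [integrable_prod_iff hm.aestronglyMeasurable]
  constructor
  · refine (ae_restrict_iff' measurableSet_Ioi).2 (Filter.Eventually.of_forall fun t ht => hT _ ?_)
    have h1 := continuous_th ht
    have h2 := continuous_thd ht
    simp only
    fun_prop
  · have he : ∀ t : ℝ, 0 < t → ∫ x : Torus, ‖thd t (x i) * th t (x i.rev)‖ = ∫ a, |thd t a| := by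
      intro t ht
      have h := integral_torus_mul (fun a => |thd t a|) (th t) i
      rw [integral_th ht, mul_one] at h
      rw [← h]
      congr 1; ext x
      rw [norm_mul, Real.norm_eq_abs, Real.norm_of_nonneg (th_nonneg ht _)]
    have hms : AEStronglyMeasurable (fun t : ℝ => ∫ x : Torus, ‖thd t (x i) * th t (x i.rev)‖)
        (volume : Measure ℝ) := (hm.norm.stronglyMeasurable.integral_prod_right).aestronglyMeasurable
    rw [← IntegrableOn, ← Set.Ioc_union_Ioi_eq_Ioi (zero_le_one (α := ℝ))]
    refine IntegrableOn.union ?_ ?_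
    · have hr : IntegrableOn (fun t : ℝ => (1 + Cq) * t ^ (-(7 / 8) : ℝ)) (Set.Ioc 0 1) := by
        refine Integrable.const_mul ?_ _
        have := intervalIntegral.intervalIntegrable_rpow' (a := 0) (b := 1)
          (show (-1 : ℝ) < -(7 / 8) by norm_num)
        rwa [intervalIntegrable_iff_integrableOn_Ioc_of_le zero_le_one] at this
      refine Integrable.mono' hr hms.restrict ?_
      refine (ae_restrict_iff' measurableSet_Ioc).2 (Filter.Eventually.of_forall fun t ht => ?_)
      rw [he t ht.1, Real.norm_of_nonneg (integral_nonneg fun a => abs_nonneg _)]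
      exact integral_abs_thd_le ht.1
    · have hr : IntegrableOn (fun t : ℝ => Cd * t ^ (-2 : ℝ)) (Set.Ioi 1) :=
        (integrableOn_Ioi_rpow_of_lt (by norm_num) one_pos).const_mul _
      refine Integrable.mono' hr hms.restrict ?_
      refine (ae_restrict_iff' measurableSet_Ioi).2 (Filter.Eventually.of_forall fun t ht => ?_)
      have ht0 : (0 : ℝ) < t := one_pos.trans ht
      rw [he t ht0, Real.norm_of_nonneg (integral_nonneg fun a => abs_nonneg _),
        Real.rpow_neg ht0.le, Real.rpow_two]
      exact integral_abs_thd_le_mul ht0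

lemma integrable_gk (i : Fin 2) : Integrable (gk i) := (integrable_thd_mul_th i).integral_prod_right

lemma integral_thd_mul_th_mul_mFourier {t : ℝ} (ht : 0 < t) (i : Fin 2) (k : Freq) :
    ∫ x : Torus, UnitAddTorus.mFourier (-k) x * ((thd t (x i) * th t (x i.rev) : ℝ) : ℂ) =
      (2 * Real.pi * Complex.I * k i) * ((Real.exp (-lam k * t) : ℝ) : ℂ) := by
  have h := integral_torus_mul (fun a => fs (hwd t) a * fourier (-k i) a)
    (fun a => fs (fun n => (hw t n : ℂ)) a * fourier (-k i.rev) a) i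
  rw [integral_fs_mul_fourier (summable_norm_hwd ht),
    integral_fs_mul_fourier (summable_norm_hw ht)] at h
  have e : hwd t (k i) * (hw t (k i.rev) : ℂ) =
      (2 * Real.pi * Complex.I * k i) * ((Real.exp (-lam k * t) : ℝ) : ℂ) := by
    have : hw t (k i) * hw t (k i.rev) = Real.exp (-lam k * t) := by
      rw [hw, hw, ← Real.exp_add, lam_eq]
      congr 1
      have := prod_fin_two_rev (M := Multiplicative ℝ)
        (fun j => Multiplicative.ofAdd ((k j : ℝ) ^ 2)) i
      rw [Fin.prod_univ_two, ← ofAdd_add, ← ofAdd_add] at this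
      have := Multiplicative.ofAdd.injective this
      rw [this]; ring
    rw [← this, hwd]; push_cast; ring
  rw [← e, ← h]
  refine integral_congr_ae (Filter.Eventually.of_forall fun x => ?_)
  simp only [UnitAddTorus.mFourier, ContinuousMap.coe_mk]
  rw [prod_fin_two_rev _ i, Complex.ofReal_mul, ofReal_thd ht, (ofReal_th ht _).1]
  simp only [Pi.neg_apply]
  ring

/-- By Fubini the coefficient is `2πi k_i` times the time integral of `exp (-lam k * t)`, namely `1
/ lam k`. For `k = 0` the first factor vanishes, in agreement with division by zero. -/
lemma fc_gk (i : Fin 2) (k : Freq) :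
    fc (fun x => (gk i x : ℂ)) k = (2 * Real.pi * Complex.I * k i) / (lam k : ℂ) := by
  have hint : Integrable (fun p : Torus × ℝ => UnitAddTorus.mFourier (-k) p.1 *
      ((thd p.2 (p.1 i) * th p.2 (p.1 i.rev) : ℝ) : ℂ))
      ((volume : Measure Torus).prod (volume.restrict (Set.Ioi (0 : ℝ)))) := by
    refine Integrable.bdd_mul (c := 1) (integrable_thd_mul_th i).swap.ofReal ?_ ?_
    · refine Continuous.aestronglyMeasurable ?_
      fun_prop
    · exact Filter.Eventually.of_forall fun p => norm_mFourier_le _ _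
  have h1 : ∀ x : Torus, UnitAddTorus.mFourier (-k) x * (gk i x : ℂ) =
      ∫ t in Set.Ioi (0 : ℝ), UnitAddTorus.mFourier (-k) x *
        ((thd t (x i) * th t (x i.rev) : ℝ) : ℂ) := by
    intro x
    rw [integral_const_mul, integral_complex_ofReal, gk]
  rw [fc]
  simp_rw [h1]
  rw [integral_integral_swap hint, setIntegral_congr_fun measurableSet_Ioi
    fun t ht => integral_thd_mul_th_mul_mFourier ht i k, integral_const_mul, integral_complex_ofReal]
  rcases eq_or_ne k 0 with rfl | hk
  · simp
  · have hl := lam_pos hk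
    rw [integral_exp_mul_Ioi (by linarith)]
    simp [div_eq_mul_inv]

/-- The Biot–Savart kernel is almost everywhere given by the integral formula. -/
lemma biotSavart_ae : biotSavart =ᵐ[volume] fun x => ![-gk 1 x, gk 0 x] := by
  filter_upwards [pd_greenReal_ae 0, pd_greenReal_ae 1] with x h0 h1
  rw [biotSavart, h0, h1]

/-! ### Fourier coefficients and a lower bound for Green's function -/

lemma fc_greenReal (k : Freq) : fc (fun x => (greenReal x : ℂ)) k = (((lam k)⁻¹ : ℝ) : ℂ) := by
  have h := integral_greenReal_mul k
  rw [fc]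
  simp_rw [mul_comm (UnitAddTorus.mFourier (-k) _)]
  rw [h]
  split_ifs with hk
  · simp [hk]
  · rfl

/-- Green's function is bounded below. -/
lemma exists_le_green : ∃ C : ℝ, 0 ≤ C ∧ ∀ x, ((-C : ℝ) : EReal) ≤ green x := by
  set S : ℝ := ∑' k : Fin 2 → ℤ, Real.exp (-(4 * Real.pi ^ 2 * ∑ i, (k i : ℝ) ^ 2) * 1)
  have hS : 0 ≤ S := tsum_nonneg fun k => (Real.exp_pos _).le
  -- Minus `g` is a lower bound for the integrand `heatKernel t x - 1`, uniformly in `x`: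
  -- nonnegativity of the heat kernel is used up to time one, exponential convergence to `1`
  -- afterwards.
  set g : ℝ → ℝ := fun t => if t ≤ 1 then 1 else Real.exp (-(4 * Real.pi ^ 2) * (t - 1)) * S with hg
  have hg0 : ∀ t, 0 ≤ g t := fun t => by rw [hg]; simp only; split_ifs <;> positivity
  have hgi : IntegrableOn g (Set.Ioi 0) := by
    rw [← Set.Ioc_union_Ioi_eq_Ioi (zero_le_one (α := ℝ))]
    refine IntegrableOn.union ?_ ?_
    · refine IntegrableOn.congr_fun (f := fun _ => (1 : ℝ)) (by simp) (fun t ht => ?_)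
        measurableSet_Ioc
      simp [hg, ht.2]
    · have h1 := ((integrableOn_exp_mul_Ioi (a := -(4 * Real.pi ^ 2))
        (by have := Real.pi_pos; nlinarith) 1).mul_const (Real.exp (4 * Real.pi ^ 2))).mul_const S
      refine IntegrableOn.congr_fun h1 (fun t ht => ?_) measurableSet_Ioi
      simp only [hg, if_neg (not_le.2 (Set.mem_Ioi.1 ht)), ← Real.exp_add]
      congr 2; ring
  refine ⟨∫ t in Set.Ioi 0, g t, integral_nonneg hg0, fun x => ?_⟩
  rw [green]
  split_ifs with hx
  · exact le_top
  · rw [EReal.coe_le_coe_iff, greenReal, ← integral_neg]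
    refine setIntegral_mono_on hgi.neg (integrableOn_heatKernel hx) measurableSet_Ioi fun t ht => ?_
    simp only [hg]
    split_ifs with h1
    · have := heatKernel_nonneg ht x
      linarith
    · have := abs_heatKernel_sub_one_le (not_le.1 h1).le x
      have := neg_abs_le (heatKernel t x - 1)
      linarith

/-! ### Interactions of measures with square integrable densities -/

lemma memLp_coe {f : Torus → ℝ} (hf : MemLp f 2 volume) :
    MemLp (fun x => (f x : ℂ)) 2 volume := hf.ofReal

lemma enorm_coe (x : ℝ) : ‖(x : ℂ)‖ₑ = ‖x‖ₑ := by
  rw [← ofReal_norm, Complex.norm_real, ofReal_norm]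

lemma nsq_fc_ne_top {f : Torus → ℝ} (hf : MemLp f 2 volume) :
    nsq (fc fun x => (f x : ℂ)) ≠ ⊤ := by
  rw [nsq_fc (memLp_coe hf)]
  have h := (hf.integrable_norm_pow two_ne_zero).2.ne
  simp_rw [enorm_coe]
  simpa using h

instance : (volume : Measure Torus).IsNegInvariant :=
  Measure.IsAddHaarMeasure.isNegInvariant_of_innerRegular volume

/-- `f` is a square integrable density of `γ`. -/
structure IsDensity (γ : Measure Torus) (f : Torus → ℝ) : Prop where
  measurable : Measurable f
  nonneg : ∀ x, 0 ≤ f x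
  memLp : MemLp f 2 volume
  eq : γ = volume.withDensity fun x => ENNReal.ofReal (f x)

lemma IsDensity.mc_eq {γ : Measure Torus} {f : Torus → ℝ} (hf : IsDensity γ f) :
    mc γ = fc fun x => (f x : ℂ) := mc_eq_fc hf.measurable hf.nonneg hf.eq

lemma IsDensity.nsq_ne_top {γ : Measure Torus} {f : Torus → ℝ} (hf : IsDensity γ f) :
    nsq (mc γ) ≠ ⊤ := by
  rw [hf.mc_eq]; exact nsq_fc_ne_top hf.memLp

lemma IsDensity.ac {γ : Measure Torus} {f : Torus → ℝ} (hf : IsDensity γ f) :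
    γ ≪ volume := by
  rw [hf.eq]; exact withDensity_absolutelyContinuous _ _

lemma IsDensity.integral_eq {γ : Measure Torus} {f : Torus → ℝ} (hf : IsDensity γ f)
    (g : Torus → ℂ) : ∫ x, g x ∂γ = ∫ x, (f x : ℂ) * g x := by
  rw [hf.eq, integral_withDensity_eq_integral_toReal_smul
    (by have := hf.measurable; fun_prop) (by simp)]
  simp only [ENNReal.toReal_ofReal (hf.nonneg _), Complex.real_smul]

/-- Properties known for almost every point, such as the formula for the Biot–Savart kernel, thereby
hold for almost every difference `x - y`. -/
lemma quasiMeasurePreserving_sub :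
    Measure.QuasiMeasurePreserving (fun p : Torus × Torus => p.1 - p.2)
      ((volume : Measure Torus).prod volume) volume :=
  Measure.quasiMeasurePreserving_fst.comp
    (measurePreserving_sub_prod (volume : Measure Torus) (volume : Measure Torus)).quasiMeasurePreserving

lemma IsDensity.prod_ac {γ : Measure Torus} {f : Torus → ℝ} (hf : IsDensity γ f) :
    γ.prod γ ≪ (volume : Measure Torus).prod volume := by
  rw [hf.eq, prod_withDensity₀ (by have := hf.measurable; fun_prop) (by have := hf.measurable; fun_prop)]
  exact withDensity_absolutelyContinuous _ _

lemma IsDensity.ae_sub {γ : Measure Torus} {f : Torus → ℝ} (hf : IsDensity γ f) {P : Torus → Prop}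
    (hP : ∀ᵐ x : Torus, P x) : ∀ᵐ p ∂γ.prod γ, P (p.1 - p.2) :=
  hf.prod_ac.ae_le (quasiMeasurePreserving_sub.ae hP)

lemma ae_torus_ne_zero : ∀ᵐ x : Torus, x ≠ 0 := by
  filter_upwards [ae_coord_ne_zero 0] with x hx h
  exact hx (by rw [h]; rfl)

lemma IsDensity.ae_ne {γ : Measure Torus} {f : Torus → ℝ} (hf : IsDensity γ f) :
    ∀ᵐ p ∂γ.prod γ, p.1 ≠ p.2 := by
  filter_upwards [hf.ae_sub ae_torus_ne_zero] with p hp h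
  exact hp (sub_eq_zero.2 h)

lemma mFourier_add_apply (k : Freq) (x y : Torus) :
    UnitAddTorus.mFourier k (x + y) = UnitAddTorus.mFourier k x * UnitAddTorus.mFourier k y := by
  simp only [UnitAddTorus.mFourier, ContinuousMap.coe_mk, ← Finset.prod_mul_distrib]
  refine Finset.prod_congr rfl fun i _ => ?_
  simp only [fourier_apply, Pi.add_apply, smul_add, AddCircle.toCircle_add, Circle.coe_mul]

lemma norm_mFourier (k : Freq) (x : Torus) : ‖UnitAddTorus.mFourier k x‖ = 1 := by
  rw [UnitAddTorus.mFourier, ContinuousMap.coe_mk, norm_prod]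
  exact Finset.prod_eq_one fun i _ => by rw [fourier_apply, Circle.norm_coe]

lemma mFourier_neg_mul (k : Freq) (x : Torus) :
    UnitAddTorus.mFourier (-k) x * UnitAddTorus.mFourier k x = 1 := by
  rw [← UnitAddTorus.mFourier_add]; simp [UnitAddTorus.mFourier_zero]

lemma memLp_translate {f : Torus → ℝ} (hf : MemLp f 2 volume) (z : Torus) :
    MemLp (fun y => f (z + y)) 2 volume :=
  hf.comp_measurePreserving (measurePreserving_add_left volume z)

lemma memLp_mFourier_mul {f : Torus → ℝ} (hf : MemLp f 2 volume) (k : Freq) :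
    MemLp (fun y => UnitAddTorus.mFourier k y * (f y : ℂ)) 2 volume := by
  refine (memLp_coe hf).mono ?_ (Filter.Eventually.of_forall fun y => ?_)
  · exact (show Continuous (UnitAddTorus.mFourier k) by fun_prop).aestronglyMeasurable.mul
      (memLp_coe hf).aestronglyMeasurable
  · rw [norm_mul, norm_mFourier, one_mul]

lemma conj_fc (f : Torus → ℝ) (k : Freq) :
    conj (fc (fun x => (f x : ℂ)) k) = fc (fun x => (f x : ℂ)) (-k) := by
  rw [fc, fc, ← integral_conj]
  refine integral_congr_ae (Filter.Eventually.of_forall fun x => ?_)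
  simp only [map_mul, UnitAddTorus.mFourier_neg, Complex.conj_conj, Complex.conj_ofReal]

lemma fc_translate (f : Torus → ℝ) (k l : Freq) (z : Torus) :
    fc (fun y => UnitAddTorus.mFourier k (z + y) * (f (z + y) : ℂ)) l =
      UnitAddTorus.mFourier l z * fc (fun x => (f x : ℂ)) (l - k) := by
  have h := integral_add_left_eq_self (μ := (volume : Measure Torus))
    (fun x => UnitAddTorus.mFourier (-l) x * (UnitAddTorus.mFourier k x * (f x : ℂ))) z
  have e1 : fc (fun y => UnitAddTorus.mFourier k (z + y) * (f (z + y) : ℂ)) l =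
      UnitAddTorus.mFourier l z * ∫ y, UnitAddTorus.mFourier (-l) (z + y) *
        (UnitAddTorus.mFourier k (z + y) * (f (z + y) : ℂ)) := by
    rw [fc, ← integral_const_mul]
    refine integral_congr_ae (Filter.Eventually.of_forall fun y => ?_)
    simp only
    linear_combination (-(UnitAddTorus.mFourier (-l) y * (UnitAddTorus.mFourier k (z + y) *
      (f (z + y) : ℂ)))) * mFourier_neg_mul l z - UnitAddTorus.mFourier l z *
      (UnitAddTorus.mFourier k (z + y) * (f (z + y) : ℂ)) * mFourier_add_apply (-l) z y
  rw [e1, h, fc]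
  congr 1
  refine integral_congr_ae (Filter.Eventually.of_forall fun x => ?_)
  simp only
  rw [← mul_assoc, ← UnitAddTorus.mFourier_add]
  congr 2
  abel_nf

/-- Parseval for the translated function against `f`; translation by `z` only multiplies the
coefficients by characters of `z`. The coefficients of the correlation are absolutely summable,
being products of square summable families. -/
lemma hasSum_correlation {f : Torus → ℝ} (hf : MemLp f 2 volume) (k : Freq) (z : Torus) :
    HasSum (fun l => UnitAddTorus.mFourier (-l) z *
        (fc (fun x => (f x : ℂ)) l * fc (fun x => (f x : ℂ)) (k - l)))
      (∫ y, UnitAddTorus.mFourier (-k) (z + y) * (f (z + y) : ℂ) * (f y : ℂ)) := by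
  have hu : MemLp (fun y => UnitAddTorus.mFourier k (z + y) * (f (z + y) : ℂ)) 2 volume :=
    (memLp_mFourier_mul hf k).comp_measurePreserving (measurePreserving_add_left volume z)
  have h := hasSum_parseval hu (memLp_coe hf)
  have e : ∫ y, UnitAddTorus.mFourier (-k) (z + y) * (f (z + y) : ℂ) * (f y : ℂ) =
      ∫ y, conj (UnitAddTorus.mFourier k (z + y) * (f (z + y) : ℂ)) * (f y : ℂ) := by
    simp only [map_mul, UnitAddTorus.mFourier_neg, Complex.conj_ofReal]
  rw [e]
  refine h.congr_fun fun l => ?_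
  rw [fc_translate, map_mul, conj_fc, neg_sub, UnitAddTorus.mFourier_neg]
  ring

lemma integrable_mul_translate {f : Torus → ℝ} (hf : MemLp f 2 volume) (z : Torus) :
    Integrable (fun y => f (z + y) * f y) := (memLp_translate hf z).integrable_mul hf

lemma integral_mul_translate_le {f : Torus → ℝ} (hf : MemLp f 2 volume) (z : Torus) :
    ∫ y, |f (z + y) * f y| ≤ ∫ y, f y ^ 2 := by
  have h1 := (memLp_translate hf z).integrable_sq
  calc ∫ y, |f (z + y) * f y| ≤ ∫ y, (f (z + y) ^ 2 + f y ^ 2) / 2 := by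
        refine integral_mono (integrable_mul_translate hf z).abs ((h1.add hf.integrable_sq).div_const 2)
          fun y => ?_
        simp only
        rw [abs_mul]
        nlinarith [sq_nonneg (|f (z + y)| - |f y|), sq_abs (f (z + y)), sq_abs (f y)]
    _ = ∫ y, f y ^ 2 := by
        rw [integral_div, integral_add h1 hf.integrable_sq,
          integral_add_left_eq_self (μ := (volume : Measure Torus)) (fun y => f y ^ 2) z]
        ring

section Interaction

variable {γ : Measure Torus} {f : Torus → ℝ} {H : Torus → ℝ}

/-- In the variables `z = x - y` and `y`, the inner integral of `f (z + y) * f y` is bounded by `∫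
f²` uniformly in `z`, so integrability of `H` alone suffices. -/
lemma integrable_interaction_aux (hf : IsDensity γ f) (hH : Integrable H) :
    Integrable (fun p : Torus × Torus => H p.1 * (f (p.1 + p.2) * f p.2))
      ((volume : Measure Torus).prod volume) := by
  have hfm := hf.measurable
  have hm : AEStronglyMeasurable (fun p : Torus × Torus => H p.1 * (f (p.1 + p.2) * f p.2))
      ((volume : Measure Torus).prod volume) :=
    hH.aestronglyMeasurable.comp_fst.mul
      (Measurable.aestronglyMeasurable (by fun_prop))
  rw [integrable_prod_iff hm]
  refine ⟨Filter.Eventually.of_forall fun z =>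
    (integrable_mul_translate hf.memLp z).const_mul (H z), ?_⟩
  refine Integrable.mono' (hH.norm.mul_const (∫ y, f y ^ 2)) hm.norm.integral_prod_right'
    (Filter.Eventually.of_forall fun z => ?_)
  rw [Real.norm_of_nonneg (integral_nonneg fun y => norm_nonneg _)]
  simp only [norm_mul (H z)]
  rw [integral_const_mul]
  exact mul_le_mul_of_nonneg_left (integral_mul_translate_le hf.memLp z) (norm_nonneg _)

lemma integrable_interaction (hf : IsDensity γ f) (hH : Integrable H) :
    Integrable (fun p : Torus × Torus => H (p.1 - p.2)) (γ.prod γ) := by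
  have hfm := hf.measurable
  have h1 := integrable_interaction_aux hf hH
  have hmp := measurePreserving_sub_prod (volume : Measure Torus) (volume : Measure Torus)
  have h2 := hmp.integrable_comp_of_integrable h1
  rw [hf.eq, prod_withDensity₀ (by fun_prop) (by fun_prop),
    integrable_withDensity_iff_integrable_smul' (by fun_prop)
      (Filter.Eventually.of_forall fun p => by simp [ENNReal.mul_lt_top])]
  refine h2.congr (Filter.Eventually.of_forall fun p => ?_)
  simp only [Function.comp, sub_add_cancel, ENNReal.toReal_mul, ENNReal.toReal_ofReal (hf.nonneg _),
    smul_eq_mul]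
  ring

/-- The Fourier representation of an interaction. -/
lemma hasSum_interaction (hf : IsDensity γ f) (hH : Integrable H) (k : Freq) :
    HasSum (fun l => fc (fun x => (H x : ℂ)) l * (mc γ l * mc γ (k - l)))
      (∫ p, UnitAddTorus.mFourier (-k) p.1 * (H (p.1 - p.2) : ℂ) ∂γ.prod γ) := by
  have hfm := hf.measurable
  have haux := integrable_interaction_aux hf hH
  have hHc : Integrable (fun z => (H z : ℂ)) := hH.ofReal
  set K : Torus × Torus → ℂ := fun p =>
    (H p.1 : ℂ) * (UnitAddTorus.mFourier (-k) (p.1 + p.2) * (f (p.1 + p.2) : ℂ) * (f p.2 : ℂ))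
  have hmp := measurePreserving_sub_prod (volume : Measure Torus) (volume : Measure Torus)
  have hKi : Integrable K ((volume : Measure Torus).prod volume) := by
    refine haux.mono ?_ (Filter.Eventually.of_forall fun p => ?_)
    · exact (hHc.aestronglyMeasurable.comp_fst).mul (Measurable.aestronglyMeasurable (by fun_prop))
    · simp only [K, norm_mul, norm_mFourier]
      simp
  have e1 : ∫ p, UnitAddTorus.mFourier (-k) p.1 * (H (p.1 - p.2) : ℂ) ∂γ.prod γ =
      ∫ p, K p ∂(volume : Measure Torus).prod volume := by
    -- The shear `(x, y) ↦ (x - y, y)` preserves Lebesgue measure and separates the kernel from the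
    -- correlation of the density.
    rw [← hmp.map_eq, integral_map hmp.measurable.aemeasurable
      (by rw [hmp.map_eq]; exact hKi.aestronglyMeasurable), hf.eq,
      prod_withDensity₀ (by fun_prop) (by fun_prop),
      integral_withDensity_eq_integral_toReal_smul (by fun_prop)
        (Filter.Eventually.of_forall fun p => by simp [ENNReal.mul_lt_top])]
    refine integral_congr_ae (Filter.Eventually.of_forall fun p => ?_)
    simp only [K, sub_add_cancel, ENNReal.toReal_mul, ENNReal.toReal_ofReal (hf.nonneg _),
      Complex.real_smul]
    push_cast; ring
  rw [e1, integral_prod _ hKi, hf.mc_eq]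
  set a := fc fun x => (f x : ℂ) with ha
  have hna : nsq a ≠ ⊤ := nsq_fc_ne_top hf.memLp
  have hsum : Summable fun l => ‖a l * a (k - l)‖ := by
    refine (summable_of_tsum_enorm_ne_top fun h => ?_).norm
    have h1 := enorm_prod_sum_le a a k
    rw [h] at h1
    simp only [ne_eq, OfNat.ofNat_ne_zero, not_false_eq_true, ENNReal.top_pow, top_le_iff] at h1
    exact ENNReal.mul_ne_top hna hna h1
  -- Only the correlation is expanded in a Fourier series, which converges absolutely. The series of
  -- `H`, which is merely integrable, is never summed on its own.
  have h := hasSum_integral_of_dominated_convergence (μ := (volume : Measure Torus))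
    (F := fun l z => (H z : ℂ) * (UnitAddTorus.mFourier (-l) z * (a l * a (k - l))))
    (f := fun z => ∫ y, K (z, y))
    (fun l z => ‖H z‖ * ‖a l * a (k - l)‖)
    (fun l => hHc.aestronglyMeasurable.mul (Continuous.aestronglyMeasurable (by fun_prop)))
    (fun l => Filter.Eventually.of_forall fun z => by
      rw [norm_mul, norm_mul, norm_mFourier, one_mul, Complex.norm_real])
    (Filter.Eventually.of_forall fun z => hsum.mul_left _)
    (by simp_rw [tsum_mul_left]; exact hH.norm.mul_const _)
    (Filter.Eventually.of_forall fun z => by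
      simp only [K]
      rw [integral_const_mul]
      exact (hasSum_correlation hf.memLp k z).mul_left _)
  refine h.congr_fun fun l => ?_
  rw [fc, ← integral_mul_const]
  refine integral_congr_ae (Filter.Eventually.of_forall fun z => ?_)
  simp only
  ring

/-- The Fourier representation of an interaction, with the character in the second variable. -/
lemma hasSum_interaction_snd [SFinite γ] (hf : IsDensity γ f) (hH : Integrable H) (k : Freq) :
    HasSum (fun l => fc (fun x => (H x : ℂ)) (-l) * (mc γ l * mc γ (k - l)))
      (∫ p, UnitAddTorus.mFourier (-k) p.2 * (H (p.1 - p.2) : ℂ) ∂γ.prod γ) := by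
  have h := hasSum_interaction hf hH.comp_neg k
  rw [← integral_prod_swap]
  simp only [neg_sub] at h
  refine h.congr_fun fun l => ?_
  congr 1
  rw [fc, fc, ← integral_neg_eq_self]
  refine integral_congr_ae (Filter.Eventually.of_forall fun x => ?_)
  simp only [UnitAddTorus.mFourier, ContinuousMap.coe_mk, Pi.neg_apply, neg_neg]
  congr 1
  refine Finset.prod_congr rfl fun i _ => ?_
  simp [fourier_apply]

end Interaction

/-! ### Energy and the squared negative Sobolev norm -/

lemma summable_interaction_energy {a : Freq → ℂ} (ha : nsq a ≠ ⊤) :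
    (hsq a).toReal = ∑' l, (lam l)⁻¹ * ‖a l‖ ^ 2 ∧ Summable fun l => (lam l)⁻¹ * ‖a l‖ ^ 2 := by
  have hh : hsq a ≠ ⊤ := ne_top_of_le_ne_top ha (hsq_le_nsq _)
  have e : ∀ l, ((om l * ‖a l‖ₑ) ^ 2).toReal = (lam l)⁻¹ * ‖a l‖ ^ 2 := fun l => by
    rw [mul_pow, om_sq, ENNReal.toReal_mul, ENNReal.toReal_ofReal (inv_nonneg.2 (lam_nonneg l)),
      ENNReal.toReal_pow, toReal_enorm]
  constructor
  · rw [hsq, ENNReal.tsum_toReal_eq (fun k =>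
      ENNReal.pow_ne_top (ENNReal.mul_ne_top (om_ne_top k) enorm_ne_top))]
    exact tsum_congr e
  · exact (ENNReal.summable_toReal hh).congr e

lemma integral_green_eq {γ : Measure Torus} {f : Torus → ℝ} (hf : IsDensity γ f) :
    ∫ p, greenReal (p.1 - p.2) ∂γ.prod γ = (hsq (mc γ)).toReal := by
  have h := hasSum_interaction hf integrable_greenReal 0
  simp only [neg_zero, UnitAddTorus.mFourier_zero, ContinuousMap.one_apply, one_mul, zero_sub,
    fc_greenReal, integral_complex_ofReal] at h
  have h2 := Complex.hasSum_re h
  rw [Complex.ofReal_re] at h2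
  rw [(summable_interaction_energy hf.nsq_ne_top).1, ← h2.tsum_eq]
  refine tsum_congr fun l => ?_
  rw [Complex.re_ofReal_mul]
  congr 1
  rw [hf.mc_eq, ← conj_fc, Complex.mul_conj, Complex.ofReal_re, Complex.normSq_eq_norm_sq]

/-- The energy of a measure with a square integrable density. -/
lemma energy_eq {γ : ProbabilityMeasure Torus} {f : Torus → ℝ} (hf : IsDensity γ f) :
    energy γ = ((1 / 2 * (hsq (mc γ)).toReal : ℝ) : EReal) := by
  set μ := (γ : Measure Torus).prod (γ : Measure Torus)
  have hi : Integrable (fun p : Torus × Torus => greenReal (p.1 - p.2)) μ :=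
    integrable_interaction hf integrable_greenReal
  have hg : ∀ᵐ p ∂μ, green (p.1 - p.2) = (greenReal (p.1 - p.2) : EReal) := by
    filter_upwards [hf.ae_sub ae_torus_ne_zero] with p hp
    rw [green, if_neg hp]
  have e1 : ∫⁻ p, (green (p.1 - p.2)).toENNReal ∂μ =
      ∫⁻ p, ENNReal.ofReal (greenReal (p.1 - p.2)) ∂μ := by
    refine lintegral_congr_ae ?_
    filter_upwards [hg] with p hp
    rw [hp]; rfl
  have e2 : ∫⁻ p, (-green (p.1 - p.2)).toENNReal ∂μ =
      ∫⁻ p, ENNReal.ofReal (-greenReal (p.1 - p.2)) ∂μ := by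
    refine lintegral_congr_ae ?_
    filter_upwards [hg] with p hp
    rw [hp, ← EReal.coe_neg]; rfl
  have h3 := integral_eq_lintegral_pos_part_sub_lintegral_neg_part hi
  rw [integral_green_eq hf] at h3
  have t1 : ∫⁻ p, ENNReal.ofReal (greenReal (p.1 - p.2)) ∂μ ≠ ⊤ := hi.lintegral_lt_top.ne
  have t2 : ∫⁻ p, ENNReal.ofReal (-greenReal (p.1 - p.2)) ∂μ ≠ ⊤ := hi.neg.lintegral_lt_top.ne
  rw [energy, e1, e2, h3, ← ENNReal.ofReal_toReal t1, ← ENNReal.ofReal_toReal t2,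
    EReal.coe_ennreal_ofReal, EReal.coe_ennreal_ofReal, max_eq_left ENNReal.toReal_nonneg,
    max_eq_left ENNReal.toReal_nonneg, ← EReal.coe_sub, ← EReal.coe_mul,
    ENNReal.toReal_ofReal ENNReal.toReal_nonneg, ENNReal.toReal_ofReal ENNReal.toReal_nonneg]

/-- The energy is bounded below. -/
lemma exists_le_energy : ∃ C : ℝ, ∀ γ, ((-C : ℝ) : EReal) ≤ energy γ := by
  obtain ⟨C, hC, h⟩ := exists_le_green
  refine ⟨1 / 2 * C, fun γ => ?_⟩
  set μ := (γ : Measure Torus).prod (γ : Measure Torus)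
  have h1 : ∫⁻ p, (-green (p.1 - p.2)).toENNReal ∂μ ≤ ENNReal.ofReal C := by
    calc _ ≤ ∫⁻ _p, ENNReal.ofReal C ∂μ := by
          refine lintegral_mono fun p => ?_
          have h2 : -green (p.1 - p.2) ≤ (C : EReal) := by
            have := EReal.neg_le_neg_iff.2 (h (p.1 - p.2))
            simpa using this
          exact EReal.toENNReal_le_toENNReal h2
      _ = ENNReal.ofReal C := by simp [μ]
  rw [energy]
  have h3 : ((-C : ℝ) : EReal) ≤ ((∫⁻ p : Torus × Torus, (green (p.1 - p.2)).toENNReal ∂μ : ENNReal) : EReal)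
      - ((∫⁻ p : Torus × Torus, (-green (p.1 - p.2)).toENNReal ∂μ : ENNReal) : EReal) := by
    have h4 : ((∫⁻ p : Torus × Torus, (-green (p.1 - p.2)).toENNReal ∂μ : ENNReal) : EReal) ≤
        (C : EReal) := by
      refine (EReal.coe_ennreal_le_coe_ennreal_iff.2 h1).trans (le_of_eq ?_)
      rw [EReal.coe_ennreal_ofReal, max_eq_left hC]
    calc ((-C : ℝ) : EReal) = 0 - (C : EReal) := by simp
      _ ≤ _ := EReal.sub_le_sub (EReal.coe_ennreal_nonneg _) h4
  have h5 : ((-(1 / 2 * C) : ℝ) : EReal) = ((1 / 2 : ℝ) : EReal) * ((-C : ℝ) : EReal) := by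
    rw [← EReal.coe_mul]; congr 1; ring
  rw [h5]
  exact mul_le_mul_of_nonneg_left h3 (by norm_num)

/-! ### Testing against characters -/

/-- The real part of a multiple of a character. -/
def chi (c : ℂ) (m : Freq) (x : Torus) : ℝ := (c * UnitAddTorus.mFourier m x).re

lemma mFourier_single (m : Freq) (i : Fin 2) (a : UnitAddCircle) :
    UnitAddTorus.mFourier m (Pi.single i a) = fourier (m i) a := by
  rw [UnitAddTorus.mFourier, ContinuousMap.coe_mk, prod_fin_two_rev _ i, Pi.single_eq_same,
    Pi.single_eq_of_ne (rev_ne i), fourier_eval_zero, mul_one]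

lemma pd_chi (c : ℂ) (m : Freq) (i : Fin 2) :
    pd i (chi c m) = chi (c * (2 * Real.pi * Complex.I * m i)) m := by
  funext x
  have h := (hasDerivAt_fourier 1 (m i) 0).const_mul (c * UnitAddTorus.mFourier m x)
  have h2 : HasDerivAt (fun h : ℝ => chi c m (x + Pi.single i (h : UnitAddCircle))) _ 0 :=
    (Complex.reCLM.hasFDerivAt.comp_hasDerivAt 0 h).congr_of_eventuallyEq
      (Filter.Eventually.of_forall fun h => by
        simp only [chi, mFourier_add_apply, mFourier_single, Function.comp, Complex.reCLM_apply,
          mul_assoc])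
  rw [pd, h2.deriv, chi, Complex.reCLM_apply]
  congr 1
  have e : fourier (m i) ((0 : ℝ) : UnitAddCircle) = (1 : ℂ) := by
    rw [AddCircle.coe_zero, fourier_eval_zero]
  rw [e]
  push_cast
  ring

lemma lap_chi (c : ℂ) (m : Freq) (x : Torus) : lap (chi c m) x = chi (-(lam m : ℂ) * c) m x := by
  simp only [lap, pd_chi, Fin.sum_univ_two]
  simp only [chi, ← Complex.add_re]
  congr 1
  rw [lam_eq]
  push_cast
  linear_combination (4 * (Real.pi : ℂ) ^ 2 * ((m 0 : ℂ) ^ 2 + (m 1 : ℂ) ^ 2) * c *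
    UnitAddTorus.mFourier m x) * Complex.I_sq

lemma isTestFunction_chi (c : ℂ) (m : Freq) : IsTestFunction fun _ => chi c m := by
  have e : (fun p : ℝ × (Fin 2 → ℝ) => chi c m fun i => (p.2 i : UnitAddCircle)) =
      fun p => Complex.reCLM (c * ∏ i, Complex.exp (2 * Real.pi * Complex.I * m i * (p.2 i : ℂ))) := by
    funext p
    simp only [chi, Complex.reCLM_apply, UnitAddTorus.mFourier, ContinuousMap.coe_mk]
    congr 2
    refine Finset.prod_congr rfl fun i _ => ?_
    rw [fourier_coe_apply]
    congr 1
    push_cast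
    ring
  rw [IsTestFunction, e]
  refine Complex.reCLM.contDiff.comp (contDiff_const.mul (contDiff_prod fun i _ => ?_))
  refine Complex.contDiff_exp.comp (contDiff_const.mul ?_)
  exact Complex.ofRealCLM.contDiff.comp (by fun_prop)

lemma integrable_mFourier (μ : Measure Torus) [IsFiniteMeasure μ] (m : Freq) :
    Integrable (fun x => UnitAddTorus.mFourier m x) μ :=
  (show Continuous (UnitAddTorus.mFourier m) by fun_prop).integrable_of_hasCompactSupport
    (HasCompactSupport.of_compactSpace _)

lemma re_const_mul_integral {α : Type*} [MeasurableSpace α] {μ : Measure α} {F : α → ℂ}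
    (hF : Integrable F μ) (c : ℂ) : ∫ x, (c * F x).re ∂μ = (c * ∫ x, F x ∂μ).re := by
  rw [← integral_const_mul]
  exact integral_re (hF.const_mul c)

lemma integral_chi (μ : Measure Torus) [IsFiniteMeasure μ] (c : ℂ) (k : Freq) :
    ∫ x, chi c (-k) x ∂μ = (c * mc μ k).re :=
  re_const_mul_integral (integrable_mFourier μ (-k)) c

lemma lam_neg (k : Freq) : lam (-k) = lam k := by simp [lam]

lemma fc_gk_neg (i : Fin 2) (k : Freq) :
    fc (fun x => (gk i x : ℂ)) (-k) = -fc (fun x => (gk i x : ℂ)) k := by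
  rw [fc_gk, fc_gk, lam_neg]; simp only [Pi.neg_apply, Int.cast_neg]; ring

lemma integrable_mFourier_interaction {γ : ProbabilityMeasure Torus} {f : Torus → ℝ}
    (hf : IsDensity γ f) {H : Torus → ℝ} (hH : Integrable H) (k : Freq) :
    Integrable (fun p : Torus × Torus => UnitAddTorus.mFourier k p.1 * (H (p.1 - p.2) : ℂ))
      ((γ : Measure Torus).prod γ) ∧
    Integrable (fun p : Torus × Torus => UnitAddTorus.mFourier k p.2 * (H (p.1 - p.2) : ℂ))
      ((γ : Measure Torus).prod γ) := by
  have h := (integrable_interaction hf hH).ofReal (𝕜 := ℂ)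
  constructor
  · exact h.bdd_mul (c := 1) (Continuous.aestronglyMeasurable (by fun_prop))
      (Filter.Eventually.of_forall fun p => norm_mFourier_le _ _)
  · exact h.bdd_mul (c := 1) (Continuous.aestronglyMeasurable (by fun_prop))
      (Filter.Eventually.of_forall fun p => norm_mFourier_le _ _)

/-- The nonlinearity in terms of Fourier coefficients. -/
lemma pairR_chi {γ : ProbabilityMeasure Torus} {f : Torus → ℝ} (hf : IsDensity γ f) (c : ℂ)
    (k : Freq) : pairR (grad (chi c (-k))) γ = (c * nonlin (mc γ) k).re := by
  set μ := (γ : Measure Torus).prod (γ : Measure Torus)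
  set e := UnitAddTorus.mFourier (-k) with he
  have hi : ∀ i, Integrable (fun p : Torus × Torus =>
      e p.1 * (gk i (p.1 - p.2) : ℂ) - e p.2 * (gk i (p.1 - p.2) : ℂ)) μ := fun i =>
    (integrable_mFourier_interaction hf (integrable_gk i) (-k)).1.sub
      (integrable_mFourier_interaction hf (integrable_gk i) (-k)).2
  set F : Torus × Torus → ℂ := fun p => Complex.I *
    ((k 0 : ℂ) * (e p.1 * (gk 1 (p.1 - p.2) : ℂ) - e p.2 * (gk 1 (p.1 - p.2) : ℂ)) -
      (k 1 : ℂ) * (e p.1 * (gk 0 (p.1 - p.2) : ℂ) - e p.2 * (gk 0 (p.1 - p.2) : ℂ)))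
  have hF : Integrable F μ :=
    (((hi 1).const_mul _).sub ((hi 0).const_mul _)).const_mul _
  have e1 : pairR (grad (chi c (-k))) γ = 1 / 2 * ∫ p, (c * (2 * Real.pi) * F p).re ∂μ := by
    -- The diagonal is a null set because the measure has a density, so removing it changes nothing.
    rw [pairR, Measure.restrict_eq_self_of_ae_mem (by exact hf.ae_ne)]
    congr 1
    refine integral_congr_ae ?_
    filter_upwards [hf.ae_sub biotSavart_ae] with p hp
    rw [hp]
    simp only [dotProduct, Fin.sum_univ_two, Pi.sub_apply, grad, pd_chi, Matrix.cons_val_zero,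
      Matrix.cons_val_one, chi, Pi.neg_apply, Int.cast_neg, ← he]
    rw [← Complex.sub_re, ← Complex.sub_re, ← Complex.re_mul_ofReal, ← Complex.re_mul_ofReal,
      ← Complex.add_re]
    congr 1
    simp only [F]
    push_cast
    ring
  have s : ∀ i, HasSum (fun l => fc (fun x => (gk i x : ℂ)) l * (mc γ l * mc γ (k - l)))
      (∫ p, e p.1 * (gk i (p.1 - p.2) : ℂ) ∂μ) ∧
      ∫ p, e p.2 * (gk i (p.1 - p.2) : ℂ) ∂μ = -∫ p, e p.1 * (gk i (p.1 - p.2) : ℂ) ∂μ := by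
    intro i
    have h1 := hasSum_interaction hf (integrable_gk i) k
    have h2 := hasSum_interaction_snd hf (integrable_gk i) k
    simp only [fc_gk_neg, neg_mul] at h2
    -- The derivative kernel has odd Fourier coefficients, so moving the character to the second
    -- variable changes the sign. The two halves of the symmetrised form are therefore equal, which
    -- cancels its factor `1 / 2`.
    exact ⟨h1, h2.unique h1.neg⟩
  have h := ((((s 1).1.mul_left (k 0 : ℂ)).sub ((s 0).1.mul_left (k 1 : ℂ))).mul_left
    (2 * Real.pi * Complex.I)).tsum_eq
  have hn : nonlin (mc γ) k = 2 * Real.pi * Complex.I *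
      ((k 0 : ℂ) * ∫ p, e p.1 * (gk 1 (p.1 - p.2) : ℂ) ∂μ -
        (k 1 : ℂ) * ∫ p, e p.1 * (gk 0 (p.1 - p.2) : ℂ) ∂μ) := by
    rw [← h, nonlin]
    refine tsum_congr fun l => ?_
    rw [fc_gk, fc_gk, symb]
    push_cast
    linear_combination (-(4 * (Real.pi : ℂ) ^ 2 * (k 0 * l 1 - k 1 * l 0) / (lam l : ℂ) *
      (mc γ l * mc γ (k - l)))) * Complex.I_sq
  have hFi : ∫ p, F p ∂μ = Complex.I *
      ((k 0 : ℂ) * (2 * ∫ p, e p.1 * (gk 1 (p.1 - p.2) : ℂ) ∂μ) -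
        (k 1 : ℂ) * (2 * ∫ p, e p.1 * (gk 0 (p.1 - p.2) : ℂ) ∂μ)) := by
    have d : ∀ i, ∫ p, (e p.1 * (gk i (p.1 - p.2) : ℂ) - e p.2 * (gk i (p.1 - p.2) : ℂ)) ∂μ =
        2 * ∫ p, e p.1 * (gk i (p.1 - p.2) : ℂ) ∂μ := fun i => by
      have hii := integrable_mFourier_interaction hf (integrable_gk i) (-k)
      rw [integral_sub hii.1 hii.2, (s i).2]
      ring
    simp only [F]
    rw [integral_const_mul, integral_sub ((hi 1).const_mul _) ((hi 0).const_mul _),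
      integral_const_mul, integral_const_mul, d, d]
  rw [e1, re_const_mul_integral hF, hFi, hn, ← Complex.re_ofReal_mul]
  congr 1
  push_cast
  ring

/-! ### Transport by a bounded field -/

/-- The Fourier coefficients of `-div (μ u)`, for a vector field `u` and a measure `μ`. -/
def drift (u : Torus → Fin 2 → ℝ) (μ : Measure Torus) (k : Freq) : ℂ :=
  ∑ j, (-(2 * Real.pi * Complex.I * k j)) * ∫ x, UnitAddTorus.mFourier (-k) x * (u x j : ℂ) ∂μ

section Drift

variable {u : Torus → Fin 2 → ℝ} {V : ℝ} {γ γ' : ProbabilityMeasure Torus} {f f' : Torus → ℝ}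

lemma aestronglyMeasurable_coord {μ : Measure Torus} (hu : AEStronglyMeasurable u μ) (j : Fin 2) :
    AEStronglyMeasurable (fun x => (u x j : ℂ)) μ :=
  (show Continuous fun y : Fin 2 → ℝ => (y j : ℂ) by fun_prop).comp_aestronglyMeasurable hu

lemma norm_coord_le {μ : Measure Torus} (hV : ∀ᵐ x ∂μ, ‖u x‖ ≤ V) (j : Fin 2) :
    ∀ᵐ x ∂μ, ‖(u x j : ℂ)‖ ≤ V := by
  filter_upwards [hV] with x hx
  rw [Complex.norm_real]
  exact (norm_le_pi_norm (u x) j).trans hx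

lemma integrable_mFourier_coord {μ : Measure Torus} [IsFiniteMeasure μ]
    (hu : AEStronglyMeasurable u μ) (hV : ∀ᵐ x ∂μ, ‖u x‖ ≤ V) (k : Freq) (j : Fin 2) :
    Integrable (fun x => UnitAddTorus.mFourier k x * (u x j : ℂ)) μ :=
  (integrable_mFourier μ k).mul_bdd (c := V) (aestronglyMeasurable_coord hu j) (norm_coord_le hV j)

lemma integral_grad_chi {μ : Measure Torus} [IsFiniteMeasure μ]
    (hu : AEStronglyMeasurable u μ) (hV : ∀ᵐ x ∂μ, ‖u x‖ ≤ V) (c : ℂ) (k : Freq) :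
    ∫ x, grad (chi c (-k)) x ⬝ᵥ u x ∂μ = (c * drift u μ k).re := by
  have hi := fun j => (integrable_mFourier_coord hu hV (-k) j).const_mul
    (-(2 * Real.pi * Complex.I * k j))
  have h : ∫ x, ∑ j, (-(2 * Real.pi * Complex.I * k j)) *
      (UnitAddTorus.mFourier (-k) x * (u x j : ℂ)) ∂μ = drift u μ k := by
    rw [integral_finsetSum _ fun j _ => hi j, drift]
    simp_rw [integral_const_mul]
  rw [← h, ← re_const_mul_integral (integrable_finsetSum _ fun j _ => hi j)]
  refine integral_congr_ae (Filter.Eventually.of_forall fun x => ?_)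
  simp only [dotProduct, grad, pd_chi, chi, Finset.mul_sum, Complex.re_sum]
  refine Finset.sum_congr rfl fun j _ => ?_
  rw [← Complex.re_mul_ofReal]
  congr 1
  simp only [Pi.neg_apply, Int.cast_neg]
  ring

lemma norm_drift_le (hu : ∀ᵐ x ∂(γ : Measure Torus), ‖u x‖ ≤ V) (k : Freq) :
    ‖drift u γ k‖ ≤ ∑ j, ‖(2 * Real.pi * Complex.I * k j : ℂ)‖ * V := by
  refine (norm_sum_le _ _).trans (Finset.sum_le_sum fun j _ => ?_)
  rw [norm_mul, norm_neg]
  refine mul_le_mul_of_nonneg_left ?_ (norm_nonneg _)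
  refine (norm_integral_le_of_norm_le_const (C := V) ?_).trans (by simp)
  filter_upwards [norm_coord_le hu j] with x hx
  rw [norm_mul, norm_mFourier, one_mul]
  exact hx

lemma memLp_coord_mul {g : Torus → ℂ} (hu : AEStronglyMeasurable u volume)
    (hV : ∀ᵐ x, ‖u x‖ ≤ V) (hg : MemLp g 2 volume) (j : Fin 2) :
    MemLp (fun x => (u x j : ℂ) * g x) 2 volume := by
  refine MemLp.of_le_mul (c := V) hg ((aestronglyMeasurable_coord hu j).mul hg.aestronglyMeasurable) ?_
  filter_upwards [norm_coord_le hV j] with x hx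
  rw [norm_mul]
  exact mul_le_mul_of_nonneg_right hx (norm_nonneg _)

lemma drift_eq (hf : IsDensity γ f) (k : Freq) :
    drift u γ k = ∑ j, (-(2 * Real.pi * Complex.I * k j)) *
      fc (fun x => (u x j : ℂ) * (f x : ℂ)) k := by
  simp only [drift, hf.integral_eq, fc]
  refine Finset.sum_congr rfl fun j _ => ?_
  congr 1
  refine integral_congr_ae (Filter.Eventually.of_forall fun x => ?_)
  simp only
  ring

/-- The derivative in the divergence is exactly compensated by the weight of the `H⁻¹` norm. -/
lemma om_mul_freq_le (k : Freq) (j : Fin 2) :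
    (om k * ‖(-(2 * Real.pi * Complex.I * k j) : ℂ)‖ₑ) ^ 2 ≤ 1 := by
  have e : ‖(-(2 * Real.pi * Complex.I * k j) : ℂ)‖ = 2 * Real.pi * |(k j : ℝ)| := by
    rw [norm_neg]
    simp [abs_of_pos Real.pi_pos]
  rw [mul_pow, om_sq, ← ofReal_norm, e, ← ENNReal.ofReal_pow (by positivity),
    ← ENNReal.ofReal_mul (inv_nonneg.2 (lam_nonneg k))]
  refine ENNReal.ofReal_le_one.2 ?_
  by_cases hk : k = 0
  · simp [hk]
  · rw [inv_mul_le_iff₀ (lam_pos hk), lam_eq, mul_pow, sq_abs]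
    have hp : 0 ≤ (2 * Real.pi) ^ 2 := by positivity
    have hj : (k j : ℝ) ^ 2 ≤ (k 0 : ℝ) ^ 2 + (k 1 : ℝ) ^ 2 := by
      fin_cases j
      · exact le_add_of_nonneg_right (sq_nonneg _)
      · exact le_add_of_nonneg_left (sq_nonneg _)
    nlinarith [mul_le_mul_of_nonneg_left hj hp]

/-- The difference of two drifts in the dual Sobolev norm. -/
lemma hsq_drift_sub_le (hu : AEStronglyMeasurable u volume) (hV : ∀ᵐ x, ‖u x‖ ≤ V)
    (hf : IsDensity γ f) (hf' : IsDensity γ' f') :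
    hsq (fun k => drift u γ k - drift u γ' k) ≤
      (4 * ENNReal.ofReal V ^ 2) * nsq (mc (γ : Measure Torus) - mc (γ' : Measure Torus)) := by
  have hw : MemLp (fun x => (f x : ℂ) - (f' x : ℂ)) 2 volume :=
    (memLp_coe hf.memLp).sub (memLp_coe hf'.memLp)
  have hsub : ∀ {g g' : Torus → ℂ}, MemLp g 2 volume → MemLp g' 2 volume →
      ∀ k, fc g k - fc g' k = fc (fun x => g x - g' x) k := fun hg hg' k => by
    have h1 : ∀ {g : Torus → ℂ}, MemLp g 2 volume →
        Integrable fun x => UnitAddTorus.mFourier (-k) x * g x := fun hg =>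
      (hg.integrable one_le_two).bdd_mul (c := 1) (Continuous.aestronglyMeasurable (by fun_prop))
        (Filter.Eventually.of_forall fun p => norm_mFourier_le _ _)
    rw [fc, fc, fc, ← integral_sub (h1 hg) (h1 hg')]
    simp only [mul_sub]
  -- The difference of the drifts is minus the divergence of `G`, so its `H⁻¹` norm is controlled by
  -- the `L²` norms of the components of `G`. The factor `4` arises from two components and from
  -- squaring a sum of two terms.
  set G : Fin 2 → Torus → ℂ := fun j x => (u x j : ℂ) * ((f x : ℂ) - (f' x : ℂ)) with hG
  have hGm : ∀ j, MemLp (G j) 2 volume := memLp_coord_mul hu hV hw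
  have e : ∀ k, drift u γ k - drift u γ' k =
      ∑ j, (-(2 * Real.pi * Complex.I * k j)) * fc (G j) k := fun k => by
    rw [drift_eq hf, drift_eq hf', ← Finset.sum_sub_distrib]
    refine Finset.sum_congr rfl fun j _ => ?_
    rw [← mul_sub, hsub (memLp_coord_mul hu hV (memLp_coe hf.memLp) j)
      (memLp_coord_mul hu hV (memLp_coe hf'.memLp) j)]
    simp only [hG, mul_sub]
  have en : nsq (mc (γ : Measure Torus) - mc (γ' : Measure Torus)) =
      ∫⁻ x, ‖(f x : ℂ) - (f' x : ℂ)‖ₑ ^ 2 := by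
    rw [← nsq_fc hw, hf.mc_eq, hf'.mc_eq]
    congr 1
    funext k
    exact hsub (memLp_coe hf.memLp) (memLp_coe hf'.memLp) k
  have hk : ∀ k, (om k * ‖drift u γ k - drift u γ' k‖ₑ) ^ 2 ≤
      2 * (‖fc (G 0) k‖ₑ ^ 2 + ‖fc (G 1) k‖ₑ ^ 2) := fun k => by
    rw [e, Fin.sum_univ_two, mul_pow]
    calc om k ^ 2 * ‖_‖ₑ ^ 2 ≤ om k ^ 2 * (2 * (‖_‖ₑ ^ 2 + ‖_‖ₑ ^ 2)) :=
          mul_le_mul_right (enorm_add_sq_le _ _) _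
      _ = 2 * ((om k * ‖(-(2 * Real.pi * Complex.I * k 0) : ℂ)‖ₑ) ^ 2 * ‖fc (G 0) k‖ₑ ^ 2 +
          (om k * ‖(-(2 * Real.pi * Complex.I * k 1) : ℂ)‖ₑ) ^ 2 * ‖fc (G 1) k‖ₑ ^ 2) := by
          rw [enorm_mul, enorm_mul]; ring
      _ ≤ 2 * (1 * ‖fc (G 0) k‖ₑ ^ 2 + 1 * ‖fc (G 1) k‖ₑ ^ 2) := by
          gcongr <;> exact om_mul_freq_le _ _
      _ = _ := by rw [one_mul, one_mul]
  have hGn : ∀ j, nsq (fc (G j)) ≤ ENNReal.ofReal V ^ 2 *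
      ∫⁻ x, ‖(f x : ℂ) - (f' x : ℂ)‖ₑ ^ 2 := fun j => by
    rw [nsq_fc (hGm j), ← lintegral_const_mul' _ _ (by simp)]
    refine lintegral_mono_ae ?_
    filter_upwards [norm_coord_le hV j] with x hx
    rw [hG, enorm_mul, mul_pow]
    gcongr
    rw [← ofReal_norm]
    exact ENNReal.ofReal_le_ofReal hx
  rw [en, hsq]
  calc ∑' k, (om k * ‖drift u γ k - drift u γ' k‖ₑ) ^ 2
      ≤ ∑' k, 2 * (‖fc (G 0) k‖ₑ ^ 2 + ‖fc (G 1) k‖ₑ ^ 2) := ENNReal.tsum_le_tsum hk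
    _ = 2 * (nsq (fc (G 0)) + nsq (fc (G 1))) := by
        rw [ENNReal.tsum_mul_left, ENNReal.tsum_add]; rfl
    _ ≤ 2 * (ENNReal.ofReal V ^ 2 * (∫⁻ x, ‖(f x : ℂ) - (f' x : ℂ)‖ₑ ^ 2) +
          ENNReal.ofReal V ^ 2 * ∫⁻ x, ‖(f x : ℂ) - (f' x : ℂ)‖ₑ ^ 2) := by
        gcongr <;> exact hGn _
    _ = _ := by ring

/-- The drift in terms of Fourier coefficients. -/
lemma integral_mFourier_coord_eq (hu : AEStronglyMeasurable u volume) (hV : ∀ᵐ x, ‖u x‖ ≤ V)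
    (hf : IsDensity γ f) (k : Freq) (j : Fin 2) :
    ∫ x, UnitAddTorus.mFourier (-k) x * (u x j : ℂ) ∂(γ : Measure Torus) =
      ∑' l, conj (∫ x, UnitAddTorus.mFourier (k - l) x * (u x j : ℂ)) * mc γ l := by
  have hF : MemLp (fun x => UnitAddTorus.mFourier k x * (u x j : ℂ)) 2 volume := by
    refine MemLp.of_bound (C := V) ((Continuous.aestronglyMeasurable (by fun_prop)).mul
      (aestronglyMeasurable_coord hu j)) ?_
    filter_upwards [norm_coord_le hV j] with x hx
    rw [norm_mul, norm_mFourier, one_mul]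
    exact hx
  rw [hf.integral_eq, hf.mc_eq]
  have h := (hasSum_parseval hF (memLp_coe hf.memLp)).tsum_eq
  have e : ∫ x, (f x : ℂ) * (UnitAddTorus.mFourier (-k) x * (u x j : ℂ)) =
      ∫ x, conj (UnitAddTorus.mFourier k x * (u x j : ℂ)) * (f x : ℂ) := by
    refine integral_congr_ae (Filter.Eventually.of_forall fun x => ?_)
    simp only [map_mul, UnitAddTorus.mFourier_neg, Complex.conj_ofReal]
    ring
  rw [e, ← h]
  refine tsum_congr fun l => ?_
  congr 2
  rw [fc]
  refine integral_congr_ae (Filter.Eventually.of_forall fun x => ?_)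
  simp only
  rw [← mul_assoc, ← UnitAddTorus.mFourier_add, neg_add_eq_sub]

end Drift

section Time

variable {T : ℝ} {v : ℝ → Torus → Fin 2 → ℝ}

/-- Slices the joint essential bound in time and space: for almost every time the spatial field is
measurable with one common bound. -/
lemma IsBoundedField.exists_bound (hv : IsBoundedField T v) :
    ∃ V : ℝ, ∀ᵐ r ∂volume.restrict (Set.Icc (0 : ℝ) T),
      AEStronglyMeasurable (v r) volume ∧ ∀ᵐ x, ‖v r x‖ ≤ V := by
  refine ⟨(eLpNorm (fun p : ℝ × Torus => v p.1 p.2) ⊤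
    ((volume.restrict (Set.Icc (0 : ℝ) T)).prod (volume : Measure Torus))).toReal, ?_⟩
  have h1 := hv.1.prodMk_left
  have h2 := Measure.ae_ae_of_ae_prod (ae_le_eLpNormEssSup (f := fun p : ℝ × Torus => v p.1 p.2)
    (μ := (volume.restrict (Set.Icc (0 : ℝ) T)).prod (volume : Measure Torus)))
  filter_upwards [h1, h2] with r hr1 hr2
  refine ⟨hr1, ?_⟩
  filter_upwards [hr2] with x hx
  have hx' := ENNReal.toReal_mono (by rw [← eLpNorm_exponent_top]; exact hv.2.ne) hx
  rwa [toReal_enorm, ← eLpNorm_exponent_top] at hx'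

lemma IsBoundedField.aemeasurable_coeff (hv : IsBoundedField T v) (m : Freq) (j : Fin 2) :
    AEMeasurable (fun r => ∫ x, UnitAddTorus.mFourier m x * (v r x j : ℂ))
      (volume.restrict (Set.Icc (0 : ℝ) T)) := by
  have h : AEStronglyMeasurable (fun p : ℝ × Torus => UnitAddTorus.mFourier m p.2 *
      (v p.1 p.2 j : ℂ)) ((volume.restrict (Set.Icc (0 : ℝ) T)).prod (volume : Measure Torus)) :=
    (Continuous.aestronglyMeasurable (by fun_prop)).mul
      ((show Continuous fun y : Fin 2 → ℝ => (y j : ℂ) by fun_prop).comp_aestronglyMeasurable hv.1)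
  exact h.integral_prod_right'.aemeasurable

end Time

/-! ### The Fourier coefficients of weak solutions -/

section Weak

variable {ν T : ℝ} {v : ℝ → Torus → Fin 2 → ℝ} {ρ : ℝ → ProbabilityMeasure Torus}

/-- Weak convergence is tested against real functions, so the real and imaginary parts are recovered
from the multiples `1` and `-I` of the character. -/
lemma continuous_mc (k : Freq) :
    Continuous fun γ : ProbabilityMeasure Torus => mc (γ : Measure Torus) k := by
  have h : ∀ c : ℂ, Continuous fun γ : ProbabilityMeasure Torus => ∫ x, chi c (-k) x ∂(γ : Measure Torus) :=
    fun c => by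
      let F : BoundedContinuousFunction Torus ℝ := BoundedContinuousFunction.mkOfCompact
        ⟨chi c (-k), by unfold chi; fun_prop⟩
      exact continuous_iff_continuousAt.2 fun γ =>
        (ProbabilityMeasure.tendsto_iff_forall_integral_tendsto.1 Filter.tendsto_id) F
  have h1 := h 1
  have h2 := h (-Complex.I)
  simp only [integral_chi] at h1 h2
  have e : (fun γ : ProbabilityMeasure Torus => mc (γ : Measure Torus) k) =
      fun γ : ProbabilityMeasure Torus => ((1 * mc (γ : Measure Torus) k).re : ℂ) +
        ((-Complex.I * mc (γ : Measure Torus) k).re : ℂ) * Complex.I := by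
    funext γ
    rw [one_mul, neg_mul, Complex.neg_re, Complex.I_mul_re, neg_neg, Complex.re_add_im]
  rw [e]
  exact (Complex.continuous_ofReal.comp h1).add
    ((Complex.continuous_ofReal.comp h2).mul continuous_const)

lemma IsWeakSolution.continuousOn_mc (hρ : IsWeakSolution ν T v ρ) (k : Freq) :
    ContinuousOn (fun t => mc (ρ t) k) (Set.Icc 0 T) :=
  (continuous_mc k).comp_continuousOn hρ.continuousOn

lemma IsWeakSolution.aemeasurable_mc (hρ : IsWeakSolution ν T v ρ) (k : Freq) :
    AEMeasurable (fun t => mc (ρ t) k) (volume.restrict (Set.Icc 0 T)) :=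
  (hρ.continuousOn_mc k).aemeasurable measurableSet_Icc

lemma IsWeakSolution.exists_Q_le (hρ : IsWeakSolution ν T v ρ) :
    ∃ q : ℝ, ∀ t ∈ Set.Icc 0 T, energy (ρ t) + ((ν / 2 : ℝ) : EReal) *
      ((∫⁻ s in Set.Icc (0 : ℝ) t, sqDistToOne (ρ s) : ℝ≥0∞) : EReal) ≤ (q : EReal) := by
  obtain ⟨q, hq, -⟩ := EReal.lt_iff_exists_real_btwn.1 hρ.Q_lt_top
  refine ⟨q, fun t ht => le_trans ?_ hq.le⟩
  exact le_iSup₂ (f := fun t (_ : t ∈ Set.Icc (0 : ℝ) T) => energy (ρ t) + ((ν / 2 : ℝ) : EReal) *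
      ((∫⁻ s in Set.Icc (0 : ℝ) t, sqDistToOne (ρ s) : ℝ≥0∞) : EReal)) t ht

lemma IsWeakSolution.lintegral_sqDistToOne (hν : 0 < ν) (hT : 0 < T)
    (hρ : IsWeakSolution ν T v ρ) : ∫⁻ s in Set.Icc (0 : ℝ) T, sqDistToOne (ρ s) ≠ ⊤ := by
  obtain ⟨q, hq⟩ := hρ.exists_Q_le
  obtain ⟨C, hC⟩ := exists_le_energy
  intro h
  have h1 := hq T ⟨hT.le, le_rfl⟩
  rw [h, EReal.coe_ennreal_top, EReal.coe_mul_top_of_pos (by positivity)] at h1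
  -- In the extended reals `⊥ + ⊤ = ⊥`, so the lower bound for the energy is indispensable:
  -- otherwise infinite dissipation could be masked.
  rw [EReal.add_top_of_ne_bot (fun hb => by
    have := hC (ρ T); rw [hb] at this; exact absurd this (by simp))] at h1
  exact absurd h1 (by simp)

lemma IsWeakSolution.lintegral_nsq (hν : 0 < ν) (hT : 0 < T) (hρ : IsWeakSolution ν T v ρ) :
    ∫⁻ t in Set.Icc 0 T, nsq (mc (ρ t)) ≠ ⊤ := by
  refine ne_top_of_le_ne_top ?_ (lintegral_mono fun t => nsq_mc_le (ρ t))
  rw [lintegral_add_left measurable_const]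
  exact ENNReal.add_ne_top.2 ⟨by simp, hρ.lintegral_sqDistToOne hν hT⟩

lemma IsWeakSolution.ae_density (hν : 0 < ν) (hT : 0 < T) (hρ : IsWeakSolution ν T v ρ) :
    ∀ᵐ t ∂volume.restrict (Set.Icc 0 T), ∃ f, IsDensity (ρ t) f := by
  filter_upwards [ae_lt_top' (aemeasurable_nsq hρ.aemeasurable_mc) (hρ.lintegral_nsq hν hT)]
    with t ht
  obtain ⟨f, h1, h2, h3, h4⟩ := exists_density ht.ne
  exact ⟨f, h1, h2, h3, h4⟩

/-- At a time with a square integrable density, `hsq` is twice the energy, and the energy is at most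
the bound for `Q` since the dissipation term is nonnegative. -/
lemma IsWeakSolution.exists_hsq_le (hν : 0 < ν) (hT : 0 < T) (hρ : IsWeakSolution ν T v ρ) :
    ∃ M : ℝ≥0∞, M ≠ ⊤ ∧ ∀ᵐ t ∂volume.restrict (Set.Icc 0 T), hsq (mc (ρ t)) ≤ M := by
  obtain ⟨q, hq⟩ := hρ.exists_Q_le
  refine ⟨ENNReal.ofReal (2 * q), ENNReal.ofReal_ne_top, ?_⟩
  filter_upwards [hρ.ae_density hν hT, ae_restrict_mem measurableSet_Icc] with t ⟨f, hf⟩ ht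
  have h1 : energy (ρ t) ≤ (q : EReal) := by
    refine le_trans (le_add_of_nonneg_right ?_) (hq t ht)
    exact mul_nonneg (by exact_mod_cast (half_pos hν).le) (EReal.coe_ennreal_nonneg _)
  rw [energy_eq hf, EReal.coe_le_coe_iff] at h1
  rw [← ENNReal.ofReal_toReal (ne_top_of_le_ne_top hf.nsq_ne_top (hsq_le_nsq _))]
  exact ENNReal.ofReal_le_ofReal (by linarith)

lemma IsWeakSolution.integrable_drift (hν : 0 < ν) (hT : 0 < T) (hv : IsBoundedField T v)
    (hρ : IsWeakSolution ν T v ρ) (k : Freq) :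
    IntegrableOn (fun r => drift (v r) (ρ r) k) (Set.Icc 0 T) := by
  obtain ⟨V, hV⟩ := hv.exists_bound
  have hm : AEMeasurable (fun r => drift (v r) (ρ r) k) (volume.restrict (Set.Icc 0 T)) := by
    refine Finset.aemeasurable_fun_sum _ fun j _ => AEMeasurable.const_mul ?_ _
    -- The measure varies with time along with the field, so measurability in time is not immediate.
    -- Parseval rewrites the pairing as a series of products of functions each measurable in time.
    have h : AEMeasurable (fun r => ∑' l,
        conj (∫ x, UnitAddTorus.mFourier (k - l) x * (v r x j : ℂ)) * mc (ρ r) l)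
        (volume.restrict (Set.Icc 0 T)) :=
      AEMeasurable.tsum fun l =>
        (Complex.continuous_conj.measurable.comp_aemeasurable
          (hv.aemeasurable_coeff (k - l) j)).mul (hρ.aemeasurable_mc l)
    refine h.congr ?_
    filter_upwards [hV, hρ.ae_density hν hT] with r hr ⟨f, hf⟩
    exact (integral_mFourier_coord_eq hr.1 hr.2 hf k j).symm
  refine ⟨hm.aestronglyMeasurable,
    HasFiniteIntegral.of_bounded (C := ∑ j, ‖(2 * Real.pi * Complex.I * k j : ℂ)‖ * V) ?_⟩
  filter_upwards [hV, hρ.ae_density hν hT] with r hr ⟨f, hf⟩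
  exact norm_drift_le (hf.ac.ae_le hr.2) k

/-- The evolution equation of the Fourier coefficients of a weak solution. -/
lemma IsWeakSolution.mc_sub_eq (hν : 0 < ν) (hT : 0 < T) (hv : IsBoundedField T v)
    (hρ : IsWeakSolution ν T v ρ) (k : Freq) {t : ℝ} (ht : t ∈ Set.Icc 0 T) :
    IntervalIntegrable (fun r => -((ν * lam k : ℝ) : ℂ) * mc (ρ r) k + nonlin (mc (ρ r)) k +
      drift (v r) (ρ r) k) volume 0 t ∧
    mc (ρ t) k - mc (ρ 0) k = ∫ r in (0 : ℝ)..t, (-((ν * lam k : ℝ) : ℂ) * mc (ρ r) k +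
      nonlin (mc (ρ r)) k + drift (v r) (ρ r) k) := by
  have h0T : (0 : ℝ) ∈ Set.Icc 0 T := ⟨le_rfl, hT.le⟩
  have sub : ∀ {F : ℝ → ℂ}, IntegrableOn F (Set.Icc 0 T) → IntervalIntegrable F volume 0 t :=
    fun hF => intervalIntegrable_of_mem_Icc hF h0T ht
  have i1 := sub (hρ.continuousOn_mc k).integrableOn_Icc
  have i2 := sub (integrable_nonlin hρ.aemeasurable_mc (hρ.lintegral_nsq hν hT) k)
  have i3 := sub (hρ.integrable_drift hν hT hv k)
  have i4 := ((i1.const_mul (-((ν * lam k : ℝ) : ℂ))).add i2).add i3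
  refine ⟨i4, ?_⟩
  rcases ht.1.eq_or_lt with rfl | htpos
  · simp
  have hres : ∀ {P : ℝ → Prop}, (∀ᵐ r ∂volume.restrict (Set.Icc 0 T), P r) →
      ∀ᵐ r, r ∈ Set.uIoc 0 t → P r := fun hP => by
    rw [← ae_restrict_iff' measurableSet_uIoc]
    refine ae_restrict_of_ae_restrict_of_subset ?_ hP
    rw [Set.uIoc_of_le ht.1]
    exact Set.Ioc_subset_Icc_self.trans (Set.Icc_subset_Icc_right ht.2)
  obtain ⟨V, hV⟩ := hv.exists_bound
  have re_mul : ∀ (c : ℂ) {F : ℝ → ℂ}, IntervalIntegrable F volume 0 t →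
      ∫ r in (0 : ℝ)..t, (c * F r).re = (c * ∫ r in (0 : ℝ)..t, F r).re := fun c F hF => by
    rw [intervalIntegral.integral_of_le ht.1, intervalIntegral.integral_of_le ht.1]
    exact re_const_mul_integral hF.1 c
  -- Test functions are real, so the complex identity is obtained from its real part after
  -- multiplication by `c = 1` and `c = -I`. The tests do not depend on time, and the time
  -- derivative term drops out.
  have key : ∀ c : ℂ, (c * (mc (ρ t) k - mc (ρ 0) k)).re =
      (c * ∫ r in (0 : ℝ)..t, (-((ν * lam k : ℝ) : ℂ) * mc (ρ r) k +
        nonlin (mc (ρ r)) k + drift (v r) (ρ r) k)).re := fun c => by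
    have h := hρ.weak_eq (fun _ => chi c (-k)) (isTestFunction_chi c (-k)) 0 t le_rfl htpos ht.2
    have e2 : ∀ r, ∫ x, lap (chi c (-k)) x ∂(ρ r : Measure Torus) =
        (-(lam k : ℂ) * c * mc (ρ r) k).re := fun r => by
      rw [← integral_chi]
      simp only [lap_chi, lam_neg]
    have e3 : ∫ r in (0 : ℝ)..t, pairR (grad (chi c (-k))) (ρ r) =
        ∫ r in (0 : ℝ)..t, (c * nonlin (mc (ρ r)) k).re := by
      refine intervalIntegral.integral_congr_ae ?_
      filter_upwards [hres (hρ.ae_density hν hT)] with r hr hrt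
      obtain ⟨f, hf⟩ := hr hrt
      exact pairR_chi hf c k
    have e4 : ∫ r in (0 : ℝ)..t, ∫ x, grad (chi c (-k)) x ⬝ᵥ v r x ∂(ρ r : Measure Torus) =
        ∫ r in (0 : ℝ)..t, (c * drift (v r) (ρ r) k).re := by
      refine intervalIntegral.integral_congr_ae ?_
      filter_upwards [hres (hρ.ae_density hν hT), hres hV] with r hr hr2 hrt
      obtain ⟨f, hf⟩ := hr hrt
      exact integral_grad_chi ((hr2 hrt).1.mono_ac hf.ac) (hf.ac.ae_le (hr2 hrt).2) c k
    simp only [deriv_const, integral_zero, intervalIntegral.integral_zero, zero_add, e2, e3, e4,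
      integral_chi] at h
    rw [re_mul _ i1, re_mul _ i2, re_mul _ i3] at h
    rw [mul_sub, Complex.sub_re, h, intervalIntegral.integral_add
      ((i1.const_mul (-((ν * lam k : ℝ) : ℂ))).add i2) i3, intervalIntegral.integral_add
      (i1.const_mul (-((ν * lam k : ℝ) : ℂ))) i2, intervalIntegral.integral_const_mul,
      ← Complex.re_ofReal_mul, ← Complex.add_re, ← Complex.add_re]
    congr 1
    push_cast
    ring
  have k1 := key 1
  have k2 := key (-Complex.I)
  rw [one_mul, one_mul] at k1
  rw [neg_mul Complex.I, neg_mul Complex.I, Complex.neg_re, Complex.neg_re, Complex.I_mul_re,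
    Complex.I_mul_re, neg_neg, neg_neg] at k2
  exact Complex.ext k1 k2

/-- Weak solutions are determined by their initial values. -/
theorem IsWeakSolution.eq_of_initial_eq (hν : 0 < ν) (hT : 0 < T) (hv : IsBoundedField T v)
    {ρ' : ℝ → ProbabilityMeasure Torus} (hρ : IsWeakSolution ν T v ρ)
    (hρ' : IsWeakSolution ν T v ρ') (h0 : ρ 0 = ρ' 0) : ∀ t ∈ Set.Icc 0 T, ρ t = ρ' t := by
  obtain ⟨V, hV⟩ := hv.exists_bound
  obtain ⟨M, hMt, hM⟩ := hρ.exists_hsq_le hν hT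
  obtain ⟨M', hMt', hM'⟩ := hρ'.exists_hsq_le hν hT
  have h := coeff_eq_of_integral_eq (T := T) hν (a := fun t => mc (ρ t)) (b := fun t => mc (ρ' t))
    (g := fun t k => drift (v t) (ρ t) k - drift (v t) (ρ' t) k)
    (M := max M M') (W := 4 * ENNReal.ofReal V ^ 2)
    (by simp [hMt, hMt']) (ENNReal.mul_ne_top (by simp) (by simp))
    hρ.continuousOn_mc hρ'.continuousOn_mc
    (fun t _ => by rw [mc_zero, mc_zero]) (fun t _ k => mc_neg _ k)
    (hρ.lintegral_nsq hν hT) (hρ'.lintegral_nsq hν hT)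
    (hM.mono fun t ht => ht.trans (le_max_left _ _))
    (hM'.mono fun t ht => ht.trans (le_max_right _ _))
    (fun k => (hρ.integrable_drift hν hT hv k).sub (hρ'.integrable_drift hν hT hv k))
    (by
      filter_upwards [hV, hρ.ae_density hν hT, hρ'.ae_density hν hT] with t ht ⟨f, hf⟩ ⟨f', hf'⟩
      exact hsq_drift_sub_le ht.1 ht.2 hf hf')
    (fun t ht k => by
      have e := hρ.mc_sub_eq hν hT hv k ht
      have e' := hρ'.mc_sub_eq hν hT hv k ht
      have e0 : mc (ρ t) k - mc (ρ' t) k =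
          (mc (ρ t) k - mc (ρ 0) k) - (mc (ρ' t) k - mc (ρ' 0) k) := by rw [h0]; ring
      rw [e0, e.2, e'.2, ← intervalIntegral.integral_sub e.1 e'.1]
      refine intervalIntegral.integral_congr fun r _ => ?_
      ring)
  intro t ht
  exact Subtype.ext (measure_eq_of_mc_eq (μ := (ρ t : Measure Torus))
    (μ' := (ρ' t : Measure Torus)) fun k => congrFun (h t ht) k)

end Weak

end Vortex

end

theorem lemma4p1 (ν : ℝ) (hν : 0 < ν) (T : ℝ) (hT : 0 < T)
    (γ : ProbabilityMeasure Vortex.Torus) (hγ : Vortex.energy γ < ⊤)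
    (v : ℝ → Vortex.Torus → Fin 2 → ℝ) (hv : Vortex.IsBoundedField T v)
    (ρ ρ' : ℝ → ProbabilityMeasure Vortex.Torus)
    (hρ : Vortex.IsWeakSolution ν T v ρ) (hρ' : Vortex.IsWeakSolution ν T v ρ')
    (h0 : ρ 0 = γ) (h0' : ρ' 0 = γ) :
    ∀ t ∈ Set.Icc (0 : ℝ) T, ρ' t = ρ t := by
  exact Vortex.IsWeakSolution.eq_of_initial_eq hν hT hv hρ' hρ (h0'.trans h0.symm)
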